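/- **Setting.** Let $t\in[0,\infty)\mapsto \dot C_t$ be a bounded càdlàg function with values in the positive semidefinite $N\times N$ matrices, integrable on $[0,\infty)$, and let $C_t=\int_0^t\dot C_u\,du$, $C_\infty=\int_0^\infty \dot C_u\,du$; assume that $\dot C_t$ is the derivative of $C_t$ except at isolated points $t>0$. Let $X\subset\mathbb R^N$ be the image of $C_\infty$; all matrices below are regarded as operators on $X$, and $\geq$ is the order of quadratic forms. Let $\mathsf E_C$ be the expectation of the centred Gaussian measure with covariance $C$. Let $V_0:X\to\mathbb R$ be measurable and bounded below. For $\varphi\in X$ and $F:X\to\mathbb R$ bounded and measurable put $$V_t(\varphi)=-\log \mathsf E_{C_t}[e^{-V_0(\varphi+\zeta)}]\quad (t\in[0,\infty]),\qquad \boldsymbol P_{s,t}F(\varphi)=e^{V_t(\varphi)}\,\mathsf E_{C_t-C_s}[e^{-V_s(\varphi+\zeta)}F(\varphi+\zeta)],$$ $$\mathbb E_{\nu_0}[F]=\frac{\mathsf E_{C_\infty}[e^{-V_0(\zeta)}F(\zeta)]}{\mathsf E_{C_\infty}[e^{-V_0(\zeta)}]},\qquad \mathbb E_{\nu_t}[F]=e^{V_\infty(0)}\,\mathsf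 E_{C_\infty-C_t}[e^{-V_t(\zeta)}F(\zeta)],\qquad \mathbb E_{\mu_t^\varphi}[F]=\frac{\mathsf E_{C_t}[e^{-V_0(\varphi+\zeta)}F(\varphi+\zeta)]}{\mathsf E_{C_t}[e^{-V_0(\varphi+\zeta)}]}.$$ Write $\Phi(x)=x\log x$, $\operatorname{Ent}_\mu(F)=\mathbb E_\mu[\Phi(F)]-\Phi(\mathbb E_\mu[F])$, $(u)_A^2=(u,Au)$, $\operatorname{cov}(\mu)$ for the covariance matrix of $\mu$, and $T_h\mu$ for the probability measure with density proportional to $e^{(h,\zeta)}$ with respect to $\mu$. **(1) Entropic stability from a covariance bound.** Let $\mu$ be a probability measure on $X$ with all exponential moments, $\dot\Sigma$ a positive semidefinite operator on $X$, $\alpha>0$, and assume $\dot\Sigma\operatorname{cov}(T_h\mu)\dot\Sigma\le\alpha\dot\Sigma$ for all $h\in X$. Then for every $F\ge0$ with $\mathbb E_\mu[F]=1$ and $\operatorname{Ent}_\mu(F)<\infty$, the function $F\zeta$ is $\mu$-integrable and $$\tfrac12\big(\mathbb E_\mu[F\zeta]-\mathbb E_\mu[\zeta]\big)^2_{\dot\Sigma}\le\alpha\operatorname{Ent}_\mu(F).$$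 **(2) Entropic stability of the fluctuation measures.** Let $t>0$ be such that $C_t$ is invertible on $X$, let $\alpha_t>0$, and set $\dot\Sigma_t=C_t^{-1}\dot C_tC_t^{-1}$. Then $V_t$ is $C^2$, and the conditions $$\forall\varphi\in X:\ \dot C_t\operatorname{Hess}V_t(\varphi)\dot C_t-\dot C_tC_t^{-1}\dot C_t\ge-\alpha_t\dot C_t \qquad\text{and}\qquad \forall\varphi\in X:\ \dot\Sigma_t\operatorname{cov}(\mu_t^\varphi)\dot\Sigma_t\le\alpha_t\dot\Sigma_t$$ are equivalent. If they hold, then for all bounded measurable $F:X\to[0,\infty)$ the function $\sqrt{\boldsymbol P_{0,t}F}$ is differentiable and, for all $\varphi\in X$, $\boldsymbol P_{0,t}F(\varphi)=\mathbb E_{\mu_t^\varphi}[F]$ and $$2\big(\nabla\sqrt{\boldsymbol P_{0,t}F}\big)^2_{\dot C_t}(\varphi)\le\alpha_t\operatorname{Ent}_{\mu_t^\varphi}(F)=\alpha_t\big[\boldsymbol P_{0,t}\Phi(F)(\varphi)-\Phi(\boldsymbol P_{0,t}F(\varphi))\big].$$ **(3) Entropy contraction.** Let $s>0$ be such that $C_s$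 is invertible on $X$, and assume that the conditions in (2) hold for all $t>s$ with numbers $\alpha_t>0$ such that $t\mapsto\alpha_t$ is integrable on $(s,\infty)$. Then for all bounded measurable $F:X\to[0,\infty)$, the function $\varphi\mapsto\operatorname{Ent}_{\mu_s^\varphi}(F)$ is $\nu_s$-integrable and $$\operatorname{Ent}_{\nu_0}(F)\le e^{\int_s^\infty\alpha_u\,du}\;\mathbb E_{\nu_s}\big[\operatorname{Ent}_{\mu_s^\varphi}(F)\big].$$ -/

import Mathlib

open MeasureTheory ProbabilityTheory Filter Topology
open scoped RealInnerProductSpace Ring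

noncomputable section

namespace Polchinski

/-! ### General notions on a finite-dimensional real inner product space -/

section General

variable {E : Type*} [NormedAddCommGroup E] [InnerProductSpace ℝ E] [FiniteDimensional ℝ E]

/-- The Hessian of `f` at `x`, as an operator: the derivative of the gradient. -/
def hessian (f : E → ℝ) (x : E) : E →L[ℝ] E := fderiv ℝ (gradient f) x

/-- The quadratic form `(u)_A² = (u, A u)`. -/
def quadForm (A : E →L[ℝ] E) (u : E) : ℝ := ⟪u, A u⟫

variable [MeasurableSpace E] [BorelSpace E]

/-- The (centred) covariance matrix of `μ`, as an operator: `⟪cov μ x, y⟫` is the covariance of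
`⟪x, ζ⟫` and `⟪y, ζ⟫` under `μ`. -/
def cov (μ : Measure E) : E →L[ℝ] E :=
  InnerProductSpace.continuousLinearMapOfBilin (covarianceBilin μ)

/-- The exponential tilt `T_h μ`, with density proportional to `exp (h, ζ)`. -/
def tilt (h : E) (μ : Measure E) : Measure E := μ.tilted fun ζ => ⟪h, ζ⟫

end General

/-- `Φ(x) = x log x`. -/
def Phi (x : ℝ) : ℝ := x * Real.log x

/-- The entropy `Ent_μ(F) = E_μ[Φ(F)] - Φ(E_μ[F])`. -/
def ent {Ω : Type*} [MeasurableSpace Ω] (μ : Measure Ω) (F : Ω → ℝ) : ℝ :=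
  (∫ x, Phi (F x) ∂μ) - Phi (∫ x, F x ∂μ)

/-! ### Covariance decompositions -/

section Covariance

variable {N : ℕ}

/-- `C_t = ∫₀ᵗ Ċ_u du`. -/
def covAt (Cdot : ℝ → Matrix (Fin N) (Fin N) ℝ) (t : ℝ) : Matrix (Fin N) (Fin N) ℝ :=
  Matrix.of fun i j => ∫ u in (0 : ℝ)..t, Cdot u i j

/-- `C_∞ = ∫₀^∞ Ċ_u du`. -/
def covInfty (Cdot : ℝ → Matrix (Fin N) (Fin N) ℝ) : Matrix (Fin N) (Fin N) ℝ :=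
  Matrix.of fun i j => ∫ u in Set.Ioi (0 : ℝ), Cdot u i j

/-- The times `t > 0` at which `Ċ_t` is not the derivative of `C_t`. -/
def exceptionalTimes (Cdot : ℝ → Matrix (Fin N) (Fin N) ℝ) : Set ℝ :=
  {t | 0 < t ∧ ¬ ∀ i j, HasDerivAt (fun u => covAt Cdot u i j) (Cdot t i j) t}

/-- `Ċ` defines a covariance decomposition: it is a bounded cadlag function on `[0, ∞)` with
positive semidefinite values, integrable on `[0, ∞)`, and it is the derivative of
`C_t = ∫₀ᵗ Ċ_u du` except at isolated points. Only the values at times `t ≥ 0` matter. -/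
structure IsCovarianceDecomposition (Cdot : ℝ → Matrix (Fin N) (Fin N) ℝ) : Prop where
  posSemidef : ∀ t, 0 ≤ t → (Cdot t).PosSemidef
  bounded : ∃ K : ℝ, ∀ t, 0 ≤ t → ∀ i j, |Cdot t i j| ≤ K
  right_continuous : ∀ t, 0 ≤ t → ContinuousWithinAt Cdot (Set.Ici t) t
  left_limits : ∀ t, 0 < t → ∃ L, Tendsto Cdot (𝓝[<] t) (𝓝 L)
  integrable : ∀ i j, IntegrableOn (fun t => Cdot t i j) (Set.Ioi 0)
  isolated : ∀ t ∈ exceptionalTimes Cdot, ∀ᶠ u in 𝓝[≠] t, u ∉ exceptionalTimes Cdot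

/-- The space `X ⊆ ℝᴺ`: the image of `C_∞`. -/
def fieldSpace (Cdot : ℝ → Matrix (Fin N) (Fin N) ℝ) : Submodule ℝ (EuclideanSpace ℝ (Fin N)) :=
  LinearMap.range (Matrix.toEuclideanLin (covInfty Cdot))

/-- The matrix `A` as an operator on the subspace `X`. (For matrices that map `X` to itself, such
as `C_t` and `Ċ_t` on the image of `C_∞`, the projection does nothing.) -/
def onSubspace (X : Submodule ℝ (EuclideanSpace ℝ (Fin N))) (A : Matrix (Fin N) (Fin N) ℝ) :
    X →L[ℝ] X :=
  X.orthogonalProjectionOnto ∘L (Matrix.toEuclideanCLM (𝕜 := ℝ) A) ∘L X.subtypeL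

/-- The centred Gaussian measure with covariance `A`, as a measure on the subspace `X`. (For `A`
whose image lies in `X` the Gaussian measure on `ℝᴺ` is supported on `X`, and the projection does
nothing.) -/
def gaussianOn (X : Submodule ℝ (EuclideanSpace ℝ (Fin N))) (A : Matrix (Fin N) (Fin N) ℝ) :
    Measure X :=
  (multivariateGaussian 0 A).map X.orthogonalProjectionOnto

end Covariance

/-! ### The Polchinski flow -/

section Flow

variable {N : ℕ} (Cdot : ℝ → Matrix (Fin N) (Fin N) ℝ)

/-- The operator `Ċ_t` on `X`. -/
def opCdot (t : ℝ) : fieldSpace Cdot →L[ℝ] fieldSpace Cdot :=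
  onSubspace (fieldSpace Cdot) (Cdot t)

/-- The operator `C_t` on `X`. -/
def opC (t : ℝ) : fieldSpace Cdot →L[ℝ] fieldSpace Cdot :=
  onSubspace (fieldSpace Cdot) (covAt Cdot t)

/-- The operator `Σ̇_t = C_t⁻¹ Ċ_t C_t⁻¹` on `X`. -/
def opSigmaDot (t : ℝ) : fieldSpace Cdot →L[ℝ] fieldSpace Cdot :=
  (opC Cdot t)⁻¹ʳ * opCdot Cdot t * (opC Cdot t)⁻¹ʳ

variable (V₀ : fieldSpace Cdot → ℝ)

/-- The renormalised potential `V_t(φ) = - log E_{C_t}[exp(-V₀(φ + ζ))]`. -/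
def renormPotential (t : ℝ) (φ : fieldSpace Cdot) : ℝ :=
  - Real.log (∫ ζ, Real.exp (-V₀ (φ + ζ)) ∂gaussianOn (fieldSpace Cdot) (covAt Cdot t))

/-- The renormalised potential at time infinity, `V_∞(φ) = - log E_{C_∞}[exp(-V₀(φ + ζ))]`. -/
def renormPotentialInfty (φ : fieldSpace Cdot) : ℝ :=
  - Real.log (∫ ζ, Real.exp (-V₀ (φ + ζ)) ∂gaussianOn (fieldSpace Cdot) (covInfty Cdot))

/-- The Polchinski semigroup
`P_{s,t} F(φ) = exp(V_t(φ)) E_{C_t - C_s}[exp(-V_s(φ + ζ)) F(φ + ζ)]`. -/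
def semigroup (s t : ℝ) (F : fieldSpace Cdot → ℝ) (φ : fieldSpace Cdot) : ℝ :=
  Real.exp (renormPotential Cdot V₀ t φ) *
    ∫ ζ, Real.exp (-renormPotential Cdot V₀ s (φ + ζ)) * F (φ + ζ)
      ∂gaussianOn (fieldSpace Cdot) (covAt Cdot t - covAt Cdot s)

/-- The measure `ν₀`, with density proportional to `exp(-V₀)` with respect to the Gaussian measure
of covariance `C_∞`. -/
def nuZero : Measure (fieldSpace Cdot) :=
  (gaussianOn (fieldSpace Cdot) (covInfty Cdot)).tilted fun ζ => -V₀ ζ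

/-- The renormalised measure `ν_t`:
`E_{ν_t}[F] = exp(V_∞(0)) E_{C_∞ - C_t}[exp(-V_t(ζ)) F(ζ)]`. -/
def nu (t : ℝ) : Measure (fieldSpace Cdot) :=
  (gaussianOn (fieldSpace Cdot) (covInfty Cdot - covAt Cdot t)).withDensity fun ζ =>
    ENNReal.ofReal (Real.exp (renormPotentialInfty Cdot V₀ 0) *
      Real.exp (-renormPotential Cdot V₀ t ζ))

/-- The fluctuation measure `μ_t^φ`:
`E_{μ_t^φ}[F] = E_{C_t}[exp(-V₀(φ + ζ)) F(φ + ζ)] / E_{C_t}[exp(-V₀(φ + ζ))]`. -/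
def fluctuation (t : ℝ) (φ : fieldSpace Cdot) : Measure (fieldSpace Cdot) :=
  ((gaussianOn (fieldSpace Cdot) (covAt Cdot t)).map fun ζ => φ + ζ).tilted fun ζ => -V₀ ζ

/-- The Hessian condition
`Ċ_t Hess V_t(φ) Ċ_t - Ċ_t C_t⁻¹ Ċ_t ≥ -a Ċ_t` for all `φ ∈ X`. -/
def HessianCondition (t a : ℝ) : Prop :=
  ∀ φ : fieldSpace Cdot,
    -(a • opCdot Cdot t) ≤
      opCdot Cdot t * hessian (renormPotential Cdot V₀ t) φ * opCdot Cdot t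
        - opCdot Cdot t * (opC Cdot t)⁻¹ʳ * opCdot Cdot t

/-- The covariance condition `Σ̇_t cov(μ_t^φ) Σ̇_t ≤ a Σ̇_t` for all `φ ∈ X`. -/
def CovarianceCondition (t a : ℝ) : Prop :=
  ∀ φ : fieldSpace Cdot,
    opSigmaDot Cdot t * cov (fluctuation Cdot V₀ t φ) * opSigmaDot Cdot t ≤ a • opSigmaDot Cdot t

end Flow

end Polchinski

end

/-! Everything rests on the Cameron-Martin formula. When $C_t$ is invertible, shifting the Gaussian
by $φ$ amounts to tilting it by $(C_t^{-1}φ, ζ)$. So $μ_t^φ$ is the tilt, by $h = C_t^{-1}φ$, of the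
single measure $μ_t^0$ (`map_add_tilted_eq_tilt`), and $V_t(φ)$ equals $\frac12(φ, C_t^{-1}φ) - \log
Λ(C_t^{-1}φ)$ up to a constant, where $Λ$ is the Laplace transform of $μ_t^0$. Although $V_0$ is
only measurable, $\log Λ$ is smooth, and its first two derivatives are the mean and the covariance
of the tilted measure. Hence $\mathrm{Hess}\,V_t = C_t^{-1} - C_t^{-1}\mathrm{cov}(μ_t^φ)C_t^{-1}$,
and the Hessian and covariance conditions differ by conjugation with $C_t$
(`hessian_le_iff_cov_le`).

Entropic stability (`half_quadForm_le_ent`) is a duality argument. The Gibbs inequality bounds $(u,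
E[Fζ])$ by the entropy plus $\log E[e^{(u,ζ)}]$; the covariance bound, integrated twice along the
line through $u = \dot Σ v$, bounds the logarithm; then $v$ is optimised. The gradient estimate is
this inequality for $F/P_{0,t}F$, because $∇P_{0,t}F = C_t^{-1}(E[Fζ] - E[F]E[ζ])$.

For the contraction put $z_t = e^{-V_t}$ and $p_t = P_{0,t}F$. The $z_t$-weighted average of
$\mathrm{Ent}_{μ_t^φ}(F)$ is $W - E_{C_∞-C_t}[z_tΦ(p_t)]$ with $W$ independent of $t$
(`averagedEntropy_eq`). Increments of the second term are averages of Jensen gaps of $(f,z) ↦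
f\log(f/z)$ under the noise of covariance $C_u - C_t$ (`flowEntropy_sub`). A second-order expansion
of the Bregman divergence of $Φ$ then gives the right derivative $-E[\frac{z_t}{2p_t}(∇p_t)^2_{\dot
C_t}]$ directly, without any differential equation for $V_t$. The gradient estimate turns this into
a differential inequality, and Gronwall from $s$ to $∞$ concludes, since at infinity the outer
Gaussian collapses to a Dirac mass and what remains is the entropy under $ν_0$.

The domination needed for these limits cannot come from a lower bound on $z_t$, because $V_0$ may be
unbounded above. It comes instead from the Hellinger distance of shifted Gaussians: $\sqrt{z_s}$ and
$\sqrt{z_sp_s}$ are Lipschitz, and Gaussian averaging preserves the constants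
(`GapProfile.average`), so the bounds are uniform in $t ≥ s$. The argument is run for $F$ bounded
away from zero, and then applied to $F + ε$ with $ε → 0$. -/

set_option linter.unusedSectionVars false

noncomputable section

namespace Polchinski

/-! ### Centred Gaussian measures and the Cameron-Martin formula. -/

section CentredGaussian

variable {E : Type*} [NormedAddCommGroup E] [InnerProductSpace ℝ E] [FiniteDimensional ℝ E]
  [MeasurableSpace E] [BorelSpace E]

/-- `γ` is the centred Gaussian measure with covariance operator `A`. -/
structure IsCentredGaussian (γ : Measure E) (A : E →L[ℝ] E) : Prop where
  isGaussian : IsGaussian γ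
  integral_id : ∫ x, x ∂γ = 0
  covarianceBilin_eq : ∀ x y, covarianceBilin γ x y = ⟪x, A y⟫

/-- `μ` has all exponential moments. -/
def HasExpMoments (μ : Measure E) : Prop :=
  ∀ a : ℝ, Integrable (fun x => Real.exp (a * ‖x‖)) μ

/-- Fernique's theorem makes $e^{C\|x\|^2}$ integrable for some $C > 0$, and completing the square
gives $a\|x\| ≤ a^2/(4C) + C\|x\|^2$. -/
theorem hasExpMoments_of_isGaussian (γ : Measure E) [IsGaussian γ] : HasExpMoments γ := by
  intro a
  obtain ⟨C, hC, hintegr⟩ := IsGaussian.exists_integrable_exp_sq γ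
  refine (hintegr.const_mul (Real.exp (a ^ 2 / (4 * C)))).mono' (by fun_prop) (ae_of_all _ fun x => ?_)
  rw [Real.norm_eq_abs, abs_of_pos (Real.exp_pos _), ← Real.exp_add]
  refine Real.exp_le_exp.2 ?_
  have h : a ^ 2 / (4 * C) + C * ‖x‖ ^ 2 - a * ‖x‖ = (a - 2 * C * ‖x‖) ^ 2 / (4 * C) := by
    field_simp
    ring
  have h2 : 0 ≤ (a - 2 * C * ‖x‖) ^ 2 / (4 * C) := by positivity
  linarith

namespace IsCentredGaussian

variable {γ γ' γ'' : Measure E} {A B : E →L[ℝ] E}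

theorem map_inner (h : IsCentredGaussian γ A) (v : E) :
    γ.map (fun x => ⟪v, x⟫) = gaussianReal 0 (⟪v, A v⟫).toNNReal := by
  have := h.isGaussian
  have h1 := IsGaussian.map_eq_gaussianReal (μ := γ) (innerSL ℝ v)
  have h2 : ∫ x, innerSL ℝ v x ∂γ = 0 := by
    rw [(innerSL ℝ v).integral_comp_comm IsGaussian.integrable_fun_id, h.integral_id, map_zero]
  have h3 : Var[innerSL ℝ v; γ] = ⟪v, A v⟫ := by
    rw [← h.covarianceBilin_eq, covarianceBilin_self IsGaussian.memLp_two_id]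
    rfl
  rw [h2, h3] at h1
  exact h1

theorem inner_nonneg (h : IsCentredGaussian γ A) (v : E) : 0 ≤ ⟪v, A v⟫ := by
  rw [← h.covarianceBilin_eq]
  exact covarianceBilin_self_nonneg v

theorem inner_comm (h : IsCentredGaussian γ A) (v w : E) : ⟪v, A w⟫ = ⟪w, A v⟫ := by
  rw [← h.covarianceBilin_eq, ← h.covarianceBilin_eq, covarianceBilin_comm]

theorem integral_exp_inner (h : IsCentredGaussian γ A) (v : E) :
    ∫ x, Real.exp ⟪v, x⟫ ∂γ = Real.exp (⟪v, A v⟫ / 2) := by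
  have := mgf_gaussianReal (h.map_inner v) 1
  simpa [mgf, h.inner_nonneg v] using this

theorem charFun_eq (h : IsCentredGaussian γ A) (v : E) :
    charFun γ v = Complex.exp (-(⟪v, A v⟫ : ℝ) / 2) := by
  have := h.isGaussian
  rw [IsGaussian.charFun_eq' v, h.covarianceBilin_eq]
  have h0 : (∫ x, id x ∂γ) = 0 := h.integral_id
  simp [h.integral_id, neg_div]

theorem conv_eq (h : IsCentredGaussian γ A) (h' : IsCentredGaussian γ' B)
    (h'' : IsCentredGaussian γ'' (A + B)) : γ ∗ γ' = γ'' := by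
  have := h.isGaussian
  have := h'.isGaussian
  have := h''.isGaussian
  refine Measure.ext_of_charFun (funext fun v => ?_)
  rw [charFun_conv, h.charFun_eq, h'.charFun_eq, h''.charFun_eq, ← Complex.exp_add]
  congr 1
  simp only [add_apply, inner_add_right, Complex.ofReal_add]
  ring

theorem hasExpMoments (h : IsCentredGaussian γ A) : HasExpMoments γ :=
  have := h.isGaussian
  hasExpMoments_of_isGaussian γ

theorem integrable_exp_inner (h : IsCentredGaussian γ A) (v : E) :
    Integrable (fun x => Real.exp ⟪v, x⟫) γ := by
  refine (h.hasExpMoments ‖v‖).mono' (by fun_prop) (ae_of_all _ fun x => ?_)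
  rw [Real.norm_eq_abs, abs_of_pos (Real.exp_pos _)]
  exact Real.exp_le_exp.2 (real_inner_le_norm v x)

/-- The Cameron-Martin formula. -/
theorem map_add_left_eq_tilted (h : IsCentredGaussian γ A) (v : E) :
    γ.map (fun x => A v + x) = γ.tilted fun x => ⟪v, x⟫ := by
  have := h.isGaussian
  have hm : IsProbabilityMeasure (γ.map (fun x => A v + x)) :=
    Measure.isProbabilityMeasure_map (by fun_prop)
  have ht : IsProbabilityMeasure (γ.tilted fun x => ⟪v, x⟫) :=
    isProbabilityMeasure_tilted (h.integrable_exp_inner v)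
  refine Measure.ext_of_charFun (funext fun w => ?_)
  have key : ∀ t : ℝ, Integrable (fun x => Real.exp (t * ⟪w, x⟫)) (γ.map (fun x => A v + x)) := by
    intro t
    rw [integrable_map_measure (by fun_prop) (by fun_prop)]
    have := (h.integrable_exp_inner (t • w)).const_mul (Real.exp (t * ⟪w, A v⟫))
    refine this.congr (ae_of_all _ fun x => ?_)
    simp [inner_add_right, mul_add, Real.exp_add, inner_smul_left]
  -- Both sides have finite moment generating functions on the whole line for every linear
  -- functional, and these agree by the Gaussian integral, so no density is needed and $A$ may be
  -- degenerate.
  have hmgf : mgf (fun x => ⟪w, x⟫) (γ.map (fun x => A v + x)) =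
      mgf (fun x => ⟪w, x⟫) (γ.tilted fun x => ⟪v, x⟫) := by
    ext t
    rw [mgf, mgf, integral_map (by fun_prop) (by fun_prop), integral_tilted]
    have e1 : ∀ x, Real.exp (t * ⟪w, A v + x⟫) =
        Real.exp (t * ⟪w, A v⟫) * Real.exp ⟪t • w, x⟫ := fun x => by
      rw [← Real.exp_add]; simp [inner_add_right, mul_add, inner_smul_left]
    have e2 : ∀ x, (Real.exp ⟪v, x⟫ / ∫ x, Real.exp ⟪v, x⟫ ∂γ) • Real.exp (t * ⟪w, x⟫) =
        (∫ x, Real.exp ⟪v, x⟫ ∂γ)⁻¹ * Real.exp ⟪v + t • w, x⟫ := fun x => by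
      rw [inner_add_left, Real.exp_add, inner_smul_left]; simp; ring
    simp_rw [e1, e2, integral_const_mul, h.integral_exp_inner, ← Real.exp_neg, ← Real.exp_add]
    congr 1
    simp only [map_add, map_smul, inner_add_left, inner_add_right, inner_smul_left,
      inner_smul_right, h.inner_comm w v]
    simp
    ring
  -- Analytic continuation of the equality from real arguments to $i$, which is the characteristic
  -- function.
  have hI := eqOn_complexMGF_of_mgf (μ := γ.map (fun x => A v + x)) hmgf
  have hset : integrableExpSet (fun x => ⟪w, x⟫) (γ.map (fun x => A v + x)) = Set.univ :=
    Set.eq_univ_of_forall key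
  have := hI (x := Complex.I) (by simp [hset])
  simp only [complexMGF] at this
  simp only [charFun_apply, real_inner_comm w]
  simpa [mul_comm] using this

end IsCentredGaussian

end CentredGaussian

/-! ### Laplace transforms, exponential tilts and their derivatives. -/

section Laplace

variable {E : Type} [NormedAddCommGroup E] [InnerProductSpace ℝ E] [FiniteDimensional ℝ E]
  [MeasurableSpace E] [BorelSpace E]

/-- The Laplace transform `h ↦ ∫ exp (h, x) g(x) dμ(x)`. -/
def laplace {W : Type*} [NormedAddCommGroup W] [NormedSpace ℝ W] (μ : Measure E) (g : E → W)
    (h : E) : W :=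
  ∫ x, Real.exp ⟪h, x⟫ • g x ∂μ

/-- `g` is integrable against all exponentials of the norm. -/
structure ExpIntegrable {W : Type*} [NormedAddCommGroup W] [NormedSpace ℝ W] (μ : Measure E)
    (g : E → W) : Prop where
  aestronglyMeasurable : AEStronglyMeasurable g μ
  integrable : ∀ a : ℝ, Integrable (fun x => Real.exp (a * ‖x‖) * ‖g x‖) μ

variable {W : Type} [NormedAddCommGroup W] [NormedSpace ℝ W] {μ : Measure E} {g : E → W}

theorem ExpIntegrable.integrable_exp_inner_smul (hg : ExpIntegrable μ g) (h : E) :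
    Integrable (fun x => Real.exp ⟪h, x⟫ • g x) μ := by
  refine (hg.integrable ‖h‖).mono' (by have := hg.aestronglyMeasurable; fun_prop)
    (ae_of_all _ fun x => ?_)
  rw [norm_smul, Real.norm_eq_abs, abs_of_pos (Real.exp_pos _)]
  gcongr
  exact real_inner_le_norm h x

/-- This is the integrand of the derivative of the Laplace transform. The extra factor $\|x\|$ is
absorbed by $e^{\|x\|}$, so the class of admissible integrands is closed under differentiation. -/
theorem ExpIntegrable.smulRight (hg : ExpIntegrable μ g) :
    ExpIntegrable μ fun x => (innerSL ℝ x).smulRight (g x) := by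
  have hm : AEStronglyMeasurable (fun x => (innerSL ℝ x).smulRight (g x)) μ :=
    (ContinuousLinearMap.smulRightL ℝ E W).aestronglyMeasurable_comp₂
      (innerSL ℝ).continuous.aestronglyMeasurable hg.aestronglyMeasurable
  refine ⟨hm, fun a => ?_⟩
  refine (hg.integrable (a + 1)).mono' (by fun_prop) (ae_of_all _ fun x => ?_)
  rw [Real.norm_eq_abs, abs_of_nonneg (by positivity), ContinuousLinearMap.norm_smulRight_apply,
    innerSL_apply_norm, add_mul, Real.exp_add, one_mul, mul_assoc]
  have : ‖x‖ ≤ Real.exp ‖x‖ := by linarith [Real.add_one_le_exp ‖x‖]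
  gcongr

theorem ExpIntegrable.hasFDerivAt_laplace (hg : ExpIntegrable μ g) (h : E) :
    HasFDerivAt (laplace μ g) (laplace μ (fun x => (innerSL ℝ x).smulRight (g x)) h) h := by
  have hd := hg.smulRight
  refine hasFDerivAt_integral_of_dominated_of_fderiv_le (s := Metric.ball h 1)
    -- On the unit ball around `h` the exponent $(k, x)$ is at most $(\|h\|+1)\|x\|$.
    (bound := fun x => Real.exp ((‖h‖ + 1) * ‖x‖) * ‖(innerSL ℝ x).smulRight (g x)‖)
    (F' := fun h x => Real.exp ⟪h, x⟫ • (innerSL ℝ x).smulRight (g x))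
    (Metric.ball_mem_nhds h one_pos)
    (Eventually.of_forall fun k => (hg.integrable_exp_inner_smul k).aestronglyMeasurable)
    (hg.integrable_exp_inner_smul h) (hd.integrable_exp_inner_smul h).aestronglyMeasurable
    (ae_of_all _ fun x k hk => ?_) (hd.integrable _) (ae_of_all _ fun x k _ => ?_)
  · rw [norm_smul, Real.norm_eq_abs, abs_of_pos (Real.exp_pos _)]
    gcongr
    refine (real_inner_le_norm k x).trans ?_
    gcongr
    have := norm_le_norm_add_norm_sub' k h
    rw [mem_ball_iff_norm] at hk
    linarith
  · have h1 : HasFDerivAt (fun k : E => ⟪k, x⟫) (innerSL ℝ x) k := by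
      have := (innerSL ℝ x).hasFDerivAt (x := k)
      refine this.congr_of_eventuallyEq (Eventually.of_forall fun y => ?_)
      simp [real_inner_comm]
    convert h1.exp.smul_const (g x) using 1
    ext y
    simp [smul_smul]

/-- The derivative is again a Laplace transform, with values in `E →L[ℝ] W`. This is why the
transform is defined for vector-valued integrands and why the induction generalises over `W`. -/
theorem ExpIntegrable.contDiff_laplace (hg : ExpIntegrable μ g) (n : ℕ) :
    ContDiff ℝ n (laplace μ g) := by
  induction n generalizing W with
  | zero =>
    exact contDiff_zero.2 (continuous_iff_continuousAt.2 fun h =>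
      (hg.hasFDerivAt_laplace h).continuousAt)
  | succ n ih =>
    push_cast
    refine contDiff_succ_iff_fderiv.2 ⟨fun h => (hg.hasFDerivAt_laplace h).differentiableAt,
      by simp, ?_⟩
    rw [show fderiv ℝ (laplace μ g) = laplace μ (fun x => (innerSL ℝ x).smulRight (g x)) from
      funext fun h => (hg.hasFDerivAt_laplace h).fderiv]
    exact ih hg.smulRight

theorem HasExpMoments.expIntegrable_of_bounded (hμ : HasExpMoments μ)
    (hg : AEStronglyMeasurable g μ) {K : ℝ} (hK : ∀ x, ‖g x‖ ≤ K) : ExpIntegrable μ g := by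
  refine ⟨hg, fun a => ?_⟩
  refine ((hμ a).mul_const K).mono' (by fun_prop) (ae_of_all _ fun x => ?_)
  rw [Real.norm_eq_abs, abs_of_nonneg (by positivity)]
  gcongr
  exact hK x

theorem ExpIntegrable.smul_id {f : E → ℝ} (hf : ExpIntegrable μ f) :
    ExpIntegrable μ fun x => f x • x := by
  refine ⟨by have := hf.aestronglyMeasurable; fun_prop, fun a => ?_⟩
  have hm := hf.aestronglyMeasurable
  refine (hf.integrable (a + 1)).mono' (by fun_prop) (ae_of_all _ fun x => ?_)
  rw [Real.norm_eq_abs, abs_of_nonneg (by positivity), norm_smul, add_mul, Real.exp_add, one_mul,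
    mul_assoc, mul_comm ‖f x‖]
  have : ‖x‖ ≤ Real.exp ‖x‖ := by linarith [Real.add_one_le_exp ‖x‖]
  gcongr

theorem ExpIntegrable.laplace_apply {W' : Type*} [NormedAddCommGroup W'] [NormedSpace ℝ W']
    [CompleteSpace W] [CompleteSpace W'] (hg : ExpIntegrable μ g) (L : W →L[ℝ] W') (h : E) :
    L (laplace μ g h) = laplace μ (fun x => L (g x)) h := by
  rw [laplace, laplace, ← L.integral_comp_comm (hg.integrable_exp_inner_smul h)]
  simp

/-- The gradient of the Laplace transform of a scalar function. -/
theorem ExpIntegrable.hasGradientAt_laplace {f : E → ℝ} (hf : ExpIntegrable μ f) (h : E) :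
    HasGradientAt (laplace μ f) (laplace μ (fun x => f x • x) h) h := by
  rw [hasGradientAt_iff_hasFDerivAt]
  refine (hf.hasFDerivAt_laplace h).congr_fderiv (ContinuousLinearMap.ext fun v => Eq.symm ?_)
  have h1 := hf.smul_id.laplace_apply (innerSL ℝ v) h
  have h2 := hf.smulRight.laplace_apply (ContinuousLinearMap.apply ℝ ℝ v) h
  simp only [ContinuousLinearMap.apply_apply] at h2
  rw [h2, InnerProductSpace.toDual_apply_apply, real_inner_comm]
  refine h1.trans (integral_congr_ae (ae_of_all _ fun x => ?_))
  simp [real_inner_comm v x, mul_comm]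

theorem HasExpMoments.expIntegrable_one (hμ : HasExpMoments μ) :
    ExpIntegrable μ fun _ => (1 : ℝ) :=
  hμ.expIntegrable_of_bounded aestronglyMeasurable_const (K := 1) (by simp)

theorem HasExpMoments.expIntegrable_id (hμ : HasExpMoments μ) : ExpIntegrable μ fun x => x := by
  simpa using hμ.expIntegrable_one.smul_id

theorem HasExpMoments.integrable_exp_inner (hμ : HasExpMoments μ) (h : E) :
    Integrable (fun x => Real.exp ⟪h, x⟫) μ := by
  simpa using hμ.expIntegrable_one.integrable_exp_inner_smul h

theorem HasExpMoments.isFiniteMeasure (hμ : HasExpMoments μ) : IsFiniteMeasure μ := by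
  have := hμ 0
  simp only [zero_mul, Real.exp_zero] at this
  exact (integrable_const_iff_isFiniteMeasure one_ne_zero).1 this

theorem laplace_one_pos [NeZero μ] (hμ : HasExpMoments μ) (h : E) :
    0 < laplace μ (fun _ => (1 : ℝ)) h := by
  simpa [laplace] using integral_exp_pos (hμ.integrable_exp_inner h)

/-- Expresses averages under tilts as quotients of Laplace transforms, through which they inherit
smoothness in `h`. -/
theorem integral_tilt (μ : Measure E) (g : E → W) (h : E) :
    ∫ x, g x ∂tilt h μ = (laplace μ (fun _ => (1 : ℝ)) h)⁻¹ • laplace μ g h := by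
  rw [tilt, integral_tilted, laplace, laplace, ← integral_smul]
  simp [div_eq_inv_mul, smul_smul]

theorem ExpIntegrable.integrable_tilt (hμ : HasExpMoments μ) (hg : ExpIntegrable μ g) (h : E) :
    Integrable g (tilt h μ) := by
  rw [tilt, integrable_tilted_iff (hμ.integrable_exp_inner h)]
  exact hg.integrable_exp_inner_smul h

theorem HasExpMoments.tilt (hμ : HasExpMoments μ) (h : E) : HasExpMoments (tilt h μ) := by
  intro a
  rw [Polchinski.tilt, integrable_tilted_iff (hμ.integrable_exp_inner h)]
  refine (hμ (‖h‖ + a)).mono' (by fun_prop) (ae_of_all _ fun x => ?_)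
  rw [smul_eq_mul, ← Real.exp_add, Real.norm_eq_abs, abs_of_pos (Real.exp_pos _), add_mul]
  exact Real.exp_le_exp.2 (by linarith [real_inner_le_norm h x])

theorem HasExpMoments.isProbabilityMeasure_tilt [NeZero μ] (hμ : HasExpMoments μ) (h : E) :
    IsProbabilityMeasure (Polchinski.tilt h μ) :=
  isProbabilityMeasure_tilted (hμ.integrable_exp_inner h)

theorem HasExpMoments.integrable_id (hμ : HasExpMoments μ) : Integrable (fun x : E => x) μ := by
  simpa using hμ.expIntegrable_id.integrable_exp_inner_smul 0

theorem HasExpMoments.memLp_id (hμ : HasExpMoments μ) : MemLp (fun x : E => x) 2 μ := by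
  rw [memLp_two_iff_integrable_sq_norm (by fun_prop)]
  have := hμ.expIntegrable_id.smulRight.integrable 0
  refine this.congr (ae_of_all _ fun x => ?_)
  simp [ContinuousLinearMap.norm_smulRight_apply, sq]

theorem cov_inner (hμ : HasExpMoments μ) (v w : E) :
    ⟪cov μ v, w⟫ = cov[fun x => ⟪v, x⟫, fun x => ⟪w, x⟫; μ] := by
  have := hμ.isFiniteMeasure
  rw [cov, InnerProductSpace.continuousLinearMapOfBilin_apply,
    covarianceBilin_apply_eq_cov hμ.memLp_id]

/-- The gradient of the logarithm of the Laplace transform is the mean of the tilted measure. -/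
theorem hasGradientAt_log_laplace [NeZero μ] (hμ : HasExpMoments μ) (h : E) :
    HasGradientAt (fun h => Real.log (laplace μ (fun _ => (1 : ℝ)) h)) (∫ x, x ∂tilt h μ) h := by
  have h1 := hμ.expIntegrable_one.hasGradientAt_laplace h
  rw [hasGradientAt_iff_hasFDerivAt] at h1 ⊢
  refine (h1.log (laplace_one_pos hμ h).ne').congr_fderiv ?_
  rw [integral_tilt, map_smul]
  simp

/-- The Hessian of the logarithm of the Laplace transform is the covariance of the tilted
measure. -/
theorem hasFDerivAt_integral_tilt [NeZero μ] (hμ : HasExpMoments μ) (h : E) :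
    HasFDerivAt (fun h => ∫ x, x ∂tilt h μ) (cov (tilt h μ)) h := by
  have h1 := (hμ.expIntegrable_one.hasGradientAt_laplace h).hasFDerivAt
  have h2 := hμ.expIntegrable_id.hasFDerivAt_laplace h
  have hpos := laplace_one_pos hμ h
  have h3 := ((hasDerivAt_inv hpos.ne').comp_hasFDerivAt h h1).smul h2
  simp_rw [integral_tilt]
  refine h3.congr_fderiv (ContinuousLinearMap.ext fun v => ext_inner_right ℝ fun w => ?_)
  have := hμ.isProbabilityMeasure_tilt h
  have hL : ∀ v : E, MemLp (fun x => ⟪v, x⟫) 2 (tilt h μ) := fun v =>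
    (innerSL ℝ v).comp_memLp' (hμ.tilt h).memLp_id
  have hi : ∀ v : E, ∫ x, ⟪v, x⟫ ∂tilt h μ = ⟪v, ∫ x, x ∂tilt h μ⟫ := fun v =>
    (innerSL ℝ v).integral_comp_comm (hμ.tilt h).integrable_id
  rw [cov_inner (hμ.tilt h), covariance_eq_sub (hL v) (hL w), hi, hi]
  -- The mixed second moment of the tilt is the derivative of the vector-valued Laplace transform,
  -- normalised; the other term of the quotient rule is the product of the means.
  have h4 : ∫ x, ((fun x => ⟪v, x⟫) * fun x => ⟪w, x⟫) x ∂tilt h μ =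
      (laplace μ (fun _ => (1 : ℝ)) h)⁻¹ *
        ⟪laplace μ (fun x => (innerSL ℝ x).smulRight x) h v, w⟫ := by
    rw [integral_tilt, smul_eq_mul]
    congr 1
    have e := hμ.expIntegrable_id.smulRight.laplace_apply
      ((innerSL ℝ w).comp (ContinuousLinearMap.apply ℝ E v)) h
    rw [real_inner_comm]
    refine Eq.trans ?_ e.symm
    refine congrArg (fun f => laplace μ f h) (funext fun x => ?_)
    simp [real_inner_comm v x]
  rw [h4, integral_tilt]
  simp [inner_add_right, inner_neg_right, inner_smul_right, real_inner_comm w,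
    real_inner_comm v (laplace μ _ h)]
  ring

end Laplace

/-! ### Entropic stability by duality. -/

section EntropicStability

/-- Young's inequality: $x\log x - x$ and $e^y$ are convex conjugates. For $x > 0$ it is $1 + u ≤
e^u$ at $u = y - \log x$. -/
theorem mul_le_Phi_sub_add_exp {x : ℝ} (hx : 0 ≤ x) (y : ℝ) :
    x * y ≤ Phi x - x + Real.exp y := by
  rcases hx.eq_or_lt with rfl | hx
  · simp [Phi, Real.exp_nonneg]
  · have h := Real.add_one_le_exp (y - Real.log x)
    rw [Real.exp_sub, Real.exp_log hx, le_div_iff₀ hx] at h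
    rw [Phi]
    linarith

/-- Two monotonicity steps: $f' - cs$ is antitone, hence so is $f - f'(0)s - cs^2/2$ on $[0,1]$. -/
theorem le_add_of_second_deriv_le {f f' f'' : ℝ → ℝ} {c : ℝ}
    (hf : ∀ s, HasDerivAt f (f' s) s) (hf' : ∀ s, HasDerivAt f' (f'' s) s) (hc : ∀ s, f'' s ≤ c) :
    f 1 ≤ f 0 + f' 0 + c / 2 := by
  have h1 : ∀ s, HasDerivAt (fun s => f' s - c * s) (f'' s - c) s := fun s => by
    exact ((hf' s).sub ((hasDerivAt_id s).const_mul c)).congr_deriv (by simp)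
  have h2 : Antitone fun s => f' s - c * s :=
    antitone_of_deriv_nonpos (fun s => (h1 s).differentiableAt)
      fun s => by rw [(h1 s).deriv]; linarith [hc s]
  have h3 : ∀ s, HasDerivAt (fun s => f s - f' 0 * s - c / 2 * s ^ 2)
      (f' s - f' 0 - c * s) s := fun s => by
    have := ((hf s).sub ((hasDerivAt_id s).const_mul (f' 0))).sub
      ((hasDerivAt_pow 2 s).const_mul (c / 2))
    refine this.congr_deriv ?_
    simp
    ring
  have h4 : AntitoneOn (fun s => f s - f' 0 * s - c / 2 * s ^ 2) (Set.Icc 0 1) := by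
    refine antitoneOn_of_deriv_nonpos (convex_Icc 0 1)
      (fun s _ => (h3 s).continuousAt.continuousWithinAt)
      (fun s _ => (h3 s).differentiableAt.differentiableWithinAt) fun s hs => ?_
    rw [interior_Icc] at hs
    rw [(h3 s).deriv]
    have := h2 hs.1.le
    simp only [mul_zero, sub_zero] at this
    linarith
  have := h4 (Set.left_mem_Icc.2 zero_le_one) (Set.right_mem_Icc.2 zero_le_one) zero_le_one
  norm_num at this
  linarith

variable {E : Type} [NormedAddCommGroup E] [InnerProductSpace ℝ E] [FiniteDimensional ℝ E]
  [MeasurableSpace E] [BorelSpace E] {μ : Measure E}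

/-- In an orthonormal basis of size $n$ some coordinate satisfies $n|(b_i, x)| ≥ \|x\|$, and
$e^{|y|} ≤ e^y + e^{-y}$. Finitely many linear exponentials therefore dominate the exponential of
the norm. -/
theorem hasExpMoments_of_integrable_exp_inner [IsFiniteMeasure μ]
    (hμ : ∀ h : E, Integrable (fun x => Real.exp ⟪h, x⟫) μ) : HasExpMoments μ := by
  intro a
  let b := stdOrthonormalBasis ℝ E
  let n := Module.finrank ℝ E
  -- The summand `1` is what dominates in dimension zero, where the sum is empty.
  have hintegr : Integrable (fun x => 1 + ∑ i, (Real.exp ⟪(n * |a|) • b i, x⟫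
      + Real.exp ⟪-(n * |a|) • b i, x⟫)) μ :=
    (integrable_const 1).add (integrable_finsetSum _ fun i _ => (hμ _).add (hμ _))
  refine hintegr.mono' (by fun_prop) (ae_of_all _ fun x => ?_)
  rw [Real.norm_eq_abs, abs_of_pos (Real.exp_pos _)]
  rcases isEmpty_or_nonempty (Fin n) with he | hne
  · have hx : ‖x‖ = 0 := by
      rw [← sq_eq_zero_iff, ← b.sum_sq_norm_inner_right x]
      exact Finset.sum_eq_zero fun i _ => (he.false i).elim
    rw [hx]
    simp only [mul_zero, Real.exp_zero, le_add_iff_nonneg_right]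
    positivity
  · have h1 : ‖x‖ ≤ ∑ i, |⟪b i, x⟫| := by
      conv_lhs => rw [← b.sum_repr' x]
      refine (norm_sum_le _ _).trans (Finset.sum_le_sum fun i _ => ?_)
      simp [norm_smul]
    obtain ⟨i, -, hi⟩ := Finset.exists_le_of_sum_le (s := (Finset.univ : Finset (Fin n)))
      (f := fun _ => ‖x‖) (g := fun i => n * |⟪b i, x⟫|) Finset.univ_nonempty (by
        simp only [Finset.sum_const, Finset.card_univ, Fintype.card_fin, nsmul_eq_mul,
          ← Finset.mul_sum]
        gcongr)
    have h2 : Real.exp (a * ‖x‖) ≤ Real.exp ⟪(n * |a|) • b i, x⟫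
        + Real.exp ⟪-(n * |a|) • b i, x⟫ := by
      have h3 : a * ‖x‖ ≤ |n * |a| * ⟪b i, x⟫| := by
        rw [abs_mul, abs_mul, abs_abs, Nat.abs_cast]
        calc a * ‖x‖ ≤ |a| * (n * |⟪b i, x⟫|) :=
              mul_le_mul (le_abs_self a) hi (norm_nonneg _) (abs_nonneg _)
          _ = _ := by ring
      refine (Real.exp_le_exp.2 h3).trans ?_
      simp only [inner_smul_left, conj_trivial]
      rw [neg_mul]
      exact Real.exp_abs_le _
    refine h2.trans ?_
    have h4 := Finset.single_le_sum (f := fun i => Real.exp ⟪(n * |a|) • b i, x⟫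
        + Real.exp ⟪-(n * |a|) • b i, x⟫) (fun i _ => by positivity) (Finset.mem_univ i)
    linarith

/-- Along $s ↦ s\,\dotΣ v$ the second derivative of the log-Laplace transform is $(v,
\dotΣ\,\mathrm{cov}(T_h μ)\,\dotΣ v)$ with $h = s\,\dotΣ v$. This is the quadratic form in the
hypothesis, hence at most $a(v, \dotΣ v)$; Taylor's formula from $0$ to $1$ does the rest.
Controlling every tilt on the line is the reason the hypothesis concerns all $h$. -/
theorem log_laplace_le [IsProbabilityMeasure μ] (hμ : HasExpMoments μ) {Sd : E →L[ℝ] E} {a : ℝ}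
    (hS : Sd.IsPositive) (hcov : ∀ h, Sd * cov (tilt h μ) * Sd ≤ a • Sd) (v : E) :
    Real.log (laplace μ (fun _ => (1 : ℝ)) (Sd v)) ≤
      ⟪Sd v, ∫ x, x ∂μ⟫ + a * ⟪v, Sd v⟫ / 2 := by
  have hline : ∀ s : ℝ, HasDerivAt (fun s : ℝ => s • Sd v) (Sd v) s := fun s => by
    simpa using (hasDerivAt_id s).smul_const (Sd v)
  have h := le_add_of_second_deriv_le
    (f := fun s => Real.log (laplace μ (fun _ => (1 : ℝ)) (s • Sd v)))
    (f' := fun s => ⟪Sd v, ∫ x, x ∂tilt (s • Sd v) μ⟫)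
    (f'' := fun s => ⟪Sd v, cov (tilt (s • Sd v) μ) (Sd v)⟫) (c := a * ⟪v, Sd v⟫)
    (fun s => by
      have := (hasGradientAt_log_laplace hμ (s • Sd v)).hasFDerivAt.comp_hasDerivAt s (hline s)
      refine this.congr_deriv ?_
      rw [InnerProductSpace.toDual_apply_apply, real_inner_comm])
    (fun s => by
      have := (hasFDerivAt_integral_tilt hμ (s • Sd v)).comp_hasDerivAt s (hline s)
      exact (innerSL ℝ (Sd v)).hasFDerivAt.comp_hasDerivAt s this)
    (fun s => by
      have := ((ContinuousLinearMap.le_def _ _).1 (hcov (s • Sd v))).inner_nonneg_right v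
      simp only [sub_apply, smul_apply, inner_sub_right, inner_smul_right,
        mul_apply_eq_comp] at this
      have hs : ⟪v, Sd (cov (tilt (s • Sd v) μ) (Sd v))⟫ =
        ⟪Sd v, cov (tilt (s • Sd v) μ) (Sd v)⟫ := (hS.isSymmetric _ _).symm
      linarith)
  have h0 : tilt (0 : E) μ = μ := by simp [tilt]
  have h1 : laplace μ (fun _ => (1 : ℝ)) 0 = 1 := by simp [laplace]
  simpa [h0, h1] using h

theorem integrable_smul_id_of_integrable_Phi (hμ : HasExpMoments μ) {F : E → ℝ}
    (hF : ∀ x, 0 ≤ F x) (hFi : Integrable F μ) (hΦ : Integrable (fun x => Phi (F x)) μ) :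
    Integrable (fun x => F x • x) μ := by
  have h1 := hμ 1
  simp only [one_mul] at h1
  refine (((hΦ.sub hFi).add h1)).mono' (by have := hFi.1; fun_prop) (ae_of_all _ fun x => ?_)
  rw [norm_smul, Real.norm_eq_abs, abs_of_nonneg (hF x)]
  -- Young's inequality with $y = \|x\|$: integrability of $Φ(F)$ is traded for one exponential
  -- moment.
  exact mul_le_Phi_sub_add_exp (hF x) ‖x‖

/-- The Gibbs variational inequality for linear functions. -/
theorem integral_mul_inner_le [IsProbabilityMeasure μ] (hμ : HasExpMoments μ) {F : E → ℝ}
    (hF : ∀ x, 0 ≤ F x) (hFi : Integrable F μ) (hF1 : ∫ x, F x ∂μ = 1)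
    (hΦ : Integrable (fun x => Phi (F x)) μ) (u : E) :
    ⟪u, ∫ x, F x • x ∂μ⟫ ≤ ent μ F + Real.log (laplace μ (fun _ => (1 : ℝ)) u) := by
  have hZ := laplace_one_pos hμ u
  set Z := laplace μ (fun _ => (1 : ℝ)) u with hZdef
  have hintegr := integrable_smul_id_of_integrable_Phi hμ hF hFi hΦ
  have h1 : ∫ x, F x * ⟪u, x⟫ ∂μ = ⟪u, ∫ x, F x • x ∂μ⟫ := by
    rw [← innerSL_apply_apply ℝ, ← (innerSL ℝ u).integral_comp_comm hintegr]
    simp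
  have hintegr' : Integrable (fun x => F x * ⟪u, x⟫) μ := by
    simpa using (innerSL ℝ u).integrable_comp hintegr
  have hsub : Integrable (fun x => Phi (F x) - F x) μ := hΦ.sub hFi
  have h2 : ∫ x, (F x * ⟪u, x⟫ - F x * Real.log Z) ∂μ ≤
      ∫ x, (Phi (F x) - F x + Z⁻¹ * Real.exp ⟪u, x⟫) ∂μ := by
    refine integral_mono (hintegr'.sub (hFi.mul_const _))
      ((hΦ.sub hFi).add ((hμ.integrable_exp_inner u).const_mul _)) fun x => ?_
    -- Subtracting $\log Z$ normalises the exponential: its integral becomes $1$ and cancels $-∫F =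
    -- -1$.
    have := mul_le_Phi_sub_add_exp (hF x) (⟪u, x⟫ - Real.log Z)
    rw [Real.exp_sub, Real.exp_log hZ, div_eq_inv_mul] at this
    simpa [mul_sub] using this
  rw [integral_sub hintegr' (hFi.mul_const _), integral_add hsub
    ((hμ.integrable_exp_inner u).const_mul _), integral_sub hΦ hFi, integral_const_mul,
    integral_mul_const, h1, hF1] at h2
  have h3 : ∫ x, Real.exp ⟪u, x⟫ ∂μ = Z := by simp [hZdef, laplace]
  rw [h3, inv_mul_cancel₀ hZ.ne'] at h2
  simp only [ent, hF1, Phi, Real.log_one, mul_zero, sub_zero] at h2 ⊢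
  linarith

/-- With $w$ the difference of means, the two preceding bounds give $(\dotΣ v, w) ≤ \mathrm{Ent} +
\frac a2 (v, \dotΣ v)$ for all $v$. The optimal choice is $v = w/a$. -/
theorem half_quadForm_le_ent [IsProbabilityMeasure μ] (hμ : HasExpMoments μ) {Sd : E →L[ℝ] E}
    {a : ℝ} (hS : Sd.IsPositive) (ha : 0 < a) (hcov : ∀ h, Sd * cov (tilt h μ) * Sd ≤ a • Sd)
    {F : E → ℝ} (hF : ∀ x, 0 ≤ F x) (hFi : Integrable F μ) (hF1 : ∫ x, F x ∂μ = 1)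
    (hΦ : Integrable (fun x => Phi (F x)) μ) :
    1 / 2 * quadForm Sd ((∫ x, F x • x ∂μ) - ∫ x, x ∂μ) ≤ a * ent μ F := by
  set w := (∫ x, F x • x ∂μ) - ∫ x, x ∂μ with hw
  have h1 := integral_mul_inner_le hμ hF hFi hF1 hΦ (Sd (a⁻¹ • w))
  have h2 := log_laplace_le hμ hS hcov (a⁻¹ • w)
  have h3 : ⟪Sd (a⁻¹ • w), w⟫ ≤ ent μ F + a * ⟪a⁻¹ • w, Sd (a⁻¹ • w)⟫ / 2 := by
    rw [hw, inner_sub_right, ← hw]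
    linarith
  have hs : ⟪Sd w, w⟫ = ⟪w, Sd w⟫ := real_inner_comm _ _
  simp only [map_smul, inner_smul_left, inner_smul_right, conj_trivial, hs] at h3
  rw [quadForm]
  have h4 := mul_le_mul_of_nonneg_left h3 ha.le
  have e : a * (ent μ F + a * (a⁻¹ * (a⁻¹ * ⟪w, Sd w⟫)) / 2) =
      a * ent μ F + ⟪w, Sd w⟫ / 2 := by field_simp
  have e' : a * (a⁻¹ * ⟪w, Sd w⟫) = ⟪w, Sd w⟫ := by field_simp
  rw [e, e'] at h4
  linarith

end EntropicStability

/-! ### Fluctuation measures as tilts, and the Hessian of the renormalised potential. -/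

section Fluctuation

variable {E : Type} [NormedAddCommGroup E] [InnerProductSpace ℝ E] [FiniteDimensional ℝ E]
  [MeasurableSpace E] [BorelSpace E] {γ : Measure E} {C : E →L[ℝ] E} {V : E → ℝ}

theorem apply_inverse (hC : IsUnit C) (x : E) : C (C⁻¹ʳ x) = x := by
  have := congrArg (fun T : E →L[ℝ] E => T x) (Ring.mul_inverse_cancel C hC)
  simpa using this

theorem inverse_apply (hC : IsUnit C) (x : E) : C⁻¹ʳ (C x) = x := by
  have := congrArg (fun T : E →L[ℝ] E => T x) (Ring.inverse_mul_cancel C hC)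
  simpa using this

theorem IsCentredGaussian.inner_inverse_left (hγ : IsCentredGaussian γ C) (hC : IsUnit C)
    (x y : E) : ⟪C⁻¹ʳ x, y⟫ = ⟪x, C⁻¹ʳ y⟫ := by
  conv_lhs => rw [← apply_inverse hC y]
  conv_rhs => rw [← apply_inverse hC x]
  rw [hγ.inner_comm, real_inner_comm]

theorem IsCentredGaussian.isSelfAdjoint_inverse (hγ : IsCentredGaussian γ C) (hC : IsUnit C) :
    IsSelfAdjoint C⁻¹ʳ :=
  (ContinuousLinearMap.isSelfAdjoint_iff_isSymmetric).2 fun x y => hγ.inner_inverse_left hC x y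

theorem IsCentredGaussian.isSelfAdjoint (hγ : IsCentredGaussian γ C) : IsSelfAdjoint C :=
  (ContinuousLinearMap.isSelfAdjoint_iff_isSymmetric).2 fun x y => by
    simpa [real_inner_comm] using hγ.inner_comm y x

theorem IsCentredGaussian.laplace_one (hγ : IsCentredGaussian γ C) (h : E) :
    laplace γ (fun _ => (1 : ℝ)) h = Real.exp (⟪h, C h⟫ / 2) := by
  simpa [laplace] using hγ.integral_exp_inner h

/-- Cameron-Martin at $v = C^{-1}φ$. It moves the dependence on $φ$ from the merely measurable `g`
into an exponential, where it is smooth. -/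
theorem IsCentredGaussian.integral_comp_add (hγ : IsCentredGaussian γ C) (hC : IsUnit C)
    (g : E → ℝ) (φ : E) :
    ∫ x, g (φ + x) ∂γ = Real.exp (-(⟪C⁻¹ʳ φ, φ⟫ / 2)) * laplace γ g (C⁻¹ʳ φ) := by
  have h1 := (measurableEmbedding_addLeft φ).integral_map (μ := γ) g
  have h2 := hγ.map_add_left_eq_tilted (C⁻¹ʳ φ)
  rw [apply_inverse hC] at h2
  rw [← h1, h2]
  have h3 := integral_tilt γ g (C⁻¹ʳ φ)
  rw [hγ.laplace_one, apply_inverse hC, ← Real.exp_neg] at h3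
  exact h3

theorem integrable_exp_neg [IsFiniteMeasure γ] (hV : Measurable V) {b : ℝ} (hb : ∀ x, b ≤ V x) :
    Integrable (fun x => Real.exp (-V x)) γ := by
  refine (integrable_const (Real.exp (-b))).mono' (by fun_prop) (ae_of_all _ fun x => ?_)
  rw [Real.norm_eq_abs, abs_of_pos (Real.exp_pos _)]
  exact Real.exp_le_exp.2 (by linarith [hb x])

theorem HasExpMoments.tilted_neg (hγ : HasExpMoments γ) (hV : Measurable V) {b : ℝ}
    (hb : ∀ x, b ≤ V x) : HasExpMoments (γ.tilted fun x => -V x) := by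
  intro a
  have := hγ.isFiniteMeasure
  rw [integrable_tilted_iff (integrable_exp_neg hV hb)]
  refine ((hγ a).const_mul (Real.exp (-b))).mono' (by fun_prop) (ae_of_all _ fun x => ?_)
  rw [smul_eq_mul, Real.norm_eq_abs, abs_of_nonneg (by positivity)]
  gcongr
  exact hb x

/-- The fluctuation measure at `φ` is an exponential tilt of the one at `0`. -/
theorem IsCentredGaussian.map_add_tilted_eq_tilt (hγ : IsCentredGaussian γ C) (hC : IsUnit C)
    (hV : Measurable V) {b : ℝ} (hb : ∀ x, b ≤ V x) (φ : E) :
    (γ.map fun x => φ + x).tilted (fun x => -V x) =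
      tilt (C⁻¹ʳ φ) (γ.tilted fun x => -V x) := by
  have := hγ.isGaussian
  have h2 := hγ.map_add_left_eq_tilted (C⁻¹ʳ φ)
  rw [apply_inverse hC] at h2
  rw [h2, tilt, tilted_tilted (hγ.integrable_exp_inner _), tilted_tilted (integrable_exp_neg hV hb),
    add_comm]

theorem laplace_tilted_neg (V : E → ℝ) (g : E → ℝ) (h : E) :
    laplace (γ.tilted fun x => -V x) g h =
      (∫ x, Real.exp (-V x) ∂γ)⁻¹ * laplace γ (fun x => Real.exp (-V x) * g x) h := by
  rw [laplace, integral_tilted, laplace, ← integral_const_mul]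
  refine integral_congr_ae (ae_of_all _ fun x => ?_)
  simp only [smul_eq_mul]
  ring

theorem IsCentredGaussian.integral_exp_neg_mul (hγ : IsCentredGaussian γ C) (hC : IsUnit C)
    (hV : Measurable V) {b : ℝ} (hb : ∀ x, b ≤ V x) (g : E → ℝ) (φ : E) :
    ∫ x, Real.exp (-V (φ + x)) * g (φ + x) ∂γ =
      Real.exp (-(⟪C⁻¹ʳ φ, φ⟫ / 2)) * (∫ x, Real.exp (-V x) ∂γ) *
        laplace (γ.tilted fun x => -V x) g (C⁻¹ʳ φ) := by
  have := hγ.isGaussian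
  rw [hγ.integral_comp_add hC (fun x => Real.exp (-V x) * g x), laplace_tilted_neg]
  have := (integral_exp_pos (integrable_exp_neg (γ := γ) hV hb)).ne'
  field_simp

/-- The decomposition of the potential into a quadratic form and a log-Laplace transform of a fixed
measure, from which both smoothness and the Hessian are read off. -/
theorem IsCentredGaussian.neg_log_integral (hγ : IsCentredGaussian γ C) (hC : IsUnit C)
    (hV : Measurable V) {b : ℝ} (hb : ∀ x, b ≤ V x) (φ : E) :
    -Real.log (∫ x, Real.exp (-V (φ + x)) ∂γ) = ⟪C⁻¹ʳ φ, φ⟫ / 2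
      - Real.log (laplace (γ.tilted fun x => -V x) (fun _ => (1 : ℝ)) (C⁻¹ʳ φ))
      - Real.log (∫ x, Real.exp (-V x) ∂γ) := by
  have := hγ.isGaussian
  have h1 := hγ.integral_exp_neg_mul hC hV hb (fun _ => 1) φ
  simp only [mul_one] at h1
  have h2 := integral_exp_pos (integrable_exp_neg (γ := γ) hV hb)
  have : IsProbabilityMeasure (γ.tilted fun x => -V x) :=
    isProbabilityMeasure_tilted (integrable_exp_neg hV hb)
  have h3 := laplace_one_pos (hγ.hasExpMoments.tilted_neg hV hb) (C⁻¹ʳ φ)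
  rw [h1, Real.log_mul (by positivity) h3.ne', Real.log_mul (by positivity) h2.ne', Real.log_exp]
  ring

theorem contDiff_log_laplace {μ : Measure E} [NeZero μ] (hμ : HasExpMoments μ) (n : ℕ) :
    ContDiff ℝ n fun h => Real.log (laplace μ (fun _ => (1 : ℝ)) h) :=
  (hμ.expIntegrable_one.contDiff_laplace n).log fun h => (laplace_one_pos hμ h).ne'

theorem IsCentredGaussian.contDiff_neg_log_integral (hγ : IsCentredGaussian γ C) (hC : IsUnit C)
    (hV : Measurable V) {b : ℝ} (hb : ∀ x, b ≤ V x) (n : ℕ) :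
    ContDiff ℝ n fun φ => -Real.log (∫ x, Real.exp (-V (φ + x)) ∂γ) := by
  have := hγ.isGaussian
  have : IsProbabilityMeasure (γ.tilted fun x => -V x) :=
    isProbabilityMeasure_tilted (integrable_exp_neg hV hb)
  simp_rw [hγ.neg_log_integral hC hV hb]
  have h1 := (contDiff_log_laplace (hγ.hasExpMoments.tilted_neg hV hb) n).comp
    (C⁻¹ʳ).contDiff
  have h2 : ContDiff ℝ n fun φ : E => ⟪C⁻¹ʳ φ, φ⟫ := (C⁻¹ʳ).contDiff.inner ℝ contDiff_id
  exact ((h2.div_const 2).sub h1).sub contDiff_const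

/-- The quadratic term contributes $C^{-1}$. The log-Laplace term contributes the covariance of the
tilt at $C^{-1}φ$, which is the fluctuation measure at $φ$, conjugated by $C^{-1}$ through the chain
rule. -/
theorem IsCentredGaussian.hessian_neg_log_integral (hγ : IsCentredGaussian γ C) (hC : IsUnit C)
    (hV : Measurable V) {b : ℝ} (hb : ∀ x, b ≤ V x) (φ : E) :
    hessian (fun φ => -Real.log (∫ x, Real.exp (-V (φ + x)) ∂γ)) φ =
      C⁻¹ʳ - C⁻¹ʳ * cov ((γ.map fun x => φ + x).tilted fun x => -V x) * C⁻¹ʳ := by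
  have := hγ.isGaussian
  have : IsProbabilityMeasure (γ.tilted fun x => -V x) :=
    isProbabilityMeasure_tilted (integrable_exp_neg hV hb)
  have hm := hγ.hasExpMoments.tilted_neg hV hb
  have hgrad : gradient (fun φ => -Real.log (∫ x, Real.exp (-V (φ + x)) ∂γ)) =
      fun φ => C⁻¹ʳ φ - C⁻¹ʳ (∫ x, x ∂tilt (C⁻¹ʳ φ) (γ.tilted fun x => -V x)) := by
    ext1 φ
    refine HasGradientAt.gradient ?_
    simp_rw [hγ.neg_log_integral hC hV hb]
    rw [hasGradientAt_iff_hasFDerivAt]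
    have h1 := (hasGradientAt_log_laplace hm (C⁻¹ʳ φ)).hasFDerivAt.comp φ (C⁻¹ʳ).hasFDerivAt
    have h2 := (C⁻¹ʳ).hasFDerivAt (x := φ) |>.inner ℝ (hasFDerivAt_id φ)
    have h3 := ((h2.mul_const (1 / 2)).sub h1).sub_const (Real.log (∫ x, Real.exp (-V x) ∂γ))
    have h4 := h3.congr_of_eventuallyEq (f₁ := fun φ => ⟪C⁻¹ʳ φ, φ⟫ / 2
      - Real.log (laplace (γ.tilted fun x => -V x) (fun _ => (1 : ℝ)) (C⁻¹ʳ φ))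
      - Real.log (∫ x, Real.exp (-V x) ∂γ)) (Eventually.of_forall fun ψ => by
        simp [div_eq_mul_inv])
    refine h4.congr_fderiv (ContinuousLinearMap.ext fun v => ?_)
    have e : ⟪v, C⁻¹ʳ φ⟫ = ⟪φ, C⁻¹ʳ v⟫ := by rw [← hγ.inner_inverse_left hC, real_inner_comm]
    simp [hγ.inner_inverse_left hC, e]
    ring
  rw [hessian, hgrad, hγ.map_add_tilted_eq_tilt hC hV hb]
  refine HasFDerivAt.fderiv ?_
  have h1 := (hasFDerivAt_integral_tilt hm (C⁻¹ʳ φ)).comp φ (C⁻¹ʳ).hasFDerivAt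
  exact (C⁻¹ʳ).hasFDerivAt.sub ((C⁻¹ʳ).hasFDerivAt.comp φ h1)

/-- The Hessian condition and the covariance condition are equivalent. -/
theorem hessian_le_iff_cov_le {Cd K R : E →L[ℝ] E} (hR : IsSelfAdjoint R) (hC : IsSelfAdjoint C)
    (hRC : R * C = 1) (hCR : C * R = 1) (a : ℝ) :
    -(a • Cd) ≤ Cd * (R - R * K * R) * Cd - Cd * R * Cd ↔
      (R * Cd * R) * K * (R * Cd * R) ≤ a • (R * Cd * R) := by
  rw [ContinuousLinearMap.le_def, ContinuousLinearMap.le_def]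
  -- The $C^{-1}$ part of the Hessian cancels the subtracted term $\dot C C^{-1}\dot C$.
  have e1 : Cd * (R - R * K * R) * Cd - Cd * R * Cd - -(a • Cd) =
      a • Cd - Cd * R * K * R * Cd := by noncomm_ring
  -- The two differences are conjugate to each other by the invertible self-adjoint `R`, so
  -- positivity passes both ways.
  have e2 : a • (R * Cd * R) - (R * Cd * R) * K * (R * Cd * R) =
      R * (a • Cd - Cd * R * K * R * Cd) * R := by
    simp only [mul_sub, sub_mul, mul_smul_comm, smul_mul_assoc, mul_assoc]
  rw [e1, e2]
  set D := a • Cd - Cd * R * K * R * Cd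
  constructor
  · intro h
    have := h.conj_adjoint R
    rwa [hR.adjoint_eq] at this
  · intro h
    have := h.conj_adjoint C
    rw [hC.adjoint_eq] at this
    have e3 : C * (R * D * R) * C = D := by
      calc C * (R * D * R) * C = (C * R) * D * (R * C) := by noncomm_ring
        _ = D := by rw [hRC, hCR, one_mul, mul_one]
    rw [← e3]
    exact this

end Fluctuation

/-! ### The gradient estimate for averages under tilts. -/

section GradientEstimate

theorem continuous_Phi : Continuous Phi := Real.continuous_mul_log

theorem exists_abs_Phi_le (M : ℝ) : ∃ K, ∀ x, 0 ≤ x → x ≤ M → |Phi x| ≤ K := by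
  obtain ⟨K, hK⟩ := (isCompact_Icc (a := (0 : ℝ)) (b := M)).exists_bound_of_continuousOn
    continuous_Phi.continuousOn
  exact ⟨K, fun x h0 hM => hK x ⟨h0, hM⟩⟩

theorem Phi_mul {c x : ℝ} (hc : 0 < c) : Phi (c * x) = c * Phi x + x * Phi c := by
  rcases eq_or_ne x 0 with rfl | hx
  · simp [Phi]
  · rw [Phi, Phi, Phi, Real.log_mul hc.ne' hx]
    ring

theorem ent_const_mul {Ω : Type*} [MeasurableSpace Ω] {μ : Measure Ω} {F : Ω → ℝ} {c : ℝ}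
    (hc : 0 < c) (hF : Integrable F μ) (hΦ : Integrable (fun x => Phi (F x)) μ) :
    ent μ (fun x => c * F x) = c * ent μ F := by
  simp only [ent, Phi_mul hc]
  rw [integral_add (hΦ.const_mul c) (hF.mul_const _), integral_const_mul, integral_mul_const,
    integral_const_mul, Phi_mul hc]
  ring

theorem integrable_of_bounded {Ω : Type*} [MeasurableSpace Ω] {μ : Measure Ω} [IsFiniteMeasure μ]
    {F : Ω → ℝ} (hF : Measurable F) {M : ℝ} (hM : ∀ x, |F x| ≤ M) : Integrable F μ :=
  (integrable_const M).mono' hF.aestronglyMeasurable (ae_of_all _ hM)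

theorem integrable_Phi_of_bounded {Ω : Type*} [MeasurableSpace Ω] {μ : Measure Ω}
    [IsFiniteMeasure μ] {F : Ω → ℝ} (hF : Measurable F) (h0 : ∀ x, 0 ≤ F x) {M : ℝ}
    (hM : ∀ x, F x ≤ M) : Integrable (fun x => Phi (F x)) μ := by
  obtain ⟨K, hK⟩ := exists_abs_Phi_le M
  exact integrable_of_bounded (continuous_Phi.measurable.comp hF) fun x => hK _ (h0 x) (hM x)

variable {E : Type} [NormedAddCommGroup E] [InnerProductSpace ℝ E] [FiniteDimensional ℝ E]
  [MeasurableSpace E] [BorelSpace E] {μ : Measure E}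

theorem quadForm_smul (A : E →L[ℝ] E) (c : ℝ) (u : E) :
    quadForm A (c • u) = c ^ 2 * quadForm A u := by
  simp only [quadForm, map_smul, inner_smul_left, inner_smul_right, conj_trivial]
  ring

/-- Tilts compose additively, so a bound over all tilts of a base measure is also a bound over all
tilts of any of its tilts. -/
theorem HasExpMoments.tilt_tilt (hμ : HasExpMoments μ) (h k : E) :
    Polchinski.tilt h (Polchinski.tilt k μ) = Polchinski.tilt (k + h) μ := by
  rw [Polchinski.tilt, Polchinski.tilt, Polchinski.tilt, tilted_tilted (hμ.integrable_exp_inner k)]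
  congr 1
  ext x
  simp [inner_add_left]

/-- The logarithmic derivative of the normalised tilt is $x$ minus its mean, so the gradient is the
covariance of $F$ with $x$. -/
theorem hasGradientAt_integral_tilt [NeZero μ] (hμ : HasExpMoments μ) {F : E → ℝ}
    (hF : ExpIntegrable μ F) (h : E) :
    HasGradientAt (fun h => ∫ x, F x ∂tilt h μ)
      ((∫ x, F x • x ∂tilt h μ) - (∫ x, F x ∂tilt h μ) • ∫ x, x ∂tilt h μ) h := by
  have h1 := (hμ.expIntegrable_one.hasGradientAt_laplace h).hasFDerivAt
  have h2 := (hF.hasGradientAt_laplace h).hasFDerivAt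
  have hpos := laplace_one_pos hμ h
  have h3 := ((hasDerivAt_inv hpos.ne').comp_hasFDerivAt h h1).mul h2
  simp_rw [integral_tilt]
  rw [hasGradientAt_iff_hasFDerivAt]
  refine h3.congr_fderiv (ContinuousLinearMap.ext fun v => ?_)
  simp
  ring

theorem contDiff_integral_tilt [NeZero μ] (hμ : HasExpMoments μ) {F : E → ℝ}
    (hF : ExpIntegrable μ F) (n : ℕ) : ContDiff ℝ n fun h => ∫ x, F x ∂tilt h μ := by
  simp_rw [integral_tilt]
  exact ((hμ.expIntegrable_one.contDiff_laplace n).inv fun h => (laplace_one_pos hμ h).ne').smul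
    (hF.contDiff_laplace n)

theorem hasGradientAt_integral_tilt_comp [NeZero μ] (hμ : HasExpMoments μ) {F : E → ℝ}
    (hF : ExpIntegrable μ F) {R : E →L[ℝ] E} (hR : IsSelfAdjoint R) (φ : E) :
    HasGradientAt (fun φ => ∫ x, F x ∂tilt (R φ) μ)
      (R ((∫ x, F x • x ∂tilt (R φ) μ) - (∫ x, F x ∂tilt (R φ) μ) • ∫ x, x ∂tilt (R φ) μ)) φ := by
  have h1 := (hasGradientAt_integral_tilt hμ hF (R φ)).hasFDerivAt.comp φ R.hasFDerivAt
  rw [hasGradientAt_iff_hasFDerivAt]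
  refine h1.congr_fderiv (ContinuousLinearMap.ext fun v => ?_)
  have := (ContinuousLinearMap.isSelfAdjoint_iff_isSymmetric.1 hR)
    ((∫ x, F x • x ∂tilt (R φ) μ) - (∫ x, F x ∂tilt (R φ) μ) • ∫ x, x ∂tilt (R φ) μ) v
  exact this.symm

/-- The gradient is $R d$ with $d = E[Fx] - pE[x]$ and $p = E[F]$, and $(Rd, \dot C Rd) = (d, R\dot
CR\,d)$. Entropic stability for $F/p$ is exactly a bound on this form, and the homogeneity of the
entropy removes the normalisation. The left side is $2(∇\sqrt p)^2_{\dot C}$ written without the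
square root. -/
theorem quadForm_gradient_le [IsProbabilityMeasure μ] (hμ : HasExpMoments μ) {R Cd : E →L[ℝ] E}
    (hR : IsSelfAdjoint R) (hCd : Cd.IsPositive) {a : ℝ} (ha : 0 < a)
    (hcov : ∀ h, (R * Cd * R) * cov (tilt h μ) * (R * Cd * R) ≤ a • (R * Cd * R))
    {F : E → ℝ} (hF : Measurable F) (h0 : ∀ x, 0 ≤ F x) {M : ℝ} (hM : ∀ x, F x ≤ M) {φ : E}
    (hp : 0 < ∫ x, F x ∂tilt (R φ) μ) :
    1 / 2 * quadForm Cd (gradient (fun φ => ∫ x, F x ∂tilt (R φ) μ) φ)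
      / (∫ x, F x ∂tilt (R φ) μ) ≤ a * ent (tilt (R φ) μ) F := by
  have hFexp : ExpIntegrable μ F := hμ.expIntegrable_of_bounded hF.aestronglyMeasurable
    (K := M) fun x => by rw [Real.norm_eq_abs, abs_of_nonneg (h0 x)]; exact hM x
  rw [(hasGradientAt_integral_tilt_comp hμ hFexp hR φ).gradient]
  have hprob := hμ.isProbabilityMeasure_tilt (R φ)
  have hT := hμ.tilt (R φ)
  set T := tilt (R φ) μ with hTdef
  set p := ∫ x, F x ∂T with hpdef
  have hFi : Integrable F T := hFexp.integrable_tilt hμ (R φ)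
  have hΦ : Integrable (fun x => Phi (F x)) T := integrable_Phi_of_bounded hF h0 hM
  have hSd : (R * Cd * R).IsPositive := by
    have := hCd.conj_adjoint R
    rwa [hR.adjoint_eq] at this
  have h1 := half_quadForm_le_ent (F := fun x => p⁻¹ * F x) hT hSd ha
    (fun h => by rw [hTdef, hμ.tilt_tilt]; exact hcov _)
    (fun x => mul_nonneg (inv_nonneg.2 hp.le) (h0 x)) (hFi.const_mul _)
    (by rw [integral_const_mul, ← hpdef, inv_mul_cancel₀ hp.ne'])
    (by
      simp only [Phi_mul (inv_pos.2 hp)]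
      exact (hΦ.const_mul _).add (hFi.mul_const _))
  rw [ent_const_mul (inv_pos.2 hp) hFi hΦ] at h1
  have e1 : (∫ x, (p⁻¹ * F x) • x ∂T) - ∫ x, x ∂T =
      p⁻¹ • ((∫ x, F x • x ∂T) - p • ∫ x, x ∂T) := by
    simp_rw [mul_smul]
    rw [integral_smul, smul_sub, smul_smul, inv_mul_cancel₀ hp.ne', one_smul]
  set d := (∫ x, F x • x ∂T) - p • ∫ x, x ∂T
  rw [e1, quadForm_smul] at h1
  have e2 : quadForm (R * Cd * R) d = quadForm Cd (R d) :=
    ((ContinuousLinearMap.isSelfAdjoint_iff_isSymmetric.1 hR) d (Cd (R d))).symm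
  rw [e2] at h1
  have h2 := mul_le_mul_of_nonneg_left h1 hp.le
  have e3 : p * (1 / 2 * (p⁻¹ ^ 2 * quadForm Cd (R d))) = 1 / 2 * quadForm Cd (R d) / p := by
    field_simp
  have e4 : p * (a * (p⁻¹ * ent T F)) = a * ent T F := by field_simp
  rwa [e3, e4] at h2

theorem quadForm_gradient_sqrt_le [IsProbabilityMeasure μ] (hμ : HasExpMoments μ)
    {R Cd : E →L[ℝ] E} (hR : IsSelfAdjoint R) (hCd : Cd.IsPositive) {a : ℝ} (ha : 0 < a)
    (hcov : ∀ h, (R * Cd * R) * cov (tilt h μ) * (R * Cd * R) ≤ a • (R * Cd * R))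
    {F : E → ℝ} (hF : Measurable F) (h0 : ∀ x, 0 ≤ F x) {M : ℝ} (hM : ∀ x, F x ≤ M) (φ : E) :
    DifferentiableAt ℝ (fun φ => √(∫ x, F x ∂tilt (R φ) μ)) φ ∧
      2 * quadForm Cd (gradient (fun φ => √(∫ x, F x ∂tilt (R φ) μ)) φ) ≤
        a * ent (tilt (R φ) μ) F := by
  have hFexp : ExpIntegrable μ F := hμ.expIntegrable_of_bounded hF.aestronglyMeasurable
    (K := M) fun x => by rw [Real.norm_eq_abs, abs_of_nonneg (h0 x)]; exact hM x
  -- If the average vanishes at one point then $F = 0$ almost everywhere for `μ`, hence for every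
  -- tilt. The square root is then identically zero, so its failure to be differentiable at the
  -- origin does no harm.
  rcases (integral_nonneg (μ := tilt (R φ) μ) (show (0 : E → ℝ) ≤ F from h0)).eq_or_lt with hp | hp
  · have hFi : Integrable F (tilt (R φ) μ) := hFexp.integrable_tilt hμ (R φ)
    have hz := (integral_eq_zero_iff_of_nonneg h0 hFi).1 hp.symm
    have hz' : F =ᵐ[μ] 0 := (absolutelyContinuous_tilted (hμ.integrable_exp_inner (R φ))).ae_le hz
    have hall : (fun φ => √(∫ x, F x ∂tilt (R φ) μ)) = fun _ => 0 := by
      ext ψ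
      have : F =ᵐ[tilt (R ψ) μ] 0 := (tilted_absolutelyContinuous μ _).ae_le hz'
      rw [integral_congr_ae this]
      simp
    rw [hall]
    refine ⟨differentiableAt_const _, ?_⟩
    have he : ent (tilt (R φ) μ) F = 0 := by
      have : (fun x => Phi (F x)) =ᵐ[tilt (R φ) μ] 0 := by
        filter_upwards [hz] with x hx
        simp [hx, Phi]
      rw [ent, integral_congr_ae this, ← hp]
      simp [Phi]
    simp [he, quadForm]
  · have hg := hasGradientAt_integral_tilt_comp hμ hFexp hR φ
    have hle := quadForm_gradient_le hμ hR hCd ha hcov hF h0 hM hp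
    rw [hg.gradient] at hle
    have hs := hg.hasFDerivAt.sqrt hp.ne'
    refine ⟨hs.differentiableAt, ?_⟩
    have hs' : HasGradientAt (fun φ => √(∫ x, F x ∂tilt (R φ) μ))
      ((1 / (2 * √(∫ x, F x ∂tilt (R φ) μ))) • (R ((∫ x, F x • x ∂tilt (R φ) μ) -
        (∫ x, F x ∂tilt (R φ) μ) • ∫ x, x ∂tilt (R φ) μ))) φ := by
      rw [hasGradientAt_iff_hasFDerivAt, map_smul]
      exact hs
    rw [hs'.gradient, quadForm_smul]
    refine le_of_eq_of_le ?_ hle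
    rw [div_pow, mul_pow, Real.sq_sqrt hp.le]
    ring

end GradientEstimate

/-! ### The Bregman divergence of $x \log x$ and its second-order expansion. -/

section Bregman

/-- The Bregman divergence of `Φ`. -/
def bregman (p q : ℝ) : ℝ := Phi p - Phi q - (Real.log q + 1) * (p - q)

theorem bregman_eq (p q : ℝ) : bregman p q = p * Real.log p - p * Real.log q - p + q := by
  rw [bregman, Phi, Phi]
  ring

theorem bregman_nonneg {p q : ℝ} (hp : 0 ≤ p) (hq : 0 < q) : 0 ≤ bregman p q := by
  have := mul_le_Phi_sub_add_exp hp (Real.log q)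
  rw [Real.exp_log hq, Phi] at this
  rw [bregman_eq]
  linarith

/-- This follows from $\log(p/q) ≤ p/q - 1$. Unlike the quadratic expansion it holds for all $p$, so
it can serve as a dominating bound. -/
theorem bregman_le {p q : ℝ} (hp : 0 ≤ p) (hq : 0 < q) : bregman p q ≤ (p - q) ^ 2 / q := by
  rw [bregman_eq, le_div_iff₀ hq]
  rcases hp.eq_or_lt with rfl | hp
  · simp [sq]
  · have h := Real.log_le_sub_one_of_pos (div_pos hp hq)
    rw [Real.log_div hp.ne' hq.ne', le_sub_iff_add_le, le_div_iff₀ hq] at h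
    nlinarith [mul_le_mul_of_nonneg_left h hp.le]

theorem abs_bregman_sub_le {p q : ℝ} (hq : 0 < q) (h : |p - q| ≤ q / 2) :
    |bregman p q - (p - q) ^ 2 / (2 * q)| ≤ 4 * |p - q| ^ 3 / q ^ 2 := by
  have hp : 0 < p := by linarith [abs_le.1 h]
  set x := 1 - p / q with hx
  have hxa : |x| = |p - q| / q := by
    rw [hx, one_sub_div hq.ne', abs_div, abs_of_pos hq, abs_sub_comm]
  have hx2 : |x| ≤ 1 / 2 := by
    rw [hxa, div_le_iff₀ hq]; linarith
  have hx1 : |x| < 1 := by linarith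
  -- The logarithmic series of $\log(1-x)$ with $x = 1 - p/q$, cut after $x^2/2$; for $|x| ≤ 1/2$
  -- its remainder is at most $2|x|^3$.
  have hT := Real.abs_log_sub_add_sum_range_le hx1 2
  have h1x : 1 - x = p / q := by rw [hx]; ring
  rw [h1x, Real.log_div hp.ne' hq.ne'] at hT
  simp only [Finset.sum_range_succ, Finset.sum_range_zero] at hT
  norm_num at hT
  set R := x + x ^ 2 / 2 + (Real.log p - Real.log q) with hR
  have hR' : |R| ≤ 2 * |x| ^ 3 := by
    refine hT.trans ?_
    rw [div_le_iff₀ (by linarith)]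
    nlinarith [pow_nonneg (abs_nonneg x) 3]
  have hpq : p = q * (1 - x) := by rw [h1x]; field_simp
  have e : bregman p q - (p - q) ^ 2 / (2 * q) = q * (x ^ 3 / 2 + (1 - x) * R) := by
    rw [bregman_eq]
    have hl : Real.log p = R - x - x ^ 2 / 2 + Real.log q := by rw [hR]; ring
    rw [hl, hpq]
    field_simp
    ring
  rw [e, abs_mul, abs_of_pos hq]
  -- The constant is $\frac12 + \frac32 · 2 = \frac72$, rounded up to $4$.
  have h3 : |x ^ 3 / 2 + (1 - x) * R| ≤ 4 * |x| ^ 3 := by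
    have a1 := abs_add_le (x ^ 3 / 2) ((1 - x) * R)
    rw [abs_mul, abs_div, abs_pow] at a1
    have a2 : |1 - x| ≤ 3 / 2 := by
      rw [abs_le] at hx2 ⊢
      constructor <;> linarith
    have a3 : |1 - x| * |R| ≤ 3 / 2 * (2 * |x| ^ 3) := by gcongr
    norm_num at a1
    nlinarith [pow_nonneg (abs_nonneg x) 3]
  calc q * |x ^ 3 / 2 + (1 - x) * R| ≤ q * (4 * |x| ^ 3) := by gcongr
    _ = 4 * |p - q| ^ 3 / q ^ 2 := by rw [hxa]; field_simp

/-- The cubic remainder divided by $r^2$ is $r$ times a convergent quantity. Both arguments vary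
along the filter because the expansion is later used at moving base points. -/
theorem tendsto_bregman_div_sq {ι : Type*} {l : Filter ι} {p q r : ι → ℝ} {c d : ℝ} (hc : 0 < c)
    (hq : Tendsto q l (𝓝 c)) (hr : Tendsto r l (𝓝 0)) (hr0 : ∀ᶠ i in l, 0 < r i)
    (hd : Tendsto (fun i => (p i - q i) / r i) l (𝓝 d)) :
    Tendsto (fun i => bregman (p i) (q i) / r i ^ 2) l (𝓝 (d ^ 2 / (2 * c))) := by
  have hpq : Tendsto (fun i => p i - q i) l (𝓝 0) := by
    have := hd.mul hr
    rw [mul_zero] at this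
    refine this.congr' ?_
    filter_upwards [hr0] with i hi
    field_simp
  have h1 : Tendsto (fun i => ((p i - q i) / r i) ^ 2 / (2 * q i)) l (𝓝 (d ^ 2 / (2 * c))) :=
    (hd.pow 2).div (hq.const_mul 2) (by positivity)
  have h2 : Tendsto (fun i => 4 * |(p i - q i) / r i| ^ 3 / q i ^ 2 * r i) l (𝓝 0) := by
    have := ((((hd.abs).pow 3).const_mul 4).div (hq.pow 2) (by positivity)).mul hr
    simpa using this
  have h3 : Tendsto (fun i => bregman (p i) (q i) / r i ^ 2 -
      ((p i - q i) / r i) ^ 2 / (2 * q i)) l (𝓝 0) := by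
    refine squeeze_zero_norm' ?_ h2
    have hq2 : ∀ᶠ i in l, c / 2 < q i := hq.eventually (lt_mem_nhds (by linarith))
    have hsm : ∀ᶠ i in l, |p i - q i| < c / 4 := by
      have := hpq.abs
      rw [abs_zero] at this
      exact this.eventually (gt_mem_nhds (by linarith))
    filter_upwards [hr0, hq2, hsm] with i hi hqi hsi
    have hqpos : 0 < q i := by linarith
    have hb := abs_bregman_sub_le hqpos (p := p i) (by linarith)
    have e : bregman (p i) (q i) / r i ^ 2 - ((p i - q i) / r i) ^ 2 / (2 * q i) =
        (bregman (p i) (q i) - (p i - q i) ^ 2 / (2 * q i)) / r i ^ 2 := by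
      field_simp
    rw [e, Real.norm_eq_abs, abs_div, abs_of_pos (pow_pos hi 2), div_le_iff₀ (pow_pos hi 2)]
    refine hb.trans (le_of_eq ?_)
    rw [abs_div, abs_of_pos hi]
    field_simp
  simpa using h3.add h1

end Bregman

/-! ### The Jensen gap. -/

section Gap

variable {Ω : Type*} [MeasurableSpace Ω]

/-- The Jensen gap of `(f, z) ↦ f log (f / z)`, in terms of `z` and `p = f / z`. -/
def phiGap (ρ : Measure Ω) (Z P : Ω → ℝ) : ℝ :=
  (∫ ω, Z ω * Phi (P ω) ∂ρ) - (∫ ω, Z ω ∂ρ) * Phi ((∫ ω, Z ω * P ω ∂ρ) / ∫ ω, Z ω ∂ρ)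

variable {ρ : Measure Ω} {Z P : Ω → ℝ}

/-- The gap does not change when an affine function is subtracted from $Φ$, so $Φ$ may be replaced
by its Bregman divergence relative to any point `c`. -/
theorem phiGap_eq (hZ : Integrable Z ρ) (hZP : Integrable (fun ω => Z ω * P ω) ρ)
    (hZΦ : Integrable (fun ω => Z ω * Phi (P ω)) ρ) (hpos : 0 < ∫ ω, Z ω ∂ρ) (c : ℝ) :
    phiGap ρ Z P = (∫ ω, Z ω * bregman (P ω) c ∂ρ) -
      (∫ ω, Z ω ∂ρ) * bregman ((∫ ω, Z ω * P ω ∂ρ) / ∫ ω, Z ω ∂ρ) c := by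
  have h1 : ∫ ω, Z ω * bregman (P ω) c ∂ρ = (∫ ω, Z ω * Phi (P ω) ∂ρ) - (∫ ω, Z ω ∂ρ) * Phi c
      - (Real.log c + 1) * ((∫ ω, Z ω * P ω ∂ρ) - (∫ ω, Z ω ∂ρ) * c) := by
    have e : ∀ ω, Z ω * bregman (P ω) c = Z ω * Phi (P ω) - Z ω * Phi c
        - (Real.log c + 1) * (Z ω * P ω - Z ω * c) := fun ω => by rw [bregman]; ring
    simp_rw [e]
    have i1 : Integrable (fun ω => Z ω * Phi (P ω) - Z ω * Phi c) ρ := hZΦ.sub (hZ.mul_const _)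
    have i2 : Integrable (fun ω => Z ω * P ω - Z ω * c) ρ := hZP.sub (hZ.mul_const _)
    rw [integral_sub i1 (i2.const_mul _), integral_sub hZΦ (hZ.mul_const _), integral_const_mul,
      integral_sub hZP (hZ.mul_const _), integral_mul_const, integral_mul_const]
  rw [h1, phiGap, bregman]
  field_simp
  ring

theorem phiGap_nonneg (hZ : Integrable Z ρ) (hZP : Integrable (fun ω => Z ω * P ω) ρ)
    (hZΦ : Integrable (fun ω => Z ω * Phi (P ω)) ρ) (hpos : 0 < ∫ ω, Z ω ∂ρ)
    (hZ0 : ∀ ω, 0 ≤ Z ω) (hP0 : ∀ ω, 0 ≤ P ω) (hpos' : 0 < ∫ ω, Z ω * P ω ∂ρ) :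
    0 ≤ phiGap ρ Z P := by
  -- With `c` equal to the average ratio the subtracted term vanishes and only a nonnegative
  -- integral is left.
  rw [phiGap_eq hZ hZP hZΦ hpos ((∫ ω, Z ω * P ω ∂ρ) / ∫ ω, Z ω ∂ρ)]
  have : bregman ((∫ ω, Z ω * P ω ∂ρ) / ∫ ω, Z ω ∂ρ) ((∫ ω, Z ω * P ω ∂ρ) / ∫ ω, Z ω ∂ρ) = 0 := by
    simp [bregman]
  rw [this, mul_zero, sub_zero]
  exact integral_nonneg fun ω => mul_nonneg (hZ0 ω) (bregman_nonneg (hP0 ω) (div_pos hpos' hpos))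

theorem phiGap_le (hZ : Integrable Z ρ) (hZP : Integrable (fun ω => Z ω * P ω) ρ)
    (hZΦ : Integrable (fun ω => Z ω * Phi (P ω)) ρ) (hpos : 0 < ∫ ω, Z ω ∂ρ)
    (hZ0 : ∀ ω, 0 ≤ Z ω) (hP0 : ∀ ω, 0 ≤ P ω) {c : ℝ} (hc : 0 < c) :
    phiGap ρ Z P ≤ ∫ ω, Z ω * bregman (P ω) c ∂ρ := by
  rw [phiGap_eq hZ hZP hZΦ hpos c]
  have h1 : 0 ≤ ∫ ω, Z ω * P ω ∂ρ := integral_nonneg fun ω => mul_nonneg (hZ0 ω) (hP0 ω)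
  have := mul_nonneg hpos.le (bregman_nonneg (div_nonneg h1 hpos.le) hc)
  linarith

end Gap

/-! ### Quadratic bounds from Lipschitz square roots. -/

section Profile

theorem integral_pos_of_pos {Ω : Type*} [MeasurableSpace Ω] {ρ : Measure Ω} [NeZero ρ]
    {f : Ω → ℝ} (hf : Integrable f ρ) (h0 : ∀ ω, 0 < f ω) : 0 < ∫ ω, f ω ∂ρ := by
  rw [integral_pos_iff_support_of_nonneg (fun ω => (h0 ω).le) hf,
    Set.eq_univ_of_forall (s := Function.support f) fun ω => (h0 ω).ne']
  exact NeZero.pos _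

variable {E : Type*} [NormedAddCommGroup E] [NormedSpace ℝ E]

/-- A pair of a density `z` and a ratio `p`, with `√z` and `√(z p)` Lipschitz. -/
structure GapProfile (z p : E → ℝ) (ε M B L : ℝ) : Prop where
  eps_pos : 0 < ε
  le_ratio : ∀ x, ε ≤ p x
  ratio_le : ∀ x, p x ≤ M
  density_pos : ∀ x, 0 < z x
  density_le : ∀ x, z x ≤ B
  continuous_density : Continuous z
  continuous_ratio : Continuous p
  lipschitz_density : ∀ x y, |√(z x) - √(z y)| ≤ L * ‖x - y‖
  lipschitz_product : ∀ x y, |√(z x * p x) - √(z y * p y)| ≤ L * ‖x - y‖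

namespace GapProfile

variable {z p : E → ℝ} {ε M B L : ℝ}

theorem ratio_pos (h : GapProfile z p ε M B L) (x : E) : 0 < p x :=
  h.eps_pos.trans_le (h.le_ratio x)

theorem bound_pos (h : GapProfile z p ε M B L) : 0 < M :=
  (h.ratio_pos 0).trans_le (h.ratio_le 0)

/-- The constant in the quadratic bounds. -/
def quadConst (M L : ℝ) : ℝ := 4 * M * (L * (1 + √M)) ^ 2

theorem quadConst_nonneg (h : GapProfile z p ε M B L) : 0 ≤ quadConst M L := by
  have := h.bound_pos
  unfold quadConst
  positivity

/-- Without a lower bound on `z` the ratio `p` has no uniform Lipschitz constant, but the weight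
$z_y$ compensates: $\sqrt{z_y}(\sqrt{p_y}-\sqrt{p_x})$ is the increment of $\sqrt{zp}$ minus
$\sqrt{p_x}$ times the increment of $\sqrt z$. The remaining factor $\sqrt{p_y}+\sqrt{p_x}$ is at
most $2\sqrt M$. -/
theorem mul_sq_sub_le (h : GapProfile z p ε M B L) (x y : E) :
    z y * (p y - p x) ^ 2 ≤ quadConst M L * ‖y - x‖ ^ 2 := by
  have hx := h.ratio_pos x
  have hy := h.ratio_pos y
  have hM := h.bound_pos
  have e1 : √(z y) * (√(p y) - √(p x)) =
      (√(z y * p y) - √(z x * p x)) - √(p x) * (√(z y) - √(z x)) := by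
    rw [Real.sqrt_mul (h.density_pos y).le, Real.sqrt_mul (h.density_pos x).le]
    ring
  have hsx : √(p x) ≤ √M := Real.sqrt_le_sqrt (h.ratio_le x)
  have hsy : √(p y) ≤ √M := Real.sqrt_le_sqrt (h.ratio_le y)
  have hL : 0 ≤ L * ‖y - x‖ := (abs_nonneg _).trans (h.lipschitz_density y x)
  have h1 : |√(z y) * (√(p y) - √(p x))| ≤ L * (1 + √M) * ‖y - x‖ := by
    rw [e1]
    refine (abs_sub _ _).trans ?_
    rw [abs_mul, abs_of_nonneg (Real.sqrt_nonneg _)]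
    have a1 := h.lipschitz_product y x
    have a2 := mul_le_mul hsx (h.lipschitz_density y x) (abs_nonneg _) (Real.sqrt_nonneg M)
    linarith
  have h2 : (√(z y) * (√(p y) - √(p x))) ^ 2 ≤ (L * (1 + √M) * ‖y - x‖) ^ 2 := by
    rw [← sq_abs]
    gcongr
  have h3 : (√(p y) + √(p x)) ^ 2 ≤ 4 * M := by
    have : (√(p y) + √(p x)) ^ 2 ≤ (2 * √M) ^ 2 := by
      gcongr
      linarith
    rwa [mul_pow, Real.sq_sqrt hM.le, show (2 : ℝ) ^ 2 = 4 by norm_num] at this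
  calc z y * (p y - p x) ^ 2
      = √(z y) ^ 2 * (√(p y) ^ 2 - √(p x) ^ 2) ^ 2 := by
        rw [Real.sq_sqrt (h.density_pos y).le, Real.sq_sqrt hx.le, Real.sq_sqrt hy.le]
    _ = (√(p y) + √(p x)) ^ 2 * (√(z y) * (√(p y) - √(p x))) ^ 2 := by ring
    _ ≤ 4 * M * (L * (1 + √M) * ‖y - x‖) ^ 2 := by gcongr
    _ = quadConst M L * ‖y - x‖ ^ 2 := by rw [quadConst]; ring

theorem mul_bregman_le (h : GapProfile z p ε M B L) (x y : E) :
    z y * bregman (p y) (p x) ≤ quadConst M L / ε * ‖y - x‖ ^ 2 := by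
  have hx := h.ratio_pos x
  have hε := h.eps_pos
  calc z y * bregman (p y) (p x) ≤ z y * ((p y - p x) ^ 2 / p x) := by
        have := h.density_pos y
        gcongr
        exact bregman_le (h.ratio_pos y).le hx
    _ = z y * (p y - p x) ^ 2 / p x := by ring
    _ ≤ z y * (p y - p x) ^ 2 / ε := by
        have := h.density_pos y
        gcongr
        exact h.le_ratio x
    _ ≤ quadConst M L * ‖y - x‖ ^ 2 / ε := by
        exact div_le_div_of_nonneg_right (h.mul_sq_sub_le x y) hε.le
    _ = _ := by ring

theorem mul_abs_sub_le (h : GapProfile z p ε M B L) (x y : E) :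
    z y * |p y - p x| ≤ √B * √(quadConst M L) * ‖y - x‖ := by
  have hz := h.density_pos y
  have h1 : z y * |p y - p x| = √(z y) * √(z y * (p y - p x) ^ 2) := by
    rw [Real.sqrt_mul hz.le, Real.sqrt_sq_eq_abs, ← mul_assoc, Real.mul_self_sqrt hz.le]
  rw [h1, mul_assoc]
  have h2 : √(z y * (p y - p x) ^ 2) ≤ √(quadConst M L) * ‖y - x‖ := by
    rw [← Real.sqrt_sq (norm_nonneg (y - x)), ← Real.sqrt_mul h.quadConst_nonneg]
    exact Real.sqrt_le_sqrt (h.mul_sq_sub_le x y)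
  gcongr
  exact h.density_le y

variable [MeasurableSpace E] [BorelSpace E] {Ω : Type*} [MeasurableSpace Ω] {ρ : Measure Ω}
  [IsProbabilityMeasure ρ] {Y : Ω → E}

theorem integrable_density (h : GapProfile z p ε M B L) (hY : Measurable Y) :
    Integrable (fun ω => z (Y ω)) ρ :=
  integrable_of_bounded (h.continuous_density.measurable.comp hY) (M := B) fun ω => by
    rw [abs_of_pos (h.density_pos _)]; exact h.density_le _

theorem integrable_density_mul (h : GapProfile z p ε M B L) (hY : Measurable Y) {g : ℝ → ℝ}
    (hg : Continuous g) : Integrable (fun ω => z (Y ω) * g (p (Y ω))) ρ := by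
  obtain ⟨K, hK⟩ := (isCompact_Icc (a := ε) (b := M)).exists_bound_of_continuousOn hg.continuousOn
  exact (h.integrable_density hY).mul_bdd
    (hg.measurable.comp (h.continuous_ratio.measurable.comp hY)).aestronglyMeasurable
    (ae_of_all _ fun ω => hK _ ⟨h.le_ratio _, h.ratio_le _⟩)

theorem integrable_product (h : GapProfile z p ε M B L) (hY : Measurable Y) :
    Integrable (fun ω => z (Y ω) * p (Y ω)) ρ :=
  h.integrable_density_mul hY continuous_id

theorem integral_density_pos (h : GapProfile z p ε M B L) (hY : Measurable Y) :
    0 < ∫ ω, z (Y ω) ∂ρ :=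
  integral_pos_of_pos (h.integrable_density hY) fun _ => h.density_pos _

theorem integral_product_pos (h : GapProfile z p ε M B L) (hY : Measurable Y) :
    0 < ∫ ω, z (Y ω) * p (Y ω) ∂ρ :=
  integral_pos_of_pos (h.integrable_product hY)
    fun _ => mul_pos (h.density_pos _) (h.ratio_pos _)

theorem phiGap_nonneg (h : GapProfile z p ε M B L) (hY : Measurable Y) :
    0 ≤ phiGap ρ (fun ω => z (Y ω)) (fun ω => p (Y ω)) :=
  Polchinski.phiGap_nonneg (h.integrable_density hY) (h.integrable_product hY)
    (h.integrable_density_mul hY continuous_Phi) (h.integral_density_pos hY)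
    (fun _ => (h.density_pos _).le) (fun _ => (h.ratio_pos _).le) (h.integral_product_pos hY)

/-- The Bregman base point is $p(x)$. The bound is quadratic in the noise and depends on the profile
only through its constants, as dominated convergence requires. -/
theorem phiGap_le (h : GapProfile z p ε M B L) (hY : Measurable Y) (x : E)
    (hY2 : Integrable (fun ω => ‖Y ω - x‖ ^ 2) ρ) :
    phiGap ρ (fun ω => z (Y ω)) (fun ω => p (Y ω)) ≤
      quadConst M L / ε * ∫ ω, ‖Y ω - x‖ ^ 2 ∂ρ := by
  refine (Polchinski.phiGap_le (h.integrable_density hY)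
    (h.integrable_product hY) (h.integrable_density_mul hY continuous_Phi)
    (h.integral_density_pos hY) (fun _ => (h.density_pos _).le) (fun _ => (h.ratio_pos _).le)
    (h.ratio_pos x)).trans ?_
  rw [← integral_const_mul]
  exact integral_mono_of_nonneg (ae_of_all _ fun ω => mul_nonneg (h.density_pos _).le
    (bregman_nonneg (h.ratio_pos _).le (h.ratio_pos x))) (hY2.const_mul _)
    (ae_of_all _ fun ω => h.mul_bregman_le x (Y ω))

end GapProfile

end Profile

/-! ### Small-noise asymptotics of the Jensen gap. -/

section Limit

variable {E W : Type*} [NormedAddCommGroup E] [NormedSpace ℝ E] [NormedAddCommGroup W]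
  [NormedSpace ℝ W]

/-- Strict differentiability is what allows the base point `y i` to move together with the
increment. -/
theorem HasStrictFDerivAt.tendsto_div {ι : Type*} {l : Filter ι} {p : E → ℝ} {p' : E →L[ℝ] ℝ}
    {x : E} (hp : HasStrictFDerivAt p p' x) {y : ι → E} {r : ι → ℝ} {u : ι → E} {v : E}
    (hy : Tendsto y l (𝓝 x)) (hr : Tendsto r l (𝓝 0)) (hr0 : ∀ᶠ i in l, 0 < r i)
    (hu : Tendsto u l (𝓝 v)) :
    Tendsto (fun i => (p (y i + r i • u i) - p (y i)) / r i) l (𝓝 (p' v)) := by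
  have h1 : Tendsto (fun i => (y i + r i • u i, y i)) l (𝓝 (x, x)) := by
    refine Tendsto.prodMk_nhds ?_ hy
    simpa using hy.add (hr.smul hu)
  have h2 := hp.isLittleO.comp_tendsto h1
  have h3 : (fun i => r i • u i) =O[l] r := by
    have := (Asymptotics.isBigO_refl r l).smul (hu.isBigO_one ℝ)
    simpa using this
  have h4 : (fun i => p (y i + r i • u i) - p (y i) - p' (r i • u i)) =o[l] r := by
    refine (h2.congr (fun i => ?_) (fun i => ?_)).trans_isBigO h3 <;> simp
  have h5 := h4.tendsto_div_nhds_zero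
  have h6 : Tendsto (fun i => p' (u i)) l (𝓝 (p' v)) := (p'.continuous.tendsto v).comp hu
  have h7 := h5.add h6
  rw [zero_add] at h7
  refine h7.congr' ?_
  filter_upwards [hr0] with i hi
  rw [map_smul, smul_eq_mul]
  field_simp
  ring

variable [MeasurableSpace E] [BorelSpace E] [MeasurableSpace W] [BorelSpace W]
  {ρ : Measure W} [IsProbabilityMeasure ρ]

/-- The second-order asymptotics of the Jensen gap under small noise. -/
theorem GapProfile.tendsto_phiGap_div {z p : E → ℝ} {ε M B L : ℝ} (h : GapProfile z p ε M B L)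
    (hρ2 : Integrable (fun w => ‖w‖ ^ 2) ρ) (hρ1 : Integrable (fun w => ‖w‖) ρ)
    (hmean : ∀ f : W →L[ℝ] ℝ, ∫ w, f w ∂ρ = 0)
    {ι : Type*} {l : Filter ι} [l.IsCountablyGenerated] {x : E} {p' : E →L[ℝ] ℝ}
    (hp : HasStrictFDerivAt p p' x) {y : ι → E} {r : ι → ℝ} {S : ι → W →L[ℝ] E} {T : W →L[ℝ] E}
    (hy : Tendsto y l (𝓝 x)) (hr : Tendsto r l (𝓝 0)) (hr0 : ∀ᶠ i in l, 0 < r i)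
    (hS : Tendsto S l (𝓝 T)) :
    Tendsto (fun i => phiGap ρ (fun w => z (y i + r i • S i w)) (fun w => p (y i + r i • S i w))
      / r i ^ 2) l (𝓝 (z x / (2 * p x) * ∫ w, (p' (T w)) ^ 2 ∂ρ)) := by
  have hSw : ∀ w, Tendsto (fun i => S i w) l (𝓝 (T w)) := fun w =>
    ((ContinuousLinearMap.apply ℝ E w).continuous.tendsto T).comp hS
  have hpoint : ∀ w, Tendsto (fun i => y i + r i • S i w) l (𝓝 x) := fun w => by
    simpa using hy.add (hr.smul (hSw w))
  have hz : ∀ w, Tendsto (fun i => z (y i + r i • S i w)) l (𝓝 (z x)) := fun w =>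
    (h.continuous_density.tendsto x).comp (hpoint w)
  have hpy : Tendsto (fun i => p (y i)) l (𝓝 (p x)) := (h.continuous_ratio.tendsto x).comp hy
  have hmeas : ∀ i, Measurable fun w => y i + r i • S i w := fun i => by
    have := (S i).measurable
    fun_prop
  have hdiff : ∀ w, Tendsto (fun i => (p (y i + r i • S i w) - p (y i)) / r i) l
      (𝓝 (p' (T w))) := fun w => HasStrictFDerivAt.tendsto_div hp hy hr hr0 (hSw w)
  have hnorm : ∀ᶠ i in l, ‖S i‖ ≤ ‖T‖ + 1 :=
    (hS.norm.eventually (gt_mem_nhds (lt_add_one ‖T‖))).mono fun i hi => le_of_lt hi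
  have hdist : ∀ i w, 0 < r i → ‖S i‖ ≤ ‖T‖ + 1 →
      ‖y i + r i • S i w - y i‖ ≤ r i * ((‖T‖ + 1) * ‖w‖) := fun i w hi hSi => by
    rw [add_sub_cancel_left, norm_smul, Real.norm_eq_abs, abs_of_pos hi]
    gcongr
    exact (S i).le_of_opNorm_le hSi w
  -- the quadratic term
  have h1 : Tendsto (fun i => ∫ w, z (y i + r i • S i w) *
      (bregman (p (y i + r i • S i w)) (p (y i)) / r i ^ 2) ∂ρ) l
      (𝓝 (∫ w, z x * ((p' (T w)) ^ 2 / (2 * p x)) ∂ρ)) := by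
    refine tendsto_integral_filter_of_dominated_convergence
      (fun w => quadConst M L / ε * ((‖T‖ + 1) ^ 2 * ‖w‖ ^ 2)) ?_ ?_
      ((hρ2.const_mul _).const_mul _) (ae_of_all _ fun w => ?_)
    · refine Eventually.of_forall fun i => Measurable.aestronglyMeasurable ?_
      have m1 := h.continuous_density.measurable.comp (hmeas i)
      have m2 := h.continuous_ratio.measurable.comp (hmeas i)
      have m3 := continuous_Phi.measurable.comp m2
      refine m1.mul (Measurable.div_const ?_ _)
      exact (m3.sub_const _).sub ((m2.sub_const _).const_mul _)
    · filter_upwards [hr0, hnorm] with i hi hSi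
      refine ae_of_all _ fun w => ?_
      have hb := bregman_nonneg (h.ratio_pos (y i + r i • S i w)).le (h.ratio_pos (y i))
      have hzp := h.density_pos (y i + r i • S i w)
      rw [Real.norm_eq_abs, abs_of_nonneg (by positivity), ← mul_div_assoc,
        div_le_iff₀ (pow_pos hi 2)]
      refine (h.mul_bregman_le (y i) _).trans ?_
      have := hdist i w hi hSi
      have hc := div_nonneg h.quadConst_nonneg h.eps_pos.le
      calc quadConst M L / ε * ‖y i + r i • S i w - y i‖ ^ 2
          ≤ quadConst M L / ε * (r i * ((‖T‖ + 1) * ‖w‖)) ^ 2 := by gcongr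
        _ = _ := by ring
    · exact (hz w).mul (tendsto_bregman_div_sq (h.ratio_pos x) hpy hr hr0 (hdiff w))
  -- the linear term
  have h2 : Tendsto (fun i => ∫ w, z (y i + r i • S i w) *
      ((p (y i + r i • S i w) - p (y i)) / r i) ∂ρ) l (𝓝 (∫ w, z x * p' (T w) ∂ρ)) := by
    refine tendsto_integral_filter_of_dominated_convergence
      (fun w => √B * √(quadConst M L) * ((‖T‖ + 1) * ‖w‖)) ?_ ?_
      ((hρ1.const_mul _).const_mul _) (ae_of_all _ fun w => ?_)
    · refine Eventually.of_forall fun i => Measurable.aestronglyMeasurable ?_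
      have m1 := h.continuous_density.measurable.comp (hmeas i)
      have m2 := h.continuous_ratio.measurable.comp (hmeas i)
      exact m1.mul ((m2.sub_const _).div_const _)
    · filter_upwards [hr0, hnorm] with i hi hSi
      refine ae_of_all _ fun w => ?_
      have hzp := h.density_pos (y i + r i • S i w)
      rw [Real.norm_eq_abs, abs_mul, abs_div, abs_of_pos hi, abs_of_pos hzp, ← mul_div_assoc,
        div_le_iff₀ hi]
      refine (h.mul_abs_sub_le (y i) _).trans ?_
      have := hdist i w hi hSi
      calc √B * √(quadConst M L) * ‖y i + r i • S i w - y i‖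
          ≤ √B * √(quadConst M L) * (r i * ((‖T‖ + 1) * ‖w‖)) := by gcongr
        _ = _ := by ring
    · exact (hz w).mul (hdiff w)
  have h3 : Tendsto (fun i => ∫ w, z (y i + r i • S i w) ∂ρ) l (𝓝 (∫ _, z x ∂ρ)) := by
    refine tendsto_integral_filter_of_dominated_convergence (fun _ => B)
      (Eventually.of_forall fun i =>
        (h.continuous_density.measurable.comp (hmeas i)).aestronglyMeasurable)
      (Eventually.of_forall fun i => ae_of_all _ fun w => ?_) (integrable_const B)
      (ae_of_all _ hz)
    rw [Real.norm_eq_abs, abs_of_pos (h.density_pos _)]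
    exact h.density_le _
  -- Centred noise has no first-order contribution.
  have e2 : ∫ w, z x * p' (T w) ∂ρ = 0 := by
    rw [integral_const_mul]
    have := hmean (p'.comp T)
    simp only [ContinuousLinearMap.comp_apply] at this
    rw [this, mul_zero]
  have e3 : ∫ _, z x ∂ρ = z x := by simp
  rw [e2] at h2
  rw [e3] at h3
  have hquot : Tendsto (fun i => (∫ w, z (y i + r i • S i w) *
      ((p (y i + r i • S i w) - p (y i)) / r i) ∂ρ) ^ 2 /
      ((∫ w, z (y i + r i • S i w) ∂ρ) * p (y i))) l (𝓝 0) := by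
    have := (h2.pow 2).div (h3.mul hpy) (mul_pos (h.density_pos x) (h.ratio_pos x)).ne'
    simp only [ne_eq, OfNat.ofNat_ne_zero, not_false_eq_true, zero_pow, zero_div] at this
    exact this
  -- The second term of `phiGap_eq`. By `bregman_le` it is at most the square of the first-order
  -- term over $p(y_i)∫z$, and that square tends to zero.
  have hsmall : Tendsto (fun i => (∫ w, z (y i + r i • S i w) ∂ρ) *
      bregman ((∫ w, z (y i + r i • S i w) * p (y i + r i • S i w) ∂ρ) /
        ∫ w, z (y i + r i • S i w) ∂ρ) (p (y i)) / r i ^ 2) l (𝓝 0) := by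
    refine squeeze_zero' ?_ ?_ hquot
    · refine Eventually.of_forall fun i => ?_
      have a1 := h.integral_density_pos (ρ := ρ) (hmeas i)
      have a2 := h.integral_product_pos (ρ := ρ) (hmeas i)
      have := bregman_nonneg (div_pos a2 a1).le (h.ratio_pos (y i))
      positivity
    · filter_upwards [hr0] with i hi
      have a1 := h.integral_density_pos (ρ := ρ) (hmeas i)
      have a2 := h.integral_product_pos (ρ := ρ) (hmeas i)
      have i1 := h.integrable_density (ρ := ρ) (hmeas i)
      have i2 := h.integrable_product (ρ := ρ) (hmeas i)
      have hlin : ∫ w, z (y i + r i • S i w) * ((p (y i + r i • S i w) - p (y i)) / r i) ∂ρ =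
          ((∫ w, z (y i + r i • S i w) * p (y i + r i • S i w) ∂ρ) -
            (∫ w, z (y i + r i • S i w) ∂ρ) * p (y i)) / r i := by
        rw [← integral_mul_const, ← integral_sub i2 (i1.mul_const _), ← integral_div]
        refine integral_congr_ae (ae_of_all _ fun w => ?_)
        ring
      rw [hlin]
      have hb := bregman_le (div_pos a2 a1).le (h.ratio_pos (y i))
      have hpi := h.ratio_pos (y i)
      set A := ∫ w, z (y i + r i • S i w) ∂ρ
      set D := ∫ w, z (y i + r i • S i w) * p (y i + r i • S i w) ∂ρ
      calc A * bregman (D / A) (p (y i)) / r i ^ 2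
          ≤ A * ((D / A - p (y i)) ^ 2 / p (y i)) / r i ^ 2 := by gcongr
        _ = _ := by field_simp
  have h4 := h1.sub hsmall
  have e4 : (∫ w, z x * ((p' (T w)) ^ 2 / (2 * p x)) ∂ρ) - 0 =
      z x / (2 * p x) * ∫ w, (p' (T w)) ^ 2 ∂ρ := by
    rw [sub_zero, ← integral_const_mul]
    refine integral_congr_ae (ae_of_all _ fun w => ?_)
    ring
  rw [e4] at h4
  refine h4.congr fun i => ?_
  have e5 : ∫ w, z (y i + r i • S i w) *
      (bregman (p (y i + r i • S i w)) (p (y i)) / r i ^ 2) ∂ρ =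
      (∫ w, z (y i + r i • S i w) * bregman (p (y i + r i • S i w)) (p (y i)) ∂ρ) / r i ^ 2 := by
    rw [← integral_div]
    refine integral_congr_ae (ae_of_all _ fun w => ?_)
    ring
  rw [e5, phiGap_eq (h.integrable_density (hmeas i)) (h.integrable_product (hmeas i))
    (h.integrable_density_mul (hmeas i) continuous_Phi) (h.integral_density_pos (hmeas i)) (p (y i)),
    sub_div]

end Limit

/-! ### Hellinger bounds for shifted Gaussians. -/

section Hellinger

/-- The reverse triangle inequality in $L^2$ for $\sqrt a$ and $\sqrt b$, obtained by expanding the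
square and using Cauchy-Schwarz. -/
theorem sq_sqrt_integral_sub_le {Ω : Type*} [MeasurableSpace Ω] {ρ : Measure Ω} {a b : Ω → ℝ}
    (ha : Integrable a ρ) (hb : Integrable b ρ) (ha0 : ∀ ω, 0 ≤ a ω) (hb0 : ∀ ω, 0 ≤ b ω) :
    (√(∫ ω, a ω ∂ρ) - √(∫ ω, b ω ∂ρ)) ^ 2 ≤ ∫ ω, (√(a ω) - √(b ω)) ^ 2 ∂ρ := by
  have hma : MemLp (fun ω => √(a ω)) 2 ρ := by
    rw [memLp_two_iff_integrable_sq (by have := ha.1; fun_prop)]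
    exact ha.congr (ae_of_all _ fun ω => (Real.sq_sqrt (ha0 ω)).symm)
  have hmb : MemLp (fun ω => √(b ω)) 2 ρ := by
    rw [memLp_two_iff_integrable_sq (by have := hb.1; fun_prop)]
    exact hb.congr (ae_of_all _ fun ω => (Real.sq_sqrt (hb0 ω)).symm)
  have hab : Integrable (fun ω => √(a ω) * √(b ω)) ρ := hma.integrable_mul hmb
  have hCS : ∫ ω, √(a ω) * √(b ω) ∂ρ ≤ √(∫ ω, a ω ∂ρ) * √(∫ ω, b ω ∂ρ) := by
    have := integral_mul_le_Lp_mul_Lq_of_nonneg (μ := ρ) Real.HolderConjugate.two_two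
      (ae_of_all _ fun ω => Real.sqrt_nonneg (a ω)) (ae_of_all _ fun ω => Real.sqrt_nonneg (b ω))
      (by simpa using hma) (by simpa using hmb)
    simp only [Real.rpow_two] at this
    simp_rw [Real.sq_sqrt (ha0 _), Real.sq_sqrt (hb0 _), ← Real.sqrt_eq_rpow] at this
    exact this
  have e : ∀ ω, (√(a ω) - √(b ω)) ^ 2 = a ω + b ω - 2 * (√(a ω) * √(b ω)) := fun ω => by
    rw [sub_sq, Real.sq_sqrt (ha0 ω), Real.sq_sqrt (hb0 ω)]
    ring
  simp_rw [e]
  have hadd : Integrable (fun ω => a ω + b ω) ρ := ha.add hb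
  rw [integral_sub hadd (hab.const_mul 2), integral_add ha hb, integral_const_mul, sub_sq,
    Real.sq_sqrt (integral_nonneg ha0), Real.sq_sqrt (integral_nonneg hb0)]
  linarith

variable {E : Type} [NormedAddCommGroup E] [InnerProductSpace ℝ E] [FiniteDimensional ℝ E]
  [MeasurableSpace E] [BorelSpace E] {γ : Measure E} {C : E →L[ℝ] E}

/-- The factors are square roots of the Cameron-Martin densities of the shifts by $φ$ and $ψ$, so
this is the Hellinger affinity of the two shifted Gaussians. -/
theorem IsCentredGaussian.integral_half_density_mul (hγ : IsCentredGaussian γ C) (hC : IsUnit C)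
    (φ ψ : E) :
    ∫ x, Real.exp (⟪C⁻¹ʳ φ, x⟫ / 2 - ⟪C⁻¹ʳ φ, φ⟫ / 4) *
      Real.exp (⟪C⁻¹ʳ ψ, x⟫ / 2 - ⟪C⁻¹ʳ ψ, ψ⟫ / 4) ∂γ =
      Real.exp (-(⟪C⁻¹ʳ (φ - ψ), φ - ψ⟫ / 8)) := by
  have e : ∀ x, Real.exp (⟪C⁻¹ʳ φ, x⟫ / 2 - ⟪C⁻¹ʳ φ, φ⟫ / 4) *
      Real.exp (⟪C⁻¹ʳ ψ, x⟫ / 2 - ⟪C⁻¹ʳ ψ, ψ⟫ / 4) =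
      Real.exp (-(⟪C⁻¹ʳ φ, φ⟫ / 4) - ⟪C⁻¹ʳ ψ, ψ⟫ / 4) *
        Real.exp ⟪(1 / 2 : ℝ) • (C⁻¹ʳ φ + C⁻¹ʳ ψ), x⟫ := fun x => by
    rw [← Real.exp_add, ← Real.exp_add, inner_smul_left, inner_add_left]
    congr 1
    simp
    ring
  simp_rw [e]
  rw [integral_const_mul, hγ.integral_exp_inner, ← Real.exp_add]
  congr 1
  simp only [map_add, map_smul, map_sub, apply_inverse hC, inner_add_left, inner_add_right,
    inner_sub_left, inner_sub_right, inner_smul_left, inner_smul_right, conj_trivial]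
  ring

theorem IsCentredGaussian.integrable_half_density_mul (hγ : IsCentredGaussian γ C) (h k : E)
    (c d : ℝ) :
    Integrable (fun x => Real.exp (⟪h, x⟫ / 2 - c) * Real.exp (⟪k, x⟫ / 2 - d)) γ := by
  refine ((hγ.integrable_exp_inner ((1 / 2 : ℝ) • (h + k))).const_mul (Real.exp (-c - d))).congr
    (ae_of_all _ fun x => ?_)
  simp only
  rw [← Real.exp_add, ← Real.exp_add, inner_smul_left, inner_add_left]
  congr 1
  simp
  ring

/-- The square root of a Gaussian average of a bounded nonnegative function is Lipschitz. -/
theorem IsCentredGaussian.abs_sqrt_sub_sqrt_le (hγ : IsCentredGaussian γ C) (hC : IsUnit C)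
    {G : E → ℝ} (hG : Measurable G) (hG0 : ∀ x, 0 ≤ G x) {B : ℝ} (hB : ∀ x, G x ≤ B) (φ ψ : E) :
    |√(∫ x, G (φ + x) ∂γ) - √(∫ x, G (ψ + x) ∂γ)| ≤ √(B * ‖C⁻¹ʳ‖ / 4) * ‖φ - ψ‖ := by
  -- `u φ` squares to the density of the Gaussian shifted by $φ$, so the shift becomes a weight on
  -- the unshifted `G`.
  set u : E → E → ℝ := fun φ x => Real.exp (⟪C⁻¹ʳ φ, x⟫ / 2 - ⟪C⁻¹ʳ φ, φ⟫ / 4) with hu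
  have hu0 : ∀ φ x, 0 ≤ u φ x := fun φ x => (Real.exp_pos _).le
  have huu : ∀ φ ψ, Integrable (fun x => u φ x * u ψ x) γ := fun φ ψ =>
    hγ.integrable_half_density_mul _ _ _ _
  have hB0 : 0 ≤ B := (hG0 0).trans (hB 0)
  have hGu : ∀ φ, Integrable (fun x => G x * (u φ x * u φ x)) γ := fun φ =>
    (huu φ φ).bdd_mul hG.aestronglyMeasurable (c := B) (ae_of_all _ fun x => by
      rw [Real.norm_eq_abs, abs_of_nonneg (hG0 x)]; exact hB x)
  have hintegr : ∀ φ, ∫ x, G (φ + x) ∂γ = ∫ x, G x * (u φ x * u φ x) ∂γ := fun φ => by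
    rw [hγ.integral_comp_add hC G φ, laplace, ← integral_const_mul]
    refine integral_congr_ae (ae_of_all _ fun x => ?_)
    simp only [hu, smul_eq_mul]
    rw [← Real.exp_add, ← mul_assoc, ← Real.exp_add, mul_comm]
    congr 2
    ring
  rw [hintegr, hintegr]
  have hGu0 : ∀ φ x, 0 ≤ G x * (u φ x * u φ x) := fun φ x =>
    mul_nonneg (hG0 x) (mul_nonneg (hu0 φ x) (hu0 φ x))
  refine abs_le_of_sq_le_sq ?_ (by positivity)
  refine (sq_sqrt_integral_sub_le (hGu φ) (hGu ψ) (hGu0 φ) (hGu0 ψ)).trans ?_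
  have e1 : ∀ x, (√(G x * (u φ x * u φ x)) - √(G x * (u ψ x * u ψ x))) ^ 2 =
      G x * (u φ x * u φ x + u ψ x * u ψ x - 2 * (u φ x * u ψ x)) := fun x => by
    rw [Real.sqrt_mul (hG0 x), Real.sqrt_mul (hG0 x), Real.sqrt_mul_self (hu0 φ x),
      Real.sqrt_mul_self (hu0 ψ x), ← mul_sub, mul_pow, Real.sq_sqrt (hG0 x)]
    ring
  have i1 : Integrable (fun x => u φ x * u φ x + u ψ x * u ψ x) γ := (huu φ φ).add (huu ψ ψ)
  have i2 : Integrable (fun x => u φ x * u φ x + u ψ x * u ψ x - 2 * (u φ x * u ψ x)) γ :=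
    i1.sub ((huu φ ψ).const_mul 2)
  have e2 : ∀ x, u φ x * u φ x + u ψ x * u ψ x - 2 * (u φ x * u ψ x) = (u φ x - u ψ x) ^ 2 :=
    fun x => by ring
  simp_rw [e1]
  have h1 : ∫ x, G x * (u φ x * u φ x + u ψ x * u ψ x - 2 * (u φ x * u ψ x)) ∂γ ≤
      ∫ x, B * (u φ x * u φ x + u ψ x * u ψ x - 2 * (u φ x * u ψ x)) ∂γ := by
    refine integral_mono_of_nonneg (ae_of_all _ fun x => ?_) (i2.const_mul B)
      (ae_of_all _ fun x => ?_)
    · simp only [e2]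
      exact mul_nonneg (hG0 x) (sq_nonneg _)
    · simp only [e2]
      exact mul_le_mul_of_nonneg_right (hB x) (sq_nonneg _)
  refine h1.trans ?_
  rw [integral_const_mul, integral_sub i1 ((huu φ ψ).const_mul 2), integral_add (huu φ φ) (huu ψ ψ),
    integral_const_mul, hγ.integral_half_density_mul hC, hγ.integral_half_density_mul hC,
    hγ.integral_half_density_mul hC]
  simp only [sub_self, map_zero, inner_zero_left, zero_div, neg_zero, Real.exp_zero]
  -- With $q = (C^{-1}(φ-ψ), φ-ψ)$, the squared Hellinger distance $2(1 - e^{-q/8})$ is at most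
  -- $q/4$, which is the source of the $4$ in the Lipschitz constant.
  have h2 := Real.add_one_le_exp (-(⟪C⁻¹ʳ (φ - ψ), φ - ψ⟫ / 8))
  have h3 : ⟪C⁻¹ʳ (φ - ψ), φ - ψ⟫ ≤ ‖C⁻¹ʳ‖ * ‖φ - ψ‖ ^ 2 := by
    refine (real_inner_le_norm _ _).trans ?_
    rw [sq, ← mul_assoc]
    gcongr
    exact ContinuousLinearMap.le_opNorm _ _
  rw [mul_pow, Real.sq_sqrt (by positivity)]
  calc B * (1 + 1 - 2 * Real.exp (-(⟪C⁻¹ʳ (φ - ψ), φ - ψ⟫ / 8)))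
      ≤ B * (‖C⁻¹ʳ‖ * ‖φ - ψ‖ ^ 2 / 4) := by
        gcongr
        linarith
    _ = _ := by ring

end Hellinger

/-! ### Averaging preserves the Lipschitz profile. -/

section Average

variable {E : Type*} [NormedAddCommGroup E] [NormedSpace ℝ E] [MeasurableSpace E] [BorelSpace E]
  [SecondCountableTopology E]

/-- The average `x ↦ ∫ g (x + y) dρ(y)`. -/
def average (ρ : Measure E) (g : E → ℝ) (x : E) : ℝ := ∫ y, g (x + y) ∂ρ

/-- The $L^2$ reverse triangle inequality, applied to two translates whose square roots differ
pointwise by at most $L\|x-y\|$. No constant is lost. -/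
theorem abs_sqrt_average_sub_le {ρ : Measure E} [IsProbabilityMeasure ρ] {f : E → ℝ}
    (hf : Continuous f) (hf0 : ∀ x, 0 ≤ f x) {B : ℝ} (hB : ∀ x, f x ≤ B) {L : ℝ}
    (hL : ∀ x y, |√(f x) - √(f y)| ≤ L * ‖x - y‖) (x y : E) :
    |√(average ρ f x) - √(average ρ f y)| ≤ L * ‖x - y‖ := by
  have hi : ∀ x, Integrable (fun w => f (x + w)) ρ := fun x =>
    integrable_of_bounded (by fun_prop) (M := B) fun w => by rw [abs_of_nonneg (hf0 _)]; exact hB _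
  refine abs_le_of_sq_le_sq ?_ ((abs_nonneg _).trans (hL x y))
  refine (sq_sqrt_integral_sub_le (hi x) (hi y) (fun _ => hf0 _) (fun _ => hf0 _)).trans ?_
  have h1 : ∫ w, (√(f (x + w)) - √(f (y + w))) ^ 2 ∂ρ ≤ ∫ _, (L * ‖x - y‖) ^ 2 ∂ρ := by
    refine integral_mono_of_nonneg (ae_of_all _ fun w => sq_nonneg _) (integrable_const _)
      (ae_of_all _ fun w => ?_)
    have := hL (x + w) (y + w)
    rw [add_sub_add_right_eq_sub] at this
    simp only
    rw [← sq_abs]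
    gcongr
  simpa using h1

theorem continuous_average {ρ : Measure E} [IsProbabilityMeasure ρ] {f : E → ℝ}
    (hf : Continuous f) {B : ℝ} (hB : ∀ x, |f x| ≤ B) : Continuous (average ρ f) :=
  continuous_of_dominated (bound := fun _ => B) (fun x => by fun_prop)
    (fun x => ae_of_all _ fun w => hB _) (integrable_const _) (ae_of_all _ fun w => by fun_prop)

/-- All four constants survive, so a profile established at one time holds uniformly at all later
times. -/
theorem GapProfile.average {z p : E → ℝ} {ε M B L : ℝ} (h : GapProfile z p ε M B L)
    (ρ : Measure E) [IsProbabilityMeasure ρ] :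
    GapProfile (average ρ z) (fun x => average ρ (fun y => z y * p y) x / average ρ z x)
      ε M B L := by
  have hm : ∀ x : E, Measurable fun y => x + y := fun x => by fun_prop
  have hz := fun x => h.integrable_density (ρ := ρ) (hm x)
  have hf := fun x => h.integrable_product (ρ := ρ) (hm x)
  have hzpos : ∀ x, 0 < Polchinski.average ρ z x := fun x => h.integral_density_pos (hm x)
  have hzB : ∀ x, |z x| ≤ B := fun x => by rw [abs_of_pos (h.density_pos x)]; exact h.density_le x
  have hB0 : 0 < B := (h.density_pos 0).trans_le (h.density_le 0)
  have hfB : ∀ x, z x * p x ≤ B * M := fun x =>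
    mul_le_mul (h.density_le x) (h.ratio_le x) (h.ratio_pos x).le hB0.le
  have hfc : Continuous fun x => z x * p x := h.continuous_density.mul h.continuous_ratio
  have hf0 : ∀ x, 0 ≤ z x * p x := fun x => (mul_pos (h.density_pos x) (h.ratio_pos x)).le
  have hzc : Continuous (Polchinski.average ρ z) := continuous_average h.continuous_density hzB
  refine ⟨h.eps_pos, fun x => ?_, fun x => ?_, hzpos, fun x => ?_, hzc, ?_, ?_, fun x y => ?_⟩
  · rw [le_div_iff₀ (hzpos x), Polchinski.average, Polchinski.average, ← integral_const_mul]
    refine integral_mono ((hz x).const_mul _) (hf x) fun y => ?_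
    simp only
    rw [mul_comm]
    exact mul_le_mul_of_nonneg_left (h.le_ratio _) (h.density_pos _).le
  · rw [div_le_iff₀ (hzpos x), Polchinski.average, Polchinski.average, ← integral_const_mul]
    refine integral_mono (hf x) ((hz x).const_mul _) fun y => ?_
    simp only
    rw [mul_comm M]
    exact mul_le_mul_of_nonneg_left (h.ratio_le _) (h.density_pos _).le
  · have := integral_mono (hz x) (integrable_const B) fun y => h.density_le (x + y)
    simpa [Polchinski.average] using this
  · exact (continuous_average hfc (B := B * M) fun x => by
      rw [abs_of_nonneg (hf0 x)]; exact hfB x).div hzc fun x => (hzpos x).ne'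
  · exact abs_sqrt_average_sub_le h.continuous_density (fun x => (h.density_pos x).le)
      h.density_le h.lipschitz_density
  · have hc : ∀ x, Polchinski.average ρ z x *
        (Polchinski.average ρ (fun y => z y * p y) x / Polchinski.average ρ z x) =
        Polchinski.average ρ (fun y => z y * p y) x := fun x => mul_div_cancel₀ _ (hzpos x).ne'
    simp_rw [hc]
    exact abs_sqrt_average_sub_le hfc hf0 hfB h.lipschitz_product x y

end Average

/-! ### Gaussians of varying covariance driven by one standard Gaussian. -/

section NoiseMap

open scoped MatrixOrder

variable {N : ℕ} (X : Submodule ℝ (EuclideanSpace ℝ (Fin N)))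

/-- A linear map that sends the standard Gaussian measure to `gaussianOn X A`. -/
def noiseMap (A : Matrix (Fin N) (Fin N) ℝ) : EuclideanSpace ℝ (Fin N) →L[ℝ] X :=
  X.orthogonalProjectionOnto ∘L Matrix.toEuclideanCLM (𝕜 := ℝ) (CFC.sqrt A)

/-- All the Gaussians live on one probability space, so limits in the covariance become dominated
convergence under a fixed measure. -/
theorem gaussianOn_eq_map (A : Matrix (Fin N) (Fin N) ℝ) :
    gaussianOn X A = (stdGaussian (EuclideanSpace ℝ (Fin N))).map (noiseMap X A) := by
  rw [gaussianOn, multivariateGaussian, Measure.map_map (by fun_prop) (by fun_prop)]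
  congr 1
  ext x
  simp [noiseMap]

instance isGaussian_gaussianOn (A : Matrix (Fin N) (Fin N) ℝ) : IsGaussian (gaussianOn X A) := by
  rw [gaussianOn]
  infer_instance

theorem integral_gaussianOn (A : Matrix (Fin N) (Fin N) ℝ) {f : X → ℝ} (hf : Measurable f) :
    ∫ x, f x ∂gaussianOn X A =
      ∫ w, f (noiseMap X A w) ∂stdGaussian (EuclideanSpace ℝ (Fin N)) := by
  rw [gaussianOn_eq_map, integral_map (by fun_prop) hf.aestronglyMeasurable]

theorem inner_onSubspace (A : Matrix (Fin N) (Fin N) ℝ) (x y : X) :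
    ⟪x, onSubspace X A y⟫ = (x : EuclideanSpace ℝ (Fin N)) ⬝ᵥ (A.mulVec
      (y : EuclideanSpace ℝ (Fin N))) := by
  rw [← Matrix.inner_toEuclideanCLM]
  simp only [onSubspace, ContinuousLinearMap.comp_apply, Submodule.subtypeL_apply]
  rw [← Submodule.inner_orthogonalProjectionOnto_eq_of_mem_left]

theorem onSubspace_add (A B : Matrix (Fin N) (Fin N) ℝ) :
    onSubspace X (A + B) = onSubspace X A + onSubspace X B := by
  ext x : 1
  simp [onSubspace]

/-- The adjoint of the orthogonal projection is the inclusion, so the projected covariance is the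
compression of `A`; the image of `A` need not lie in `X`. -/
theorem isCentredGaussian_gaussianOn {A : Matrix (Fin N) (Fin N) ℝ} (hA : A.PosSemidef) :
    IsCentredGaussian (gaussianOn X A) (onSubspace X A) where
  isGaussian := inferInstance
  integral_id := by
    rw [gaussianOn, integral_map (by fun_prop) (by fun_prop),
      (X.orthogonalProjectionOnto).integral_comp_comm IsGaussian.integrable_fun_id,
      integral_id_multivariateGaussian, map_zero]
  covarianceBilin_eq x y := by
    rw [gaussianOn, covarianceBilin_map IsGaussian.memLp_two_id,
      covarianceBilin_multivariateGaussian hA, inner_onSubspace,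
      Submodule.adjoint_orthogonalProjectionOnto]
    rfl

theorem isPositive_onSubspace {A : Matrix (Fin N) (Fin N) ℝ} (hA : A.PosSemidef) :
    (onSubspace X A).IsPositive := by
  have h := isCentredGaussian_gaussianOn X hA
  rw [ContinuousLinearMap.isPositive_def']
  refine ⟨h.isSelfAdjoint, fun x => ?_⟩
  rw [ContinuousLinearMap.reApplyInnerSelf_apply, real_inner_comm]
  exact h.inner_nonneg x

theorem onSubspace_eq_zero_of_inner {A : Matrix (Fin N) (Fin N) ℝ} (hA : A.PosSemidef) {x : X}
    (hx : ⟪x, onSubspace X A x⟫ = 0) : onSubspace X A x = 0 := by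
  rw [inner_onSubspace] at hx
  have h1 := (hA.dotProduct_mulVec_zero_iff (x : EuclideanSpace ℝ (Fin N))).1 (by simpa using hx)
  refine ext_inner_left ℝ fun y => ?_
  rw [inner_onSubspace, h1]
  simp

/-- In finite dimension it suffices to look at kernels: if $(A+B)x = 0$ then both nonnegative
quadratic forms vanish at $x$, and positivity of $A$ turns $(x, Ax) = 0$ into $Ax = 0$. -/
theorem isUnit_onSubspace_add {A B : Matrix (Fin N) (Fin N) ℝ} (hA : A.PosSemidef)
    (hB : B.PosSemidef) (h : IsUnit (onSubspace X A)) : IsUnit (onSubspace X (A + B)) := by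
  rw [ContinuousLinearMap.isUnit_iff_isUnit_toLinearMap, LinearMap.isUnit_iff_ker_eq_bot,
    LinearMap.ker_eq_bot'] at h ⊢
  intro x hx
  refine h x ?_
  have hx' : onSubspace X (A + B) x = 0 := hx
  have h1 : ⟪x, onSubspace X A x⟫ + ⟪x, onSubspace X B x⟫ = 0 := by
    rw [← inner_add_right, ← add_apply, ← onSubspace_add, hx', inner_zero_right]
  have h2 := (isCentredGaussian_gaussianOn X hA).inner_nonneg x
  have h3 := (isCentredGaussian_gaussianOn X hB).inner_nonneg x
  exact onSubspace_eq_zero_of_inner X hA (by linarith)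

theorem gaussianOn_conv {A B : Matrix (Fin N) (Fin N) ℝ} (hA : A.PosSemidef)
    (hB : B.PosSemidef) : gaussianOn X A ∗ gaussianOn X B = gaussianOn X (A + B) := by
  refine (isCentredGaussian_gaussianOn X hA).conv_eq (isCentredGaussian_gaussianOn X hB) ?_
  rw [← onSubspace_add]
  exact isCentredGaussian_gaussianOn X (hA.add hB)

theorem noiseMap_zero : noiseMap X 0 = 0 := by simp [noiseMap]

theorem gaussianOn_zero : gaussianOn X 0 = Measure.dirac 0 := by
  rw [gaussianOn_eq_map, noiseMap_zero]
  exact (Measure.map_const _ 0).trans (by simp)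

/-- Noise of covariance $cA$ has amplitude $\sqrt c$; this is the scaling by $\sqrt{u-t}$ behind the
time derivative. -/
theorem noiseMap_smul {A : Matrix (Fin N) (Fin N) ℝ} (hA : A.PosSemidef) {c : ℝ} (hc : 0 ≤ c) :
    noiseMap X (c • A) = √c • noiseMap X A := by
  have h : CFC.sqrt (c • A) = √c • CFC.sqrt A := by
    refine CFC.sqrt_unique ?_ ?_
    · rw [smul_mul_smul_comm, Real.mul_self_sqrt hc, CFC.sqrt_mul_sqrt_self A hA.nonneg]
    · exact ((Matrix.nonneg_iff_posSemidef.1 (CFC.sqrt_nonneg A)).smul (Real.sqrt_nonneg c)).nonneg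
  rw [noiseMap, h, noiseMap, map_smul, ContinuousLinearMap.comp_smul]

open scoped Matrix.Norms.L2Operator in
theorem continuousOn_noiseMap : ContinuousOn (noiseMap X) {A | A.PosSemidef} := by
  have h1 : ContinuousOn (CFC.sqrt : Matrix (Fin N) (Fin N) ℝ → _) {A | A.PosSemidef} :=
    CFC.continuousOn_sqrt.mono fun A hA => hA.nonneg
  have h2 : Continuous fun A : Matrix (Fin N) (Fin N) ℝ =>
      X.orthogonalProjectionOnto ∘L Matrix.toEuclideanCLM (𝕜 := ℝ) A := by
    have : Continuous fun A : Matrix (Fin N) (Fin N) ℝ => Matrix.toEuclideanCLM (𝕜 := ℝ) A :=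
      LinearMap.continuous_of_finiteDimensional
        (Matrix.toEuclideanCLM (n := Fin N) (𝕜 := ℝ)).toAlgEquiv.toLinearMap
    fun_prop
  exact h2.comp_continuousOn h1

end NoiseMap

/-! ### Positivity, continuity and right derivative of $C_t$. -/

section CovarianceFlow

variable {N : ℕ} {Cdot : ℝ → Matrix (Fin N) (Fin N) ℝ}

namespace IsCovarianceDecomposition

/-- Common source of positivity for $C_t$, its increments and the remainder $C_∞ - C_t$, which are
integrals over different sets of times. -/
theorem posSemidef_setIntegral (hC : IsCovarianceDecomposition Cdot) {S : Set ℝ}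
    (hS : MeasurableSet S) (hS0 : S ⊆ Set.Ioi 0) :
    (Matrix.of fun i j => ∫ u in S, Cdot u i j).PosSemidef := by
  have hintegr : ∀ i j, IntegrableOn (fun u => Cdot u i j) S := fun i j =>
    (hC.integrable i j).mono_set hS0
  refine .of_dotProduct_mulVec_nonneg ?_ fun x => ?_
  · ext i j
    simp only [Matrix.conjTranspose_apply, Matrix.of_apply, star_trivial]
    refine setIntegral_congr_fun hS fun u hu => ?_
    exact (hC.posSemidef u (hS0 hu).le).1.apply i j
  · have e : star x ⬝ᵥ ((Matrix.of fun i j => ∫ u in S, Cdot u i j).mulVec x) =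
        ∫ u in S, star x ⬝ᵥ ((Cdot u).mulVec x) := by
      simp only [dotProduct, Matrix.mulVec, Matrix.of_apply]
      rw [integral_finsetSum]
      · refine Finset.sum_congr rfl fun i _ => ?_
        rw [integral_const_mul, integral_finsetSum]
        · simp_rw [integral_mul_const]
        · exact fun j _ => (hintegr i j).mul_const _
      · exact fun i _ => (integrable_finsetSum _ fun j _ => (hintegr i j).mul_const _).const_mul _
    rw [e]
    exact setIntegral_nonneg hS fun u hu =>
      (hC.posSemidef u (hS0 hu).le).dotProduct_mulVec_nonneg x

theorem intervalIntegrable (hC : IsCovarianceDecomposition Cdot) {s t : ℝ} (hs : 0 ≤ s)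
    (ht : 0 ≤ t) (i j : Fin N) : IntervalIntegrable (fun u => Cdot u i j) volume s t := by
  rw [intervalIntegrable_iff]
  refine (hC.integrable i j).mono_set fun u hu => ?_
  rw [Set.mem_uIoc] at hu
  rcases hu with hu | hu
  · exact hs.trans_lt hu.1
  · exact ht.trans_lt hu.1

theorem posSemidef_covAt_sub (hC : IsCovarianceDecomposition Cdot) {s t : ℝ} (hs : 0 ≤ s)
    (hst : s ≤ t) : (covAt Cdot t - covAt Cdot s).PosSemidef := by
  convert hC.posSemidef_setIntegral (S := Set.Ioc s t) measurableSet_Ioc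
    (fun u hu => hs.trans_lt hu.1) using 1
  ext i j
  simp only [covAt, Matrix.sub_apply, Matrix.of_apply]
  rw [intervalIntegral.integral_interval_sub_left (hC.intervalIntegrable le_rfl (hs.trans hst) i j)
    (hC.intervalIntegrable le_rfl hs i j), intervalIntegral.integral_of_le hst]

theorem covAt_zero : covAt Cdot 0 = 0 := by
  ext i j
  simp [covAt]

theorem posSemidef_covAt (hC : IsCovarianceDecomposition Cdot) {t : ℝ} (ht : 0 ≤ t) :
    (covAt Cdot t).PosSemidef := by
  simpa [covAt_zero] using hC.posSemidef_covAt_sub le_rfl ht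

theorem posSemidef_covInfty_sub (hC : IsCovarianceDecomposition Cdot) {t : ℝ} (ht : 0 ≤ t) :
    (covInfty Cdot - covAt Cdot t).PosSemidef := by
  convert hC.posSemidef_setIntegral (S := Set.Ioi t) measurableSet_Ioi
    (fun u hu => ht.trans_lt hu) using 1
  ext i j
  simp only [covAt, covInfty, Matrix.sub_apply, Matrix.of_apply]
  rw [intervalIntegral.integral_of_le ht, ← Set.Ioc_union_Ioi_eq_Ioi ht,
    setIntegral_union (Set.Ioc_disjoint_Ioi le_rfl) measurableSet_Ioi
      ((hC.integrable i j).mono_set Set.Ioc_subset_Ioi_self)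
      ((hC.integrable i j).mono_set (Set.Ioi_subset_Ioi ht))]
  ring

theorem tendsto_covAt_atTop (hC : IsCovarianceDecomposition Cdot) :
    Tendsto (covAt Cdot) atTop (𝓝 (covInfty Cdot)) :=
  tendsto_pi_nhds.2 fun i => tendsto_pi_nhds.2 fun j =>
    intervalIntegral_tendsto_integral_Ioi 0 (hC.integrable i j) tendsto_id

theorem continuousOn_covAt (hC : IsCovarianceDecomposition Cdot) :
    ContinuousOn (covAt Cdot) (Set.Ici 0) := by
  refine continuousOn_pi.2 fun i => continuousOn_pi.2 fun j => fun t ht => ?_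
  have h1 : IntegrableOn (fun u => Cdot u i j) (Set.uIcc 0 (t + 1)) := by
    rw [Set.uIcc_of_le (by linarith [Set.mem_Ici.1 ht]), integrableOn_Icc_iff_integrableOn_Ioc]
    exact (hC.integrable i j).mono_set Set.Ioc_subset_Ioi_self
  have h2 := intervalIntegral.continuousOn_primitive_interval h1
  rw [Set.uIcc_of_le (by linarith [Set.mem_Ici.1 ht])] at h2
  refine (h2 t ⟨ht, by linarith⟩).mono_of_mem_nhdsWithin ?_
  rw [← Set.Ici_inter_Iic]
  exact inter_mem_nhdsWithin _ (Iic_mem_nhds (lt_add_one t))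

/-- The right derivative of `C_t` is `Ċ_t`, at all times. -/
theorem hasDerivWithinAt_covAt (hC : IsCovarianceDecomposition Cdot) {t : ℝ} (ht : 0 ≤ t)
    (i j : Fin N) :
    HasDerivWithinAt (fun u => covAt Cdot u i j) (Cdot t i j) (Set.Ioi t) t := by
  refine (intervalIntegral.integral_hasDerivWithinAt_right (s := Set.Ici t) (t := Set.Ioi t)
    (hC.intervalIntegrable le_rfl ht i j) ?_ ?_).mono Set.Ioi_subset_Ici_self
  · exact ⟨Set.Ioi t, self_mem_nhdsWithin,
      ((hC.integrable i j).mono_set (Set.Ioi_subset_Ioi ht)).aestronglyMeasurable⟩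
  · have h1 := (hC.right_continuous t ht).mono Set.Ioi_subset_Ici_self
    exact (continuousWithinAt_pi.1 ((continuousWithinAt_pi.1 h1) i)) j

theorem tendsto_covAt_slope (hC : IsCovarianceDecomposition Cdot) {t : ℝ} (ht : 0 ≤ t) :
    Tendsto (fun u => (u - t)⁻¹ • (covAt Cdot u - covAt Cdot t)) (𝓝[>] t) (𝓝 (Cdot t)) := by
  refine tendsto_pi_nhds.2 fun i => tendsto_pi_nhds.2 fun j => ?_
  have := (hasDerivWithinAt_iff_tendsto_slope' (by simp)).1 (hC.hasDerivWithinAt_covAt ht i j)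
  exact this

theorem isUnit_opC (hC : IsCovarianceDecomposition Cdot) {s t : ℝ} (hs : 0 ≤ s) (hst : s ≤ t)
    (h : IsUnit (opC Cdot s)) : IsUnit (opC Cdot t) := by
  have := isUnit_onSubspace_add (fieldSpace Cdot) (hC.posSemidef_covAt hs)
    (hC.posSemidef_covAt_sub hs hst) h
  rwa [add_sub_cancel] at this

end IsCovarianceDecomposition

end CovarianceFlow

/-! ### The fluctuation measures of the flow and their entropic stability. -/

section Flow

variable {N : ℕ} {Cdot : ℝ → Matrix (Fin N) (Fin N) ℝ} {V₀ : fieldSpace Cdot → ℝ}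

theorem IsCovarianceDecomposition.isCentredGaussian (hC : IsCovarianceDecomposition Cdot) {t : ℝ}
    (ht : 0 ≤ t) :
    IsCentredGaussian (gaussianOn (fieldSpace Cdot) (covAt Cdot t)) (opC Cdot t) :=
  isCentredGaussian_gaussianOn _ (hC.posSemidef_covAt ht)

theorem renormPotential_zero (φ : fieldSpace Cdot) : renormPotential Cdot V₀ 0 φ = V₀ φ := by
  rw [renormPotential, IsCovarianceDecomposition.covAt_zero, gaussianOn_zero, integral_dirac]
  simp

theorem exp_neg_renormPotential (hV : Measurable V₀) {b : ℝ} (hb : ∀ x, b ≤ V₀ x) (t : ℝ)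
    (φ : fieldSpace Cdot) :
    Real.exp (-renormPotential Cdot V₀ t φ) =
      ∫ ζ, Real.exp (-V₀ (φ + ζ)) ∂gaussianOn (fieldSpace Cdot) (covAt Cdot t) := by
  rw [renormPotential, neg_neg, Real.exp_log]
  exact integral_exp_pos (integrable_exp_neg (V := fun ζ => V₀ (φ + ζ)) (by fun_prop)
    fun ζ => hb _)

theorem integral_fluctuation (t : ℝ) (φ : fieldSpace Cdot) (F : fieldSpace Cdot → ℝ) :
    ∫ ζ, F ζ ∂fluctuation Cdot V₀ t φ =
      (∫ ζ, Real.exp (-V₀ (φ + ζ)) * F (φ + ζ)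
        ∂gaussianOn (fieldSpace Cdot) (covAt Cdot t)) /
      ∫ ζ, Real.exp (-V₀ (φ + ζ)) ∂gaussianOn (fieldSpace Cdot) (covAt Cdot t) := by
  rw [fluctuation, integral_tilted, (measurableEmbedding_addLeft φ).integral_map,
    (measurableEmbedding_addLeft φ).integral_map, ← integral_div]
  refine integral_congr_ae (ae_of_all _ fun ζ => ?_)
  simp only [smul_eq_mul]
  ring

theorem semigroup_zero_eq (hV : Measurable V₀) {b : ℝ} (hb : ∀ x, b ≤ V₀ x) (t : ℝ)
    (F : fieldSpace Cdot → ℝ) (φ : fieldSpace Cdot) :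
    semigroup Cdot V₀ 0 t F φ = ∫ ζ, F ζ ∂fluctuation Cdot V₀ t φ := by
  rw [semigroup, integral_fluctuation, IsCovarianceDecomposition.covAt_zero, sub_zero,
    ← exp_neg_renormPotential hV hb, Real.exp_neg, div_inv_eq_mul, mul_comm]
  simp_rw [renormPotential_zero]

/-- The fluctuation measure at `φ = 0`. -/
def fluctuationBase (Cdot : ℝ → Matrix (Fin N) (Fin N) ℝ) (V₀ : fieldSpace Cdot → ℝ) (t : ℝ) :
    Measure (fieldSpace Cdot) :=
  (gaussianOn (fieldSpace Cdot) (covAt Cdot t)).tilted fun ζ => -V₀ ζ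

theorem isProbabilityMeasure_fluctuationBase (hV : Measurable V₀) {b : ℝ} (hb : ∀ x, b ≤ V₀ x)
    (t : ℝ) : IsProbabilityMeasure (fluctuationBase Cdot V₀ t) :=
  isProbabilityMeasure_tilted (integrable_exp_neg hV hb)

theorem hasExpMoments_fluctuationBase (hC : IsCovarianceDecomposition Cdot) (hV : Measurable V₀)
    {b : ℝ} (hb : ∀ x, b ≤ V₀ x) {t : ℝ} (ht : 0 ≤ t) :
    HasExpMoments (fluctuationBase Cdot V₀ t) :=
  (hC.isCentredGaussian ht).hasExpMoments.tilted_neg hV hb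

theorem fluctuation_eq_tilt (hC : IsCovarianceDecomposition Cdot) (hV : Measurable V₀) {b : ℝ}
    (hb : ∀ x, b ≤ V₀ x) {t : ℝ} (ht : 0 ≤ t) (hu : IsUnit (opC Cdot t)) (φ : fieldSpace Cdot) :
    fluctuation Cdot V₀ t φ = tilt ((opC Cdot t)⁻¹ʳ φ) (fluctuationBase Cdot V₀ t) :=
  (hC.isCentredGaussian ht).map_add_tilted_eq_tilt hu hV hb φ

theorem isProbabilityMeasure_fluctuation (hV : Measurable V₀) {b : ℝ} (hb : ∀ x, b ≤ V₀ x)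
    (t : ℝ) (φ : fieldSpace Cdot) : IsProbabilityMeasure (fluctuation Cdot V₀ t φ) := by
  have : IsProbabilityMeasure ((gaussianOn (fieldSpace Cdot) (covAt Cdot t)).map
      fun ζ => φ + ζ) := Measure.isProbabilityMeasure_map (by fun_prop)
  exact isProbabilityMeasure_tilted (integrable_exp_neg hV hb)

theorem hessianCondition_iff (hC : IsCovarianceDecomposition Cdot) (hV : Measurable V₀) {b : ℝ}
    (hb : ∀ x, b ≤ V₀ x) {t : ℝ} (ht : 0 ≤ t) (hu : IsUnit (opC Cdot t)) (a : ℝ) :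
    HessianCondition Cdot V₀ t a ↔ CovarianceCondition Cdot V₀ t a := by
  have hγ := hC.isCentredGaussian ht
  refine forall_congr' fun φ => ?_
  have h := hγ.hessian_neg_log_integral hu hV hb φ
  rw [show hessian (renormPotential Cdot V₀ t) φ = _ from h]
  exact hessian_le_iff_cov_le (hγ.isSelfAdjoint_inverse hu) hγ.isSelfAdjoint
    (Ring.inverse_mul_cancel _ hu) (Ring.mul_inverse_cancel _ hu) a

/-- As $C_t$ is invertible, every tilt of the base measure is a fluctuation measure, namely the one
at $φ = C_t h$. The condition over all $φ$ thus supplies the bound over all tilts that entropic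
stability needs. -/
theorem cov_tilt_le (hC : IsCovarianceDecomposition Cdot) (hV : Measurable V₀) {b : ℝ}
    (hb : ∀ x, b ≤ V₀ x) {t : ℝ} (ht : 0 ≤ t) (hu : IsUnit (opC Cdot t)) {a : ℝ}
    (hH : HessianCondition Cdot V₀ t a) (h : fieldSpace Cdot) :
    ((opC Cdot t)⁻¹ʳ * opCdot Cdot t * (opC Cdot t)⁻¹ʳ) *
      cov (tilt h (fluctuationBase Cdot V₀ t)) *
      ((opC Cdot t)⁻¹ʳ * opCdot Cdot t * (opC Cdot t)⁻¹ʳ) ≤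
      a • ((opC Cdot t)⁻¹ʳ * opCdot Cdot t * (opC Cdot t)⁻¹ʳ) := by
  have := (hessianCondition_iff hC hV hb ht hu a).1 hH (opC Cdot t h)
  rwa [fluctuation_eq_tilt hC hV hb ht hu, inverse_apply hu] at this

theorem isPositive_opCdot (hC : IsCovarianceDecomposition Cdot) {t : ℝ} (ht : 0 ≤ t) :
    (opCdot Cdot t).IsPositive :=
  isPositive_onSubspace _ (hC.posSemidef t ht)

theorem fluctuation_entropic_stability (hC : IsCovarianceDecomposition Cdot) (hV : Measurable V₀)
    {b : ℝ} (hb : ∀ x, b ≤ V₀ x) {t : ℝ} (ht : 0 ≤ t) (hu : IsUnit (opC Cdot t)) {a : ℝ}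
    (ha : 0 < a) (hH : HessianCondition Cdot V₀ t a) {F : fieldSpace Cdot → ℝ} (hF : Measurable F)
    (h0 : ∀ x, 0 ≤ F x) {M : ℝ} (hM : ∀ x, F x ≤ M) (φ : fieldSpace Cdot) :
    DifferentiableAt ℝ (fun ψ => √(semigroup Cdot V₀ 0 t F ψ)) φ ∧
      2 * quadForm (opCdot Cdot t) (gradient (fun ψ => √(semigroup Cdot V₀ 0 t F ψ)) φ) ≤
        a * ent (fluctuation Cdot V₀ t φ) F := by
  have := isProbabilityMeasure_fluctuationBase (Cdot := Cdot) hV hb t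
  have hγ := hC.isCentredGaussian ht
  simp_rw [semigroup_zero_eq hV hb, fluctuation_eq_tilt hC hV hb ht hu]
  exact quadForm_gradient_sqrt_le (hasExpMoments_fluctuationBase hC hV hb ht)
    (hγ.isSelfAdjoint_inverse hu) (isPositive_opCdot hC ht) ha (cov_tilt_le hC hV hb ht hu hH)
    hF h0 hM φ

end Flow

/-! ### The flow indexed by covariance matrices, and increments of the entropy. -/

section MatrixFlow

theorem IsCentredGaussian.integral_inner_sq {E : Type*} [NormedAddCommGroup E]
    [InnerProductSpace ℝ E] [FiniteDimensional ℝ E] [MeasurableSpace E] [BorelSpace E]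
    {γ : Measure E} {A : E →L[ℝ] E} (h : IsCentredGaussian γ A) (v : E) :
    ∫ x, ⟪v, x⟫ ^ 2 ∂γ = ⟪v, A v⟫ := by
  have := h.isGaussian
  rw [← h.covarianceBilin_eq, covarianceBilin_self IsGaussian.memLp_two_id,
    variance_of_integral_eq_zero (by fun_prop)]
  exact ((innerSL ℝ v).integral_comp_comm IsGaussian.integrable_fun_id).trans
    (by rw [h.integral_id, map_zero])

theorem measurable_average {E : Type*} [NormedAddCommGroup E] [NormedSpace ℝ E]
    [MeasurableSpace E] [BorelSpace E] [SecondCountableTopology E] {ρ : Measure E} [SFinite ρ]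
    {g : E → ℝ} (hg : Measurable g) : Measurable (average ρ g) := by
  have : StronglyMeasurable fun q : E × E => g (q.1 + q.2) :=
    (hg.comp (measurable_fst.add measurable_snd)).stronglyMeasurable
  exact this.integral_prod_right.measurable

theorem average_conv {E : Type*} [NormedAddCommGroup E] [NormedSpace ℝ E]
    [MeasurableSpace E] [BorelSpace E] [SecondCountableTopology E] {ρ ρ' : Measure E}
    [IsProbabilityMeasure ρ] [IsProbabilityMeasure ρ'] {g : E → ℝ} (hg : Measurable g) {K : ℝ}
    (hK : ∀ x, |g x| ≤ K) (x : E) : average (ρ ∗ ρ') g x = average ρ (average ρ' g) x := by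
  rw [average, integral_conv]
  · simp only [average, add_assoc]
  · exact integrable_of_bounded (by fun_prop) fun y => hK _

variable {N : ℕ} {X : Submodule ℝ (EuclideanSpace ℝ (Fin N))} {V F : X → ℝ} {b ε M : ℝ}

/-- The Gaussian average of `exp(-V)`. -/
def flowDensity (V : X → ℝ) (A : Matrix (Fin N) (Fin N) ℝ) : X → ℝ :=
  average (gaussianOn X A) fun x => Real.exp (-V x)

/-- The Gaussian average of `exp(-V) F`. -/
def flowNumerator (V F : X → ℝ) (A : Matrix (Fin N) (Fin N) ℝ) : X → ℝ :=
  average (gaussianOn X A) fun x => Real.exp (-V x) * F x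

/-- The average of `F` under the fluctuation measure. -/
def flowRatio (V F : X → ℝ) (A : Matrix (Fin N) (Fin N) ℝ) (φ : X) : ℝ :=
  flowNumerator V F A φ / flowDensity V A φ

theorem integrable_exp_neg_mul {Ω : Type*} [MeasurableSpace Ω] {ρ : Measure Ω} [IsFiniteMeasure ρ]
    {Y : Ω → X} (hY : Measurable Y) (hV : Measurable V) (hb : ∀ x, b ≤ V x) {G : X → ℝ}
    (hG : Measurable G) {K : ℝ} (hK : ∀ x, |G x| ≤ K) :
    Integrable (fun ω => Real.exp (-V (Y ω)) * G (Y ω)) ρ := by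
  refine integrable_of_bounded (M := Real.exp (-b) * K) (by fun_prop) fun ω => ?_
  rw [abs_mul, abs_of_pos (Real.exp_pos _)]
  exact mul_le_mul (Real.exp_le_exp.2 (by linarith [hb (Y ω)])) (hK _) (abs_nonneg _)
    (Real.exp_pos _).le

theorem flowDensity_pos (hV : Measurable V) (hb : ∀ x, b ≤ V x) (A : Matrix (Fin N) (Fin N) ℝ)
    (φ : X) : 0 < flowDensity V A φ :=
  integral_exp_pos (integrable_exp_neg (V := fun ζ => V (φ + ζ)) (by fun_prop) fun ζ => hb _)

theorem flowDensity_le (hV : Measurable V) (hb : ∀ x, b ≤ V x) (A : Matrix (Fin N) (Fin N) ℝ)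
    (φ : X) : flowDensity V A φ ≤ Real.exp (-b) := by
  have h1 : flowDensity V A φ ≤ ∫ _, Real.exp (-b) ∂gaussianOn X A := by
    refine integral_mono (integrable_exp_neg (V := fun ζ => V (φ + ζ)) (by fun_prop)
      fun ζ => hb _) (integrable_const _) fun ζ => ?_
    exact Real.exp_le_exp.2 (by linarith [hb (φ + ζ)])
  simpa using h1

theorem flowDensity_add (hV : Measurable V) (hb : ∀ x, b ≤ V x) {A D : Matrix (Fin N) (Fin N) ℝ}
    (hA : A.PosSemidef) (hD : D.PosSemidef) :
    flowDensity V (A + D) = average (gaussianOn X D) (flowDensity V A) := by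
  ext φ
  -- The order matters: `average_conv` makes the first factor of the convolution the outer average,
  -- which has to be the one of covariance `D`.
  rw [flowDensity, add_comm, ← gaussianOn_conv X hD hA,
    average_conv (K := Real.exp (-b)) (by fun_prop)]
  · rfl
  · intro x
    rw [abs_of_pos (Real.exp_pos _)]
    exact Real.exp_le_exp.2 (by linarith [hb x])

theorem flowNumerator_add (hV : Measurable V) (hb : ∀ x, b ≤ V x) (hF : Measurable F) {K : ℝ}
    (hK : ∀ x, |F x| ≤ K) {A D : Matrix (Fin N) (Fin N) ℝ} (hA : A.PosSemidef)
    (hD : D.PosSemidef) :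
    flowNumerator V F (A + D) = average (gaussianOn X D) (flowNumerator V F A) := by
  ext φ
  rw [flowNumerator, add_comm, ← gaussianOn_conv X hD hA,
    average_conv (K := Real.exp (-b) * K) (by fun_prop)]
  · rfl
  · intro x
    rw [abs_mul, abs_of_pos (Real.exp_pos _)]
    exact mul_le_mul (Real.exp_le_exp.2 (by linarith [hb x])) (hK _) (abs_nonneg _)
      (Real.exp_pos _).le

theorem le_flowRatio (hV : Measurable V) (hb : ∀ x, b ≤ V x) (hF : Measurable F)
    {K : ℝ} (hK : ∀ x, |F x| ≤ K) (hε : ∀ x, ε ≤ F x) (A : Matrix (Fin N) (Fin N) ℝ) (φ : X) :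
    ε ≤ flowRatio V F A φ := by
  rw [flowRatio, le_div_iff₀ (flowDensity_pos hV hb A φ), flowDensity, average, mul_comm,
    ← integral_mul_const]
  refine integral_mono ((integrable_exp_neg (V := fun ζ => V (φ + ζ)) (by fun_prop)
      fun ζ => hb _).mul_const _)
    (integrable_exp_neg_mul (Y := fun ζ => φ + ζ) (by fun_prop) hV hb hF hK) fun ζ => ?_
  exact mul_le_mul_of_nonneg_left (hε _) (Real.exp_pos _).le

theorem flowRatio_le (hV : Measurable V) (hb : ∀ x, b ≤ V x) (hF : Measurable F)
    {K : ℝ} (hK : ∀ x, |F x| ≤ K) (hM : ∀ x, F x ≤ M) (A : Matrix (Fin N) (Fin N) ℝ) (φ : X) :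
    flowRatio V F A φ ≤ M := by
  rw [flowRatio, div_le_iff₀ (flowDensity_pos hV hb A φ), flowDensity, average, mul_comm,
    ← integral_mul_const]
  refine integral_mono
    (integrable_exp_neg_mul (Y := fun ζ => φ + ζ) (by fun_prop) hV hb hF hK)
    ((integrable_exp_neg (V := fun ζ => V (φ + ζ)) (by fun_prop)
      fun ζ => hb _).mul_const _) fun ζ => ?_
  exact mul_le_mul_of_nonneg_left (hM _) (Real.exp_pos _).le

theorem continuous_of_abs_sqrt_sub_le {E : Type*} [NormedAddCommGroup E] {f : E → ℝ} {L : ℝ}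
    (hf : ∀ x, 0 ≤ f x) (hL : ∀ x y, |√(f x) - √(f y)| ≤ L * ‖x - y‖) : Continuous f := by
  have h1 : Continuous fun x => √(f x) := by
    refine (LipschitzWith.of_dist_le' (K := L) fun x y => ?_).continuous
    rw [Real.dist_eq, dist_eq_norm]
    exact hL x y
  have h2 : f = fun x => √(f x) ^ 2 := funext fun x => (Real.sq_sqrt (hf x)).symm
  rw [h2]
  exact h1.pow 2

/-- The Hellinger bound for $e^{-V} ≤ e^{-b}$ and for $e^{-V}F ≤ e^{-b}M$. Invertibility of the
covariance makes the Lipschitz constants finite; their sum serves for both functions. -/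
theorem exists_gapProfile (hV : Measurable V) (hb : ∀ x, b ≤ V x) (hF : Measurable F)
    (hε0 : 0 < ε) (hε : ∀ x, ε ≤ F x) (hM : ∀ x, F x ≤ M) {A : Matrix (Fin N) (Fin N) ℝ}
    (hA : A.PosSemidef) (hu : IsUnit (onSubspace X A)) :
    ∃ L, GapProfile (flowDensity V A) (flowRatio V F A) ε M (Real.exp (-b)) L := by
  have hγ := isCentredGaussian_gaussianOn X hA
  have hF0 : ∀ x, 0 ≤ F x := fun x => hε0.le.trans (hε x)
  have hK : ∀ x, |F x| ≤ M := fun x => by rw [abs_of_nonneg (hF0 x)]; exact hM x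
  set L₁ := √(Real.exp (-b) * ‖(onSubspace X A)⁻¹ʳ‖ / 4)
  set L₂ := √(Real.exp (-b) * M * ‖(onSubspace X A)⁻¹ʳ‖ / 4)
  have h1 : ∀ φ ψ, |√(flowDensity V A φ) - √(flowDensity V A ψ)| ≤ (L₁ + L₂) * ‖φ - ψ‖ := by
    intro φ ψ
    refine (hγ.abs_sqrt_sub_sqrt_le hu (G := fun x => Real.exp (-V x)) (B := Real.exp (-b))
      (by fun_prop) (fun x => (Real.exp_pos _).le)
      (fun x => Real.exp_le_exp.2 (by linarith [hb x])) φ ψ).trans ?_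
    gcongr
    exact le_add_of_nonneg_right (Real.sqrt_nonneg _)
  have h2 : ∀ φ ψ, |√(flowNumerator V F A φ) - √(flowNumerator V F A ψ)| ≤
      (L₁ + L₂) * ‖φ - ψ‖ := by
    intro φ ψ
    refine (hγ.abs_sqrt_sub_sqrt_le hu (G := fun x => Real.exp (-V x) * F x)
      (B := Real.exp (-b) * M) (by fun_prop) (fun x => mul_nonneg (Real.exp_pos _).le (hF0 x))
      (fun x => mul_le_mul (Real.exp_le_exp.2 (by linarith [hb x])) (hM x) (hF0 x)
        (Real.exp_pos _).le) φ ψ).trans ?_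
    gcongr
    exact le_add_of_nonneg_left (Real.sqrt_nonneg _)
  have hpos := flowDensity_pos hV hb A
  have hnum0 : ∀ φ, 0 ≤ flowNumerator V F A φ := fun φ =>
    integral_nonneg fun ζ => mul_nonneg (Real.exp_pos _).le (hF0 _)
  have hc1 := continuous_of_abs_sqrt_sub_le (fun x => (hpos x).le) h1
  have hc2 := continuous_of_abs_sqrt_sub_le hnum0 h2
  refine ⟨L₁ + L₂, hε0, le_flowRatio hV hb hF hK hε A, flowRatio_le hV hb hF hK hM A, hpos,
    flowDensity_le hV hb A, hc1, hc2.div hc1 fun x => (hpos x).ne', h1, fun x y => ?_⟩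
  have hc : ∀ x, flowDensity V A x * flowRatio V F A x = flowNumerator V F A x := fun x =>
    mul_div_cancel₀ _ (hpos x).ne'
  rw [hc, hc]
  exact h2 x y

theorem flowRatio_add (hV : Measurable V) (hb : ∀ x, b ≤ V x) (hF : Measurable F) {K : ℝ}
    (hK : ∀ x, |F x| ≤ K) {A D : Matrix (Fin N) (Fin N) ℝ} (hA : A.PosSemidef)
    (hD : D.PosSemidef) :
    flowRatio V F (A + D) = fun φ =>
      average (gaussianOn X D) (fun ψ => flowDensity V A ψ * flowRatio V F A ψ) φ /
        average (gaussianOn X D) (flowDensity V A) φ := by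
  ext φ
  rw [flowRatio, flowNumerator_add hV hb hF hK hA hD, flowDensity_add hV hb hA hD]
  have hc : (fun ψ => flowDensity V A ψ * flowRatio V F A ψ) = flowNumerator V F A :=
    funext fun x => mul_div_cancel₀ _ (flowDensity_pos hV hb A x).ne'
  rw [hc]

theorem GapProfile.flow_add (hV : Measurable V) (hb : ∀ x, b ≤ V x) (hF : Measurable F) {K : ℝ}
    (hK : ∀ x, |F x| ≤ K) {A D : Matrix (Fin N) (Fin N) ℝ} (hA : A.PosSemidef)
    (hD : D.PosSemidef) {B L : ℝ}
    (h : GapProfile (flowDensity V A) (flowRatio V F A) ε M B L) :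
    GapProfile (flowDensity V (A + D)) (flowRatio V F (A + D)) ε M B L := by
  rw [flowRatio_add hV hb hF hK hA hD, flowDensity_add hV hb hA hD]
  exact h.average _

/-- The average of `Φ (flowRatio)` with respect to the (unnormalised) renormalised measure. -/
def flowEntropy (V F : X → ℝ) (K A : Matrix (Fin N) (Fin N) ℝ) : ℝ :=
  ∫ φ, flowDensity V A φ * Phi (flowRatio V F A φ) ∂gaussianOn X K

/-- The Jensen gap along the noise of covariance `D`. -/
def flowGap (V F : X → ℝ) (A D : Matrix (Fin N) (Fin N) ℝ) (φ : X) : ℝ :=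
  phiGap (stdGaussian (EuclideanSpace ℝ (Fin N))) (fun w => flowDensity V A (φ + noiseMap X D w))
    (fun w => flowRatio V F A (φ + noiseMap X D w))

theorem flowGap_eq {B L : ℝ} (hV : Measurable V) (hb : ∀ x, b ≤ V x)
    (hF : Measurable F) {K' : ℝ} (hK : ∀ x, |F x| ≤ K') {A D : Matrix (Fin N) (Fin N) ℝ}
    (hA : A.PosSemidef) (hD : D.PosSemidef)
    (h : GapProfile (flowDensity V A) (flowRatio V F A) ε M B L) (φ : X) :
    flowGap V F A D φ =
      average (gaussianOn X D) (fun ψ => flowDensity V A ψ * Phi (flowRatio V F A ψ)) φ -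
      flowDensity V (A + D) φ * Phi (flowRatio V F (A + D) φ) := by
  have m1 := h.continuous_density.measurable
  have m2 := h.continuous_ratio.measurable
  have m3 := continuous_Phi.measurable
  rw [flowRatio_add hV hb hF hK hA hD, flowDensity_add hV hb hA hD]
  simp only [average]
  rw [integral_gaussianOn X D (by fun_prop), integral_gaussianOn X D (by fun_prop),
    integral_gaussianOn X D (by fun_prop)]
  rfl

/-- Of the outer noise of covariance $K + D$, the part $D$ is either averaged after applying $Φ$ or
moved inside and averaged before. The difference of the two orders is the Jensen gap of $D$,
averaged over $K$. -/
theorem flowEntropy_sub {B L : ℝ} (hV : Measurable V) (hb : ∀ x, b ≤ V x)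
    (hF : Measurable F) {K' : ℝ} (hK : ∀ x, |F x| ≤ K') {A D K : Matrix (Fin N) (Fin N) ℝ}
    (hA : A.PosSemidef) (hD : D.PosSemidef) (hKp : K.PosSemidef)
    (h : GapProfile (flowDensity V A) (flowRatio V F A) ε M B L) :
    flowEntropy V F (K + D) A - flowEntropy V F K (A + D) =
      ∫ φ, flowGap V F A D φ ∂gaussianOn X K := by
  have h' := h.flow_add hV hb hF hK hA hD
  have i1 : Integrable (fun φ => flowDensity V A φ * Phi (flowRatio V F A φ))
      (gaussianOn X K ∗ gaussianOn X D) := h.integrable_density_mul measurable_id continuous_Phi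
  have i2 : Integrable (fun φ => flowDensity V (A + D) φ * Phi (flowRatio V F (A + D) φ))
      (gaussianOn X K) := h'.integrable_density_mul measurable_id continuous_Phi
  have i3 : Integrable (average (gaussianOn X D)
      fun φ => flowDensity V A φ * Phi (flowRatio V F A φ)) (gaussianOn X K) :=
    ((integrable_map_measure i1.1 (by fun_prop)).1 i1).integral_prod_left
  have e1 : flowEntropy V F (K + D) A = ∫ φ, average (gaussianOn X D)
      (fun φ => flowDensity V A φ * Phi (flowRatio V F A φ)) φ ∂gaussianOn X K := by
    rw [flowEntropy, ← gaussianOn_conv X hKp hD, integral_conv i1]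
    rfl
  rw [e1, flowEntropy, ← integral_sub i3 i2]
  exact integral_congr_ae (ae_of_all _ fun φ => (flowGap_eq hV hb hF hK hA hD h φ).symm)

theorem measurable_flowGap {B L : ℝ} (hV : Measurable V) (hb : ∀ x, b ≤ V x)
    (hF : Measurable F) {K' : ℝ} (hK : ∀ x, |F x| ≤ K') {A D : Matrix (Fin N) (Fin N) ℝ}
    (hA : A.PosSemidef) (hD : D.PosSemidef)
    (h : GapProfile (flowDensity V A) (flowRatio V F A) ε M B L) :
    Measurable (flowGap V F A D) := by
  have h' := h.flow_add hV hb hF hK hA hD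
  have m1 := h.continuous_density.measurable
  have m2 := h.continuous_ratio.measurable
  have m3 := continuous_Phi.measurable
  have m4 := h'.continuous_density.measurable
  have m5 := h'.continuous_ratio.measurable
  rw [funext (flowGap_eq hV hb hF hK hA hD h)]
  exact (measurable_average (by fun_prop)).sub (by fun_prop)

theorem flowGap_nonneg {A D : Matrix (Fin N) (Fin N) ℝ} {B L : ℝ}
    (h : GapProfile (flowDensity V A) (flowRatio V F A) ε M B L) (φ : X) :
    0 ≤ flowGap V F A D φ :=
  h.phiGap_nonneg (by fun_prop)

theorem integrable_norm_sq_stdGaussian :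
    Integrable (fun w => ‖w‖ ^ 2) (stdGaussian (EuclideanSpace ℝ (Fin N))) :=
  (memLp_two_iff_integrable_sq_norm (by fun_prop)).1 IsGaussian.memLp_two_id

/-- The constant in the bound on the Jensen gap. -/
def gapConst (N : ℕ) (ε M L : ℝ) : ℝ :=
  GapProfile.quadConst M L / ε * ∫ w, ‖w‖ ^ 2 ∂stdGaussian (EuclideanSpace ℝ (Fin N))

/-- The bound is uniform in $φ$ and, since $\|\sqrt D\|^2$ scales linearly with $D$, of first order
in the covariance increment. -/
theorem flowGap_le {A D : Matrix (Fin N) (Fin N) ℝ} {B L : ℝ}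
    (h : GapProfile (flowDensity V A) (flowRatio V F A) ε M B L) (φ : X) :
    flowGap V F A D φ ≤ gapConst N ε M L * ‖noiseMap X D‖ ^ 2 := by
  have hi := integrable_norm_sq_stdGaussian (N := N)
  have hle : ∀ w, ‖φ + noiseMap X D w - φ‖ ^ 2 ≤ ‖noiseMap X D‖ ^ 2 * ‖w‖ ^ 2 := fun w => by
    rw [add_sub_cancel_left, ← mul_pow]
    gcongr
    exact ContinuousLinearMap.le_opNorm _ _
  have hi' : Integrable (fun w => ‖φ + noiseMap X D w - φ‖ ^ 2)
      (stdGaussian (EuclideanSpace ℝ (Fin N))) := by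
    refine (hi.const_mul (‖noiseMap X D‖ ^ 2)).mono' (by fun_prop) (ae_of_all _ fun w => ?_)
    rw [Real.norm_eq_abs, abs_of_nonneg (by positivity)]
    exact hle w
  refine (h.phiGap_le (Y := fun w => φ + noiseMap X D w) (by fun_prop) φ hi').trans ?_
  have h1 := integral_mono hi' (hi.const_mul (‖noiseMap X D‖ ^ 2)) hle
  rw [integral_const_mul] at h1
  have hc := div_nonneg h.quadConst_nonneg h.eps_pos.le
  calc _ ≤ GapProfile.quadConst M L / ε * (‖noiseMap X D‖ ^ 2 *
        ∫ w, ‖w‖ ^ 2 ∂stdGaussian (EuclideanSpace ℝ (Fin N))) :=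
        mul_le_mul_of_nonneg_left h1 hc
    _ = _ := by rw [gapConst]; ring

theorem abs_flowEntropy_sub_le {B L : ℝ} (hV : Measurable V) (hb : ∀ x, b ≤ V x)
    (hF : Measurable F) {K' : ℝ} (hK : ∀ x, |F x| ≤ K') {A D K : Matrix (Fin N) (Fin N) ℝ}
    (hA : A.PosSemidef) (hD : D.PosSemidef) (hKp : K.PosSemidef)
    (h : GapProfile (flowDensity V A) (flowRatio V F A) ε M B L) :
    |flowEntropy V F (K + D) A - flowEntropy V F K (A + D)| ≤
      gapConst N ε M L * ‖noiseMap X D‖ ^ 2 := by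
  rw [flowEntropy_sub hV hb hF hK hA hD hKp h]
  have h0 := integral_nonneg (μ := gaussianOn X K)
    (show (0 : X → ℝ) ≤ flowGap V F A D from flowGap_nonneg h)
  rw [abs_of_nonneg h0]
  have h1 : ∫ φ, flowGap V F A D φ ∂gaussianOn X K ≤
      ∫ _, gapConst N ε M L * ‖noiseMap X D‖ ^ 2 ∂gaussianOn X K :=
    integral_mono_of_nonneg (ae_of_all _ (flowGap_nonneg h)) (integrable_const _)
      (ae_of_all _ (flowGap_le h))
  simpa using h1

end MatrixFlow

/-! ### Continuity, limit and right derivative of the entropy along the flow. -/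

section TimeFlow

variable {N : ℕ} {Cdot : ℝ → Matrix (Fin N) (Fin N) ℝ} {V₀ F : fieldSpace Cdot → ℝ}
  {b ε M K' B L s : ℝ}

/-- The average of `Φ(P_{0,t} F)` with respect to the (unnormalised) measure `ν_t`. -/
def entropyAt (V₀ F : fieldSpace Cdot → ℝ) (t : ℝ) : ℝ :=
  flowEntropy V₀ F (covInfty Cdot - covAt Cdot t) (covAt Cdot t)

theorem entropyAt_sub (hC : IsCovarianceDecomposition Cdot) (hV : Measurable V₀)
    (hb : ∀ x, b ≤ V₀ x) (hF : Measurable F) (hK : ∀ x, |F x| ≤ K') {t u : ℝ} (ht : 0 ≤ t)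
    (htu : t ≤ u)
    (h : GapProfile (flowDensity V₀ (covAt Cdot t)) (flowRatio V₀ F (covAt Cdot t)) ε M B L) :
    entropyAt V₀ F t - entropyAt V₀ F u =
      ∫ φ, flowGap V₀ F (covAt Cdot t) (covAt Cdot u - covAt Cdot t) φ
        ∂gaussianOn (fieldSpace Cdot) (covInfty Cdot - covAt Cdot u) := by
  have := flowEntropy_sub hV hb hF hK (hC.posSemidef_covAt ht) (hC.posSemidef_covAt_sub ht htu)
    (hC.posSemidef_covInfty_sub (ht.trans htu)) h
  rwa [sub_add_sub_cancel, add_sub_cancel] at this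

theorem abs_entropyAt_sub_le (hC : IsCovarianceDecomposition Cdot) (hV : Measurable V₀)
    (hb : ∀ x, b ≤ V₀ x) (hF : Measurable F) (hK : ∀ x, |F x| ≤ K') {t u : ℝ} (ht : 0 ≤ t)
    (htu : t ≤ u)
    (h : GapProfile (flowDensity V₀ (covAt Cdot t)) (flowRatio V₀ F (covAt Cdot t)) ε M B L) :
    |entropyAt V₀ F t - entropyAt V₀ F u| ≤
      gapConst N ε M L * ‖noiseMap (fieldSpace Cdot) (covAt Cdot u - covAt Cdot t)‖ ^ 2 := by
  have := abs_flowEntropy_sub_le hV hb hF hK (hC.posSemidef_covAt ht)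
    (hC.posSemidef_covAt_sub ht htu) (hC.posSemidef_covInfty_sub (ht.trans htu)) h
  rwa [sub_add_sub_cancel, add_sub_cancel] at this

theorem tendsto_noiseMap (X : Submodule ℝ (EuclideanSpace ℝ (Fin N))) {ι : Type*} {l : Filter ι}
    {A : ι → Matrix (Fin N) (Fin N) ℝ} {A₀ : Matrix (Fin N) (Fin N) ℝ} (hA : Tendsto A l (𝓝 A₀))
    (hp : ∀ᶠ i in l, (A i).PosSemidef) (hp₀ : A₀.PosSemidef) :
    Tendsto (fun i => noiseMap X (A i)) l (𝓝 (noiseMap X A₀)) := by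
  have h := (continuousOn_noiseMap X A₀ hp₀).tendsto
  exact Tendsto.comp (g := noiseMap X) h
    (tendsto_nhdsWithin_of_tendsto_nhds_of_eventually_within _ hA hp)

theorem tendsto_opNorm {E G : Type*} [NormedAddCommGroup E] [NormedSpace ℝ E]
    [NormedAddCommGroup G] [NormedSpace ℝ G] {ι : Type*} {l : Filter ι} {f : ι → E →L[ℝ] G}
    {g : E →L[ℝ] G} (h : Tendsto f l (𝓝 g)) : Tendsto (fun i => ‖f i‖) l (𝓝 ‖g‖) := h.norm

theorem tendsto_norm_noiseMap (X : Submodule ℝ (EuclideanSpace ℝ (Fin N))) {ι : Type*}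
    {l : Filter ι} {A : ι → Matrix (Fin N) (Fin N) ℝ} {A₀ : Matrix (Fin N) (Fin N) ℝ}
    (hA : Tendsto A l (𝓝 A₀)) (hp : ∀ᶠ i in l, (A i).PosSemidef) (hp₀ : A₀.PosSemidef) :
    Tendsto (fun i => ‖noiseMap X (A i)‖) l (𝓝 ‖noiseMap X A₀‖) := by
  have h := tendsto_noiseMap X hA hp hp₀
  exact tendsto_opNorm h

theorem norm_noiseMap_zero (X : Submodule ℝ (EuclideanSpace ℝ (Fin N))) : ‖noiseMap X 0‖ = 0 := by
  rw [noiseMap_zero]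
  exact ContinuousLinearMap.opNorm_zero

theorem opNorm_smul_sq {E G : Type*} [NormedAddCommGroup E] [NormedSpace ℝ E]
    [NormedAddCommGroup G] [NormedSpace ℝ G] (c : ℝ) (f : E →L[ℝ] G) :
    ‖c • f‖ ^ 2 = c ^ 2 * ‖f‖ ^ 2 := by
  rw [norm_smul, mul_pow, Real.norm_eq_abs, sq_abs]

theorem norm_noiseMap_smul_sq (X : Submodule ℝ (EuclideanSpace ℝ (Fin N)))
    {A : Matrix (Fin N) (Fin N) ℝ} (hA : A.PosSemidef) {c : ℝ} (hc : 0 ≤ c) :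
    ‖noiseMap X (c • A)‖ ^ 2 = c * ‖noiseMap X A‖ ^ 2 := by
  rw [noiseMap_smul X hA hc]
  exact (opNorm_smul_sq _ _).trans (by rw [Real.sq_sqrt hc])

theorem tendsto_mul_norm_noiseMap_sq (X : Submodule ℝ (EuclideanSpace ℝ (Fin N)))
    {ι : Type*} {l : Filter ι} {A : ι → Matrix (Fin N) (Fin N) ℝ} (hA : Tendsto A l (𝓝 0))
    (hp : ∀ᶠ i in l, (A i).PosSemidef) (c : ℝ) :
    Tendsto (fun i => c * ‖noiseMap X (A i)‖ ^ 2) l (𝓝 0) := by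
  have h := ((tendsto_norm_noiseMap X hA hp Matrix.PosSemidef.zero).pow 2).const_mul c
  have e : c * ‖noiseMap X (0 : Matrix (Fin N) (Fin N) ℝ)‖ ^ 2 = 0 := by
    rw [norm_noiseMap_zero]
    ring
  exact e ▸ h

theorem continuousOn_entropyAt (hC : IsCovarianceDecomposition Cdot) (hV : Measurable V₀)
    (hb : ∀ x, b ≤ V₀ x) (hF : Measurable F) (hK : ∀ x, |F x| ≤ K') (hs : 0 ≤ s)
    (h : ∀ t, s ≤ t →
      GapProfile (flowDensity V₀ (covAt Cdot t)) (flowRatio V₀ F (covAt Cdot t)) ε M B L) :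
    ContinuousOn (entropyAt V₀ F) (Set.Ici s) := by
  intro t (ht : s ≤ t)
  have hcov : ContinuousWithinAt (covAt Cdot) (Set.Ici s) t :=
    (hC.continuousOn_covAt t (hs.trans ht)).mono (Set.Ici_subset_Ici.2 hs)
  rw [← Set.Icc_union_Ici_eq_Ici ht]
  refine ContinuousWithinAt.union ?_ ?_
  -- From the left the gap starts at the moving time `u`, so the profile constants must not depend
  -- on the time.
  · have h1 : Tendsto (fun u => covAt Cdot t - covAt Cdot u) (𝓝[Set.Icc s t] t) (𝓝 0) := by
      have := (hcov.mono (fun u hu => hu.1 : Set.Icc s t ⊆ Set.Ici s)).tendsto.const_sub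
        (covAt Cdot t)
      rwa [sub_self] at this
    have h2 := tendsto_mul_norm_noiseMap_sq (fieldSpace Cdot) h1
      (eventually_nhdsWithin_of_forall fun u hu =>
        hC.posSemidef_covAt_sub (hs.trans hu.1) hu.2) (gapConst N ε M L)
    refine tendsto_iff_norm_sub_tendsto_zero.2 (squeeze_zero' (Eventually.of_forall fun u =>
      norm_nonneg _) (eventually_nhdsWithin_of_forall fun u hu => ?_) h2)
    exact abs_entropyAt_sub_le hC hV hb hF hK (hs.trans hu.1) hu.2 (h u hu.1)
  · have h1 : Tendsto (fun u => covAt Cdot u - covAt Cdot t) (𝓝[Set.Ici t] t) (𝓝 0) := by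
      have := (hcov.mono (Set.Ici_subset_Ici.2 ht)).tendsto.sub_const (covAt Cdot t)
      rwa [sub_self] at this
    have h2 := tendsto_mul_norm_noiseMap_sq (fieldSpace Cdot) h1
      (eventually_nhdsWithin_of_forall fun u hu =>
        hC.posSemidef_covAt_sub (hs.trans ht) hu) (gapConst N ε M L)
    refine tendsto_iff_norm_sub_tendsto_zero.2 (squeeze_zero' (Eventually.of_forall fun u =>
      norm_nonneg _) (eventually_nhdsWithin_of_forall fun u hu => ?_) h2)
    rw [norm_sub_rev]
    exact abs_entropyAt_sub_le hC hV hb hF hK (hs.trans ht) hu (h t ht)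

/-- Compares with the flow run to $C_∞$: the remaining covariance tends to zero, and with none left
the outer Gaussian is the Dirac mass at $0$. -/
theorem tendsto_entropyAt_atTop (hC : IsCovarianceDecomposition Cdot) (hV : Measurable V₀)
    (hb : ∀ x, b ≤ V₀ x) (hF : Measurable F) (hK : ∀ x, |F x| ≤ K') (hs : 0 ≤ s)
    (h : ∀ t, s ≤ t →
      GapProfile (flowDensity V₀ (covAt Cdot t)) (flowRatio V₀ F (covAt Cdot t)) ε M B L) :
    Tendsto (entropyAt V₀ F) atTop (𝓝 (flowDensity V₀ (covInfty Cdot) 0 *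
      Phi (flowRatio V₀ F (covInfty Cdot) 0))) := by
  have h1 : Tendsto (fun u => covInfty Cdot - covAt Cdot u) atTop (𝓝 0) := by
    have := hC.tendsto_covAt_atTop.const_sub (covInfty Cdot)
    rwa [sub_self] at this
  have h2 := tendsto_mul_norm_noiseMap_sq (fieldSpace Cdot) h1
    ((eventually_ge_atTop s).mono fun u hu => hC.posSemidef_covInfty_sub (hs.trans hu))
    (gapConst N ε M L)
  refine tendsto_iff_norm_sub_tendsto_zero.2 (squeeze_zero' (Eventually.of_forall fun u =>
      norm_nonneg _) ((eventually_ge_atTop s).mono fun u hu => ?_) h2)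
  have h3 := abs_flowEntropy_sub_le hV hb hF hK (hC.posSemidef_covAt (hs.trans hu))
    (hC.posSemidef_covInfty_sub (hs.trans hu)) Matrix.PosSemidef.zero (h u hu)
  have e : flowEntropy V₀ F 0 (covInfty Cdot) = flowDensity V₀ (covInfty Cdot) 0 *
      Phi (flowRatio V₀ F (covInfty Cdot) 0) := by
    rw [flowEntropy, gaussianOn_zero, integral_dirac]
  rw [zero_add, add_sub_cancel, e] at h3
  exact h3

theorem flowRatio_covAt (t : ℝ) (φ : fieldSpace Cdot) :
    flowRatio V₀ F (covAt Cdot t) φ = ∫ ζ, F ζ ∂fluctuation Cdot V₀ t φ :=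
  (integral_fluctuation t φ F).symm

theorem contDiff_flowRatio (hC : IsCovarianceDecomposition Cdot) (hV : Measurable V₀)
    (hb : ∀ x, b ≤ V₀ x) (hF : Measurable F) (hK : ∀ x, |F x| ≤ K') {t : ℝ} (ht : 0 ≤ t)
    (hu : IsUnit (opC Cdot t)) : ContDiff ℝ 1 (flowRatio V₀ F (covAt Cdot t)) := by
  have := isProbabilityMeasure_fluctuationBase (Cdot := Cdot) hV hb t
  have hm := hasExpMoments_fluctuationBase hC hV hb ht
  have h1 := (contDiff_integral_tilt hm (hm.expIntegrable_of_bounded hF.aestronglyMeasurable hK)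
    1).comp ((opC Cdot t)⁻¹ʳ).contDiff
  have e : flowRatio V₀ F (covAt Cdot t) = (fun h => ∫ ζ, F ζ ∂tilt h (fluctuationBase Cdot V₀ t)) ∘
      ((opC Cdot t)⁻¹ʳ : fieldSpace Cdot →L[ℝ] fieldSpace Cdot) := by
    ext φ
    rw [flowRatio_covAt, fluctuation_eq_tilt hC hV hb ht hu]
    rfl
  rw [e]
  exact_mod_cast h1

/-- The dissipation at time `t`. -/
def dissipation (V₀ F : fieldSpace Cdot → ℝ) (t : ℝ) (φ : fieldSpace Cdot) : ℝ :=
  flowDensity V₀ (covAt Cdot t) φ / (2 * flowRatio V₀ F (covAt Cdot t) φ) *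
    quadForm (opCdot Cdot t) (gradient (flowRatio V₀ F (covAt Cdot t)) φ)

/-- The small-noise expansion with $r = \sqrt{u-t}$ and the noise map of the difference quotient of
$C$, which converges to that of $\dot C_t$. The base point moves with `u` because the outer Gaussian
does too. -/
theorem tendsto_flowGap_div (hC : IsCovarianceDecomposition Cdot) {t : ℝ} (ht : 0 ≤ t)
    (hd : ContDiff ℝ 1 (flowRatio V₀ F (covAt Cdot t)))
    (h : GapProfile (flowDensity V₀ (covAt Cdot t)) (flowRatio V₀ F (covAt Cdot t)) ε M B L)
    {y : ℝ → fieldSpace Cdot} {x : fieldSpace Cdot} (hy : Tendsto y (𝓝[>] t) (𝓝 x)) :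
    Tendsto (fun u => flowGap V₀ F (covAt Cdot t) (covAt Cdot u - covAt Cdot t) (y u) / (u - t))
      (𝓝[>] t) (𝓝 (dissipation V₀ F t x)) := by
  have hstrict := (hd.contDiffAt (x := x)).hasStrictFDerivAt one_ne_zero
  have hpos : ∀ᶠ u in 𝓝[>] t, 0 < √(u - t) :=
    eventually_nhdsWithin_of_forall fun u hu => Real.sqrt_pos.2 (sub_pos.2 hu)
  have hr : Tendsto (fun u => √(u - t)) (𝓝[>] t) (𝓝 0) := by
    have : Continuous fun u => √(u - t) := by fun_prop
    have h0 := (this.tendsto t).mono_left (nhdsWithin_le_nhds (s := Set.Ioi t))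
    simpa using h0
  have hpsd : ∀ u, t < u → ((u - t)⁻¹ • (covAt Cdot u - covAt Cdot t)).PosSemidef := fun u hu =>
    (hC.posSemidef_covAt_sub ht hu.le).smul (inv_nonneg.2 (sub_pos.2 hu).le)
  have hS := tendsto_noiseMap (fieldSpace Cdot) (hC.tendsto_covAt_slope ht)
    (eventually_nhdsWithin_of_forall fun u hu => hpsd u hu) (hC.posSemidef t ht)
  have key := h.tendsto_phiGap_div (ρ := stdGaussian (EuclideanSpace ℝ (Fin N)))
    integrable_norm_sq_stdGaussian IsGaussian.integrable_id.norm
    integral_strongDual_stdGaussian hstrict hy hr hpos hS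
  -- The second moment of $(∇p, ζ)$ under the Gaussian of covariance $\dot C_t$.
  have hlim : ∫ w, (fderiv ℝ (flowRatio V₀ F (covAt Cdot t)) x
      (noiseMap (fieldSpace Cdot) (Cdot t) w)) ^ 2 ∂stdGaussian (EuclideanSpace ℝ (Fin N)) =
      quadForm (opCdot Cdot t) (gradient (flowRatio V₀ F (covAt Cdot t)) x) := by
    have hγ := isCentredGaussian_gaussianOn (fieldSpace Cdot) (hC.posSemidef t ht)
    rw [quadForm, opCdot, ← hγ.integral_inner_sq, integral_gaussianOn _ _ (by fun_prop)]
    refine integral_congr_ae (ae_of_all _ fun w => ?_)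
    simp only
    rw [inner_gradient_left]
  rw [hlim] at key
  refine key.congr' (eventually_nhdsWithin_of_forall fun u (hu : t < u) => ?_)
  have hut := sub_pos.2 hu
  have hn : noiseMap (fieldSpace Cdot) (covAt Cdot u - covAt Cdot t) =
      √(u - t) • noiseMap (fieldSpace Cdot) ((u - t)⁻¹ • (covAt Cdot u - covAt Cdot t)) := by
    rw [← noiseMap_smul _ (hpsd u hu) hut.le, smul_smul, mul_inv_cancel₀ hut.ne', one_smul]
  simp only [flowGap]
  rw [hn, Real.sq_sqrt hut.le]
  rfl

/-- The right derivative of the entropy along the flow. -/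
theorem hasDerivWithinAt_entropyAt (hC : IsCovarianceDecomposition Cdot) (hV : Measurable V₀)
    (hb : ∀ x, b ≤ V₀ x) (hF : Measurable F) (hK : ∀ x, |F x| ≤ K') {t : ℝ} (ht : 0 ≤ t)
    (hd : ContDiff ℝ 1 (flowRatio V₀ F (covAt Cdot t)))
    (h : GapProfile (flowDensity V₀ (covAt Cdot t)) (flowRatio V₀ F (covAt Cdot t)) ε M B L) :
    HasDerivWithinAt (entropyAt V₀ F) (-∫ φ, dissipation V₀ F t φ
      ∂gaussianOn (fieldSpace Cdot) (covInfty Cdot - covAt Cdot t)) (Set.Ioi t) t := by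
  rw [hasDerivWithinAt_iff_tendsto_slope' (by simp)]
  have hcov : Tendsto (fun u => covInfty Cdot - covAt Cdot u) (𝓝[>] t)
      (𝓝 (covInfty Cdot - covAt Cdot t)) :=
    (((hC.continuousOn_covAt t ht).mono (fun u (hu : t < u) => ht.trans hu.le)).tendsto).const_sub _
  have hnm := tendsto_noiseMap (fieldSpace Cdot) hcov
    (eventually_nhdsWithin_of_forall fun u (hu : t < u) =>
      hC.posSemidef_covInfty_sub (ht.trans hu.le)) (hC.posSemidef_covInfty_sub ht)
  have hmeas : ∀ u, t < u →
      Measurable (flowGap V₀ F (covAt Cdot t) (covAt Cdot u - covAt Cdot t)) := fun u hu =>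
    measurable_flowGap hV hb hF hK (hC.posSemidef_covAt ht) (hC.posSemidef_covAt_sub ht hu.le) h
  have hpsd : ∀ u, t < u → ((u - t)⁻¹ • (covAt Cdot u - covAt Cdot t)).PosSemidef := fun u hu =>
    (hC.posSemidef_covAt_sub ht hu.le).smul (inv_nonneg.2 (sub_pos.2 hu).le)
  have hS := tendsto_norm_noiseMap (fieldSpace Cdot) (hC.tendsto_covAt_slope ht)
    (eventually_nhdsWithin_of_forall fun u hu => hpsd u hu) (hC.posSemidef t ht)
  have hbd := hS.eventually (gt_mem_nhds (lt_add_one _))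
  set T := ‖noiseMap (fieldSpace Cdot) (Cdot t)‖
  -- The outer Gaussian, of covariance $C_∞ - C_u$, depends on `u` as well. Writing it as the image
  -- of a standard Gaussian turns this into a moving base point for each fixed `w`.
  have hlim : Tendsto (fun u => ∫ w, flowGap V₀ F (covAt Cdot t) (covAt Cdot u - covAt Cdot t)
      (noiseMap (fieldSpace Cdot) (covInfty Cdot - covAt Cdot u) w) / (u - t)
      ∂stdGaussian (EuclideanSpace ℝ (Fin N))) (𝓝[>] t)
      (𝓝 (∫ w, dissipation V₀ F t (noiseMap (fieldSpace Cdot) (covInfty Cdot - covAt Cdot t) w)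
        ∂stdGaussian (EuclideanSpace ℝ (Fin N)))) := by
    refine tendsto_integral_filter_of_dominated_convergence
      (fun _ => gapConst N ε M L * (T + 1) ^ 2) ?_ ?_ (integrable_const _) (ae_of_all _ fun w => ?_)
    · refine eventually_nhdsWithin_of_forall fun u (hu : t < u) => ?_
      have := hmeas u hu
      exact Measurable.aestronglyMeasurable (by fun_prop)
    · filter_upwards [hbd, self_mem_nhdsWithin] with u hbu hu
      have hut := sub_pos.2 (Set.mem_Ioi.1 hu)
      refine ae_of_all _ fun w => ?_
      rw [Real.norm_eq_abs, abs_of_nonneg (div_nonneg (flowGap_nonneg h _) hut.le),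
        div_le_iff₀ hut]
      refine (flowGap_le h _).trans ?_
      have hn := norm_noiseMap_smul_sq (fieldSpace Cdot) (hpsd u hu) hut.le
      rw [smul_smul, mul_inv_cancel₀ hut.ne', one_smul] at hn
      rw [hn]
      have hg : 0 ≤ gapConst N ε M L := by
        have := h.quadConst_nonneg
        have := h.eps_pos
        rw [gapConst]
        positivity
      calc gapConst N ε M L * ((u - t) * _) ≤ gapConst N ε M L * ((u - t) * (T + 1) ^ 2) := by
            gcongr
        _ = _ := by ring
    · exact tendsto_flowGap_div hC ht hd h
        (((ContinuousLinearMap.apply ℝ (fieldSpace Cdot) w).continuous.tendsto _).comp hnm)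
  have hdm : Measurable (dissipation V₀ F t) := by
    have m1 := h.continuous_density.measurable
    have m2 := h.continuous_ratio.measurable
    have hc : Continuous (gradient (flowRatio V₀ F (covAt Cdot t))) :=
      (InnerProductSpace.toDual ℝ (fieldSpace Cdot)).symm.continuous.comp
        (hd.continuous_fderiv one_ne_zero)
    have hq : Continuous (quadForm (opCdot Cdot t)) := by
      unfold quadForm
      fun_prop
    exact (m1.div (m2.const_mul 2)).mul (hq.comp hc).measurable
  rw [integral_gaussianOn _ _ hdm]
  refine hlim.neg.congr' (eventually_nhdsWithin_of_forall fun u (hu : t < u) => ?_)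
  have e := entropyAt_sub hC hV hb hF hK ht hu.le h
  rw [integral_gaussianOn _ _ (hmeas u hu)] at e
  rw [integral_div, ← e, slope_def_field]
  ring

end TimeFlow

/-! ### Gronwall's inequality for right derivatives. -/

section Gronwall

/-- A Gronwall inequality with an integrable rate, for right derivatives. -/
theorem le_exp_integral_mul_of_hasDerivWithinAt {G G' α : ℝ → ℝ} {s T : ℝ}
    (h0 : ∀ t, s ≤ t → 0 ≤ G t) (hc : ContinuousOn G (Set.Ici s))
    (hd : ∀ t, s < t → HasDerivWithinAt G (G' t) (Set.Ioi t) t)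
    (hle : ∀ t, s < t → G' t ≤ α t * G t) (hα : ∀ t, s < t → 0 ≤ α t)
    (hi : IntegrableOn α (Set.Ioi s)) (hT : s ≤ T) :
    G T ≤ Real.exp (∫ u in Set.Ioi s, α u) * G s := by
  set I := ∫ u in Set.Ioi s, α u with hI
  -- `G` may vanish, so the logarithm is taken of $G + δ$; nonnegativity of `α` preserves the
  -- differential inequality.
  have hlog : ∀ δ, 0 < δ → G T + δ ≤ Real.exp I * (G s + δ) := by
    intro δ hδ
    have hpos : ∀ t, s ≤ t → 0 < G t + δ := fun t ht => add_pos_of_nonneg_of_pos (h0 t ht) hδ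
    have h1 := intervalIntegral.sub_le_integral_of_hasDeriv_right_of_le
      (g := fun t => Real.log (G t + δ)) (g' := fun t => G' t / (G t + δ)) (φ := α) hT
      (((hc.mono fun t ht => ht.1).add continuousOn_const).log fun t ht => (hpos t ht.1).ne')
      (fun t ht => ((hd t ht.1).add_const δ).log (hpos t ht.1.le).ne')
      ((integrableOn_Icc_iff_integrableOn_Ioc (by simp)).2 (hi.mono_set Set.Ioc_subset_Ioi_self))
      (fun t ht => by
        rw [div_le_iff₀ (hpos t ht.1.le)]
        have := mul_nonneg (hα t ht.1) hδ.le
        linarith [hle t ht.1])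
    have h2 : ∫ u in s..T, α u ≤ I := by
      rw [intervalIntegral.integral_of_le hT]
      exact setIntegral_mono_set hi
        ((ae_restrict_iff' measurableSet_Ioi).2 (ae_of_all _ fun t ht => hα t ht))
        (ae_of_all _ Set.Ioc_subset_Ioi_self)
    rw [← Real.log_le_log_iff (hpos T hT) (mul_pos (Real.exp_pos _) (hpos s le_rfl)),
      Real.log_mul (Real.exp_pos _).ne' (hpos s le_rfl).ne', Real.log_exp]
    linarith
  refine le_of_forall_pos_le_add fun e he => ?_
  -- This `δ` makes the error $e^Iδ$ on the right exactly `e`.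
  have h3 := hlog (e / Real.exp I) (by positivity)
  rw [mul_add, mul_div_cancel₀ _ (Real.exp_pos I).ne'] at h3
  have : 0 < e / Real.exp I := by positivity
  linarith

end Gronwall

/-! ### Elementary bounds on the entropy. -/

section Entropy

variable {Ω : Type*} [MeasurableSpace Ω] {μ : Measure Ω} [IsProbabilityMeasure μ] {F : Ω → ℝ}
  {M K : ℝ}

theorem ent_nonneg (hF : Measurable F) (h0 : ∀ x, 0 ≤ F x) (hM : ∀ x, F x ≤ M) :
    0 ≤ ent μ F := by
  have hFi : Integrable F μ := integrable_of_bounded hF (M := M) fun x => by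
    rw [abs_of_nonneg (h0 x)]; exact hM x
  exact sub_nonneg.2 (Real.convexOn_mul_log.map_integral_le continuous_Phi.continuousOn
    isClosed_Ici (ae_of_all _ h0) hFi (integrable_Phi_of_bounded hF h0 hM))

theorem integral_mem_Icc_of_mem (hF : Measurable F) (h0 : ∀ x, 0 ≤ F x) (hM : ∀ x, F x ≤ M) :
    ∫ x, F x ∂μ ∈ Set.Icc 0 M := by
  refine ⟨integral_nonneg h0, ?_⟩
  have hFi : Integrable F μ := integrable_of_bounded hF (M := M) fun x => by
    rw [abs_of_nonneg (h0 x)]; exact hM x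
  have := integral_mono hFi (integrable_const (μ := μ) M) hM
  simpa using this

theorem abs_ent_le (hF : Measurable F) (h0 : ∀ x, 0 ≤ F x) (hM : ∀ x, F x ≤ M)
    (hK : ∀ x, 0 ≤ x → x ≤ M → |Phi x| ≤ K) : |ent μ F| ≤ K + K := by
  have h1 := integral_mem_Icc_of_mem (μ := μ) hF h0 hM
  have h2 : |∫ x, Phi (F x) ∂μ| ≤ K := by
    have := norm_integral_le_of_norm_le_const (μ := μ) (f := fun x => Phi (F x)) (C := K)
      (ae_of_all _ fun x => hK _ (h0 x) (hM x))
    simpa using this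
  exact (abs_sub _ _).trans (add_le_add h2 (hK _ h1.1 h1.2))

/-- Allows functions bounded away from zero to be treated first: $Φ$ is continuous on the whole line
and bounded on $[0, M+1]$, so dominated convergence applies. -/
theorem tendsto_ent_add_const (hF : Measurable F) (h0 : ∀ x, 0 ≤ F x) (hM : ∀ x, F x ≤ M) :
    Tendsto (fun ε => ent μ fun x => F x + ε) (𝓝[>] 0) (𝓝 (ent μ F)) := by
  obtain ⟨K, hK⟩ := exists_abs_Phi_le (M + 1)
  have hFi : Integrable F μ := integrable_of_bounded hF (M := M) fun x => by
    rw [abs_of_nonneg (h0 x)]; exact hM x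
  have hid : Tendsto (fun ε : ℝ => ε) (𝓝[>] 0) (𝓝 0) := nhdsWithin_le_nhds
  have hadd : ∀ y : ℝ, Tendsto (fun ε : ℝ => Phi (y + ε)) (𝓝[>] 0) (𝓝 (Phi y)) := fun y => by
    have := (continuous_Phi.tendsto (y + 0)).comp (hid.const_add y)
    rwa [add_zero] at this
  refine Tendsto.sub ?_ ?_
  · refine tendsto_integral_filter_of_dominated_convergence (fun _ => K)
      (Eventually.of_forall fun ε => ?_) ?_ (integrable_const _) (ae_of_all _ fun x => hadd _)
    · exact (continuous_Phi.measurable.comp (hF.add_const ε)).aestronglyMeasurable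
    · filter_upwards [Ioo_mem_nhdsGT (zero_lt_one' ℝ)] with ε hε
      exact ae_of_all _ fun x => hK _ (add_nonneg (h0 x) hε.1.le) (add_le_add (hM x) hε.2.le)
  · refine (hadd _).congr fun ε => ?_
    rw [integral_add hFi (integrable_const _)]
    simp

end Entropy

/-! ### Entropy contraction. -/

section Contraction

variable {N : ℕ} {Cdot : ℝ → Matrix (Fin N) (Fin N) ℝ} {V₀ F : fieldSpace Cdot → ℝ} {b ε M : ℝ}

theorem measurable_flowDensity {X : Submodule ℝ (EuclideanSpace ℝ (Fin N))} {V : X → ℝ}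
    (hV : Measurable V) (A : Matrix (Fin N) (Fin N) ℝ) : Measurable (flowDensity V A) :=
  measurable_average (by fun_prop)

theorem measurable_flowRatio {X : Submodule ℝ (EuclideanSpace ℝ (Fin N))} {V F : X → ℝ}
    (hV : Measurable V) (hF : Measurable F) (A : Matrix (Fin N) (Fin N) ℝ) :
    Measurable (flowRatio V F A) :=
  (measurable_average (by fun_prop)).div (measurable_flowDensity hV A)

theorem integrable_flowDensity_mul {X : Submodule ℝ (EuclideanSpace ℝ (Fin N))} {V g : X → ℝ}
    (hV : Measurable V) (hb : ∀ x, b ≤ V x) (hg : Measurable g) {K : ℝ} (hK : ∀ x, |g x| ≤ K)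
    (A : Matrix (Fin N) (Fin N) ℝ) (ρ : Measure X) [IsFiniteMeasure ρ] :
    Integrable (fun φ => flowDensity V A φ * g φ) ρ := by
  refine integrable_of_bounded (M := Real.exp (-b) * K) ((measurable_flowDensity hV A).mul hg)
    fun φ => ?_
  rw [abs_mul, abs_of_pos (flowDensity_pos hV hb A φ)]
  exact mul_le_mul (flowDensity_le hV hb A φ) (hK φ) (abs_nonneg _) (Real.exp_pos _).le

theorem ent_fluctuation (t : ℝ) (φ : fieldSpace Cdot) :
    ent (fluctuation Cdot V₀ t φ) F = flowRatio V₀ (fun x => Phi (F x)) (covAt Cdot t) φ -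
      Phi (flowRatio V₀ F (covAt Cdot t) φ) := by
  rw [flowRatio_covAt, flowRatio_covAt, ent]

theorem measurable_ent_fluctuation (hV : Measurable V₀) (hF : Measurable F) (t : ℝ) :
    Measurable fun φ => ent (fluctuation Cdot V₀ t φ) F := by
  simp_rw [ent_fluctuation]
  exact (measurable_flowRatio hV (continuous_Phi.measurable.comp hF) _).sub
    (continuous_Phi.measurable.comp (measurable_flowRatio hV hF _))

/-- The unnormalised average of the entropies of the fluctuation measures. -/
def averagedEntropy (V₀ F : fieldSpace Cdot → ℝ) (t : ℝ) : ℝ :=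
  ∫ φ, flowDensity V₀ (covAt Cdot t) φ * ent (fluctuation Cdot V₀ t φ) F
    ∂gaussianOn (fieldSpace Cdot) (covInfty Cdot - covAt Cdot t)

theorem abs_ent_fluctuation_le (hV : Measurable V₀) (hb : ∀ x, b ≤ V₀ x) (hF : Measurable F)
    (h0 : ∀ x, 0 ≤ F x) (hM : ∀ x, F x ≤ M) {K : ℝ} (hK : ∀ x, 0 ≤ x → x ≤ M → |Phi x| ≤ K)
    (t : ℝ) (φ : fieldSpace Cdot) : |ent (fluctuation Cdot V₀ t φ) F| ≤ K + K :=
  have := isProbabilityMeasure_fluctuation hV hb t φ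
  abs_ent_le hF h0 hM hK

theorem integrable_flowDensity_mul_ent (hV : Measurable V₀) (hb : ∀ x, b ≤ V₀ x)
    (hF : Measurable F) (h0 : ∀ x, 0 ≤ F x) (hM : ∀ x, F x ≤ M) (t : ℝ)
    (ρ : Measure (fieldSpace Cdot)) [IsFiniteMeasure ρ] :
    Integrable (fun φ => flowDensity V₀ (covAt Cdot t) φ * ent (fluctuation Cdot V₀ t φ) F) ρ := by
  obtain ⟨K, hK⟩ := exists_abs_Phi_le M
  exact integrable_flowDensity_mul hV hb (measurable_ent_fluctuation hV hF t)
    (abs_ent_fluctuation_le hV hb hF h0 hM hK t) _ _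

/-- The average of $E_{μ_t^φ}[Φ(F)]$ against the unnormalised renormalised measure does not depend
on $t$, by the semigroup property. So the averaged entropy and `entropyAt` have opposite
derivatives. -/
theorem averagedEntropy_eq (hC : IsCovarianceDecomposition Cdot) (hV : Measurable V₀)
    (hb : ∀ x, b ≤ V₀ x) (hF : Measurable F) (h0 : ∀ x, 0 ≤ F x) (hM : ∀ x, F x ≤ M) {t : ℝ}
    (ht : 0 ≤ t) :
    averagedEntropy V₀ F t =
      flowNumerator V₀ (fun x => Phi (F x)) (covInfty Cdot) 0 - entropyAt V₀ F t := by
  obtain ⟨K, hK⟩ := exists_abs_Phi_le M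
  have hK1 : ∀ x, |F x| ≤ M := fun x => by rw [abs_of_nonneg (h0 x)]; exact hM x
  have hK2 : ∀ x, |Phi (F x)| ≤ K := fun x => hK _ (h0 x) (hM x)
  have hΦF : Measurable fun x => Phi (F x) := continuous_Phi.measurable.comp hF
  have hpos := flowDensity_pos hV hb (covAt Cdot t)
  have e : ∀ φ, flowDensity V₀ (covAt Cdot t) φ * ent (fluctuation Cdot V₀ t φ) F =
      flowDensity V₀ (covAt Cdot t) φ *
        flowRatio V₀ (fun x => Phi (F x)) (covAt Cdot t) φ -
      flowDensity V₀ (covAt Cdot t) φ * Phi (flowRatio V₀ F (covAt Cdot t) φ) := fun φ => by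
    rw [ent_fluctuation, mul_sub]
  have e2 := congrFun (flowNumerator_add hV hb hΦF hK2 (hC.posSemidef_covAt ht)
    (hC.posSemidef_covInfty_sub ht)) 0
  rw [add_sub_cancel, average] at e2
  simp_rw [zero_add] at e2
  rw [averagedEntropy, entropyAt, flowEntropy, e2]
  simp_rw [e]
  rw [integral_sub]
  · congr 1
    refine integral_congr_ae (ae_of_all _ fun φ => ?_)
    exact mul_div_cancel₀ _ (hpos φ).ne'
  · refine integrable_flowDensity_mul hV hb (measurable_flowRatio hV hΦF _) (K := K)
      (fun φ => abs_le.2 ⟨?_, ?_⟩) _ _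
    · exact le_flowRatio hV hb hΦF hK2 (fun x => (abs_le.1 (hK2 x)).1) _ φ
    · exact flowRatio_le hV hb hΦF hK2 (fun x => (abs_le.1 (hK2 x)).2) _ φ
  · exact integrable_flowDensity_mul hV hb
      (continuous_Phi.measurable.comp (measurable_flowRatio hV hF _))
      (fun φ => hK _ (le_flowRatio hV hb hF hK1 h0 _ φ) (flowRatio_le hV hb hF hK1 hM _ φ)) _ _

theorem averagedEntropy_nonneg (hV : Measurable V₀) (hb : ∀ x, b ≤ V₀ x) (hF : Measurable F)
    (h0 : ∀ x, 0 ≤ F x) (hM : ∀ x, F x ≤ M) (t : ℝ) : 0 ≤ averagedEntropy V₀ F t := by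
  refine integral_nonneg fun φ => mul_nonneg (flowDensity_pos hV hb _ φ).le ?_
  have := isProbabilityMeasure_fluctuation hV hb t φ
  exact ent_nonneg hF h0 hM

theorem dissipation_nonneg (hC : IsCovarianceDecomposition Cdot) (hV : Measurable V₀)
    (hb : ∀ x, b ≤ V₀ x) {t : ℝ} (ht : 0 ≤ t) (φ : fieldSpace Cdot)
    (hp : 0 ≤ flowRatio V₀ F (covAt Cdot t) φ) : 0 ≤ dissipation V₀ F t φ := by
  have h1 := (flowDensity_pos hV hb (covAt Cdot t) φ).le
  have h2 : 0 ≤ quadForm (opCdot Cdot t) (gradient (flowRatio V₀ F (covAt Cdot t)) φ) :=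
    (isPositive_opCdot hC ht).inner_nonneg_right _
  rw [dissipation]
  positivity

/-- The gradient estimate at time $t$, multiplied by the density. This is the inequality that closes
the Gronwall argument. -/
theorem dissipation_le (hC : IsCovarianceDecomposition Cdot) (hV : Measurable V₀)
    (hb : ∀ x, b ≤ V₀ x) {t : ℝ} (ht : 0 ≤ t) (hu : IsUnit (opC Cdot t)) {a : ℝ} (ha : 0 < a)
    (hH : HessianCondition Cdot V₀ t a) (hF : Measurable F) (h0 : ∀ x, 0 ≤ F x)
    (hM : ∀ x, F x ≤ M) {φ : fieldSpace Cdot} (hp : 0 < flowRatio V₀ F (covAt Cdot t) φ) :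
    dissipation V₀ F t φ ≤
      a * (flowDensity V₀ (covAt Cdot t) φ * ent (fluctuation Cdot V₀ t φ) F) := by
  have := isProbabilityMeasure_fluctuationBase (Cdot := Cdot) hV hb t
  have e : flowRatio V₀ F (covAt Cdot t) =
      fun φ => ∫ ζ, F ζ ∂tilt ((opC Cdot t)⁻¹ʳ φ) (fluctuationBase Cdot V₀ t) := by
    ext φ
    rw [flowRatio_covAt, fluctuation_eq_tilt hC hV hb ht hu]
  have hz := flowDensity_pos hV hb (covAt Cdot t) φ
  rw [dissipation, fluctuation_eq_tilt hC hV hb ht hu]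
  rw [e] at hp ⊢
  have key := quadForm_gradient_le (hasExpMoments_fluctuationBase hC hV hb ht)
    ((hC.isCentredGaussian ht).isSelfAdjoint_inverse hu) (isPositive_opCdot hC ht) ha
    (cov_tilt_le hC hV hb ht hu hH) hF h0 hM hp
  refine le_trans (le_of_eq ?_) ((mul_le_mul_of_nonneg_left key hz.le).trans (le_of_eq ?_))
  · field_simp
  · ring

/-- Identifies $ν_0$ with the fluctuation measure of covariance $C_∞$ at $φ = 0$, the endpoint of
the flow. -/
theorem integral_nuZero (G : fieldSpace Cdot → ℝ) :
    ∫ ζ, G ζ ∂nuZero Cdot V₀ = flowRatio V₀ G (covInfty Cdot) 0 := by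
  rw [nuZero, integral_tilted, flowRatio, flowNumerator, flowDensity, average, average,
    ← integral_div]
  simp_rw [zero_add, smul_eq_mul, div_mul_eq_mul_div]

theorem exp_renormPotentialInfty (hV : Measurable V₀) (hb : ∀ x, b ≤ V₀ x)
    (φ : fieldSpace Cdot) :
    Real.exp (renormPotentialInfty Cdot V₀ φ) = (flowDensity V₀ (covInfty Cdot) φ)⁻¹ := by
  rw [renormPotentialInfty, Real.exp_neg]
  exact congrArg _ (Real.exp_log (flowDensity_pos hV hb _ φ))

theorem nu_eq (hV : Measurable V₀) (hb : ∀ x, b ≤ V₀ x) (t : ℝ) :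
    nu Cdot V₀ t = (gaussianOn (fieldSpace Cdot) (covInfty Cdot - covAt Cdot t)).withDensity
      fun ζ => ENNReal.ofReal ((flowDensity V₀ (covInfty Cdot) 0)⁻¹ *
        flowDensity V₀ (covAt Cdot t) ζ) := by
  simp_rw [nu, exp_renormPotentialInfty hV hb, exp_neg_renormPotential hV hb]
  rfl

theorem isFiniteMeasure_nu (hV : Measurable V₀) (hb : ∀ x, b ≤ V₀ x) (t : ℝ) :
    IsFiniteMeasure (nu Cdot V₀ t) := by
  rw [nu_eq hV hb]
  refine isFiniteMeasure_withDensity_ofReal (Integrable.const_mul ?_ _).2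
  simpa using integrable_flowDensity_mul hV hb (g := fun _ => 1) measurable_const (K := 1)
    (by simp) (covAt Cdot t) (gaussianOn (fieldSpace Cdot) (covInfty Cdot - covAt Cdot t))

theorem integral_nu (hV : Measurable V₀) (hb : ∀ x, b ≤ V₀ x) (t : ℝ)
    (G : fieldSpace Cdot → ℝ) :
    ∫ φ, G φ ∂nu Cdot V₀ t = (flowDensity V₀ (covInfty Cdot) 0)⁻¹ *
      ∫ φ, flowDensity V₀ (covAt Cdot t) φ * G φ
        ∂gaussianOn (fieldSpace Cdot) (covInfty Cdot - covAt Cdot t) := by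
  rw [nu_eq hV hb, integral_withDensity_eq_integral_toReal_smul
    ((measurable_flowDensity hV _).const_mul _).ennreal_ofReal
    (ae_of_all _ fun _ => ENNReal.ofReal_lt_top), ← integral_const_mul]
  refine integral_congr_ae (ae_of_all _ fun φ => ?_)
  have h1 := (flowDensity_pos hV hb (covInfty Cdot) 0).le
  have h2 := (flowDensity_pos hV hb (covAt Cdot t) φ).le
  simp only [smul_eq_mul]
  rw [ENNReal.toReal_ofReal (by positivity), mul_assoc]

theorem integrable_ent_fluctuation (hV : Measurable V₀) (hb : ∀ x, b ≤ V₀ x)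
    (hF : Measurable F) (h0 : ∀ x, 0 ≤ F x) (hM : ∀ x, F x ≤ M) (t : ℝ) :
    Integrable (fun φ => ent (fluctuation Cdot V₀ t φ) F) (nu Cdot V₀ t) := by
  obtain ⟨K, hK⟩ := exists_abs_Phi_le M
  have := isFiniteMeasure_nu (Cdot := Cdot) hV hb t
  exact integrable_of_bounded (measurable_ent_fluctuation hV hF t)
    (abs_ent_fluctuation_le hV hb hF h0 hM hK t)

/-- Entropy contraction for functions bounded away from zero. -/
theorem ent_nuZero_le_of_pos (hC : IsCovarianceDecomposition Cdot) (hV : Measurable V₀)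
    (hb : ∀ x, b ≤ V₀ x) {α : ℝ → ℝ} {s : ℝ} (hs : 0 ≤ s) (hu : IsUnit (opC Cdot s))
    (hα : ∀ t, s < t → 0 < α t ∧ HessianCondition Cdot V₀ t (α t))
    (hi : IntegrableOn α (Set.Ioi s)) (hF : Measurable F) (hε0 : 0 < ε) (hε : ∀ x, ε ≤ F x)
    (hM : ∀ x, F x ≤ M) :
    ent (nuZero Cdot V₀) F ≤ Real.exp (∫ u in Set.Ioi s, α u) *
      ∫ φ, ent (fluctuation Cdot V₀ s φ) F ∂nu Cdot V₀ s := by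
  have h0 : ∀ x, 0 ≤ F x := fun x => hε0.le.trans (hε x)
  have hK : ∀ x, |F x| ≤ M := fun x => by rw [abs_of_nonneg (h0 x)]; exact hM x
  obtain ⟨L, hL⟩ := exists_gapProfile hV hb hF hε0 hε hM (hC.posSemidef_covAt hs) hu
  have hprof : ∀ t, s ≤ t → GapProfile (flowDensity V₀ (covAt Cdot t))
      (flowRatio V₀ F (covAt Cdot t)) ε M (Real.exp (-b)) L := fun t ht => by
    have := hL.flow_add hV hb hF hK (hC.posSemidef_covAt hs) (hC.posSemidef_covAt_sub hs ht)
    rwa [add_sub_cancel] at this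
  set W := flowNumerator V₀ (fun x => Phi (F x)) (covInfty Cdot) 0 with hW
  have hG : ∀ t, s ≤ t → averagedEntropy V₀ F t = W - entropyAt V₀ F t := fun t ht =>
    averagedEntropy_eq hC hV hb hF h0 hM (hs.trans ht)
  have hunit : ∀ t, s < t → IsUnit (opC Cdot t) := fun t ht => hC.isUnit_opC hs ht.le hu
  -- Gronwall is run on $W$ minus `entropyAt`, whose regularity is known. It agrees with the
  -- averaged entropy on $[s, ∞)$, which supplies the sign and the differential inequality.
  have hgr : ∀ T, s ≤ T → W - entropyAt V₀ F T ≤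
      Real.exp (∫ u in Set.Ioi s, α u) * (W - entropyAt V₀ F s) := fun T hT => by
    refine le_exp_integral_mul_of_hasDerivWithinAt (G := fun t => W - entropyAt V₀ F t)
      (fun t ht => ?_)
      (continuousOn_const.sub (continuousOn_entropyAt hC hV hb hF hK hs hprof))
      (fun t ht => (hasDerivWithinAt_entropyAt hC hV hb hF hK (hs.trans ht.le)
        (contDiff_flowRatio hC hV hb hF hK (hs.trans ht.le) (hunit t ht))
        (hprof t ht.le)).const_sub W)
      (fun t ht => ?_) (fun t ht => (hα t ht).1.le) hi hT
    · rw [← hG t ht]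
      exact averagedEntropy_nonneg hV hb hF h0 hM t
    · have ht0 := hs.trans ht.le
      have hp : ∀ φ, 0 < flowRatio V₀ F (covAt Cdot t) φ := fun φ =>
        hε0.trans_le (le_flowRatio hV hb hF hK hε _ φ)
      rw [neg_neg, ← hG t ht.le, averagedEntropy, ← integral_const_mul]
      exact integral_mono_of_nonneg
        (ae_of_all _ fun φ => dissipation_nonneg hC hV hb ht0 φ (hp φ).le)
        ((integrable_flowDensity_mul_ent hV hb hF h0 hM t _).const_mul _)
        (ae_of_all _ fun φ => dissipation_le hC hV hb ht0 (hunit t ht) (hα t ht).1 (hα t ht).2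
          hF h0 hM (hp φ))
  have hlim := le_of_tendsto
    ((tendsto_entropyAt_atTop hC hV hb hF hK hs hprof).const_sub W)
    ((eventually_ge_atTop s).mono hgr)
  have hZ := flowDensity_pos hV hb (covInfty Cdot) 0
  -- The limit as $T → ∞$ is the entropy under $ν_0$ times the partition function, which cancels the
  -- normalisation of $ν_s$.
  have e1 : W - flowDensity V₀ (covInfty Cdot) 0 * Phi (flowRatio V₀ F (covInfty Cdot) 0) =
      flowDensity V₀ (covInfty Cdot) 0 * ent (nuZero Cdot V₀) F := by
    rw [ent, integral_nuZero, integral_nuZero, mul_sub]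
    congr 1
    exact (mul_div_cancel₀ _ hZ.ne').symm
  rw [e1, ← hG s le_rfl] at hlim
  rw [integral_nu hV hb, ← averagedEntropy]
  rw [← le_div_iff₀' hZ] at hlim
  exact hlim.trans_eq (by ring)

/-- Entropy contraction along the flow. -/
theorem ent_nuZero_le (hC : IsCovarianceDecomposition Cdot) (hV : Measurable V₀)
    (hb : ∀ x, b ≤ V₀ x) {α : ℝ → ℝ} {s : ℝ} (hs : 0 ≤ s) (hu : IsUnit (opC Cdot s))
    (hα : ∀ t, s < t → 0 < α t ∧ HessianCondition Cdot V₀ t (α t))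
    (hi : IntegrableOn α (Set.Ioi s)) (hF : Measurable F) (h0 : ∀ x, 0 ≤ F x)
    (hM : ∀ x, F x ≤ M) :
    ent (nuZero Cdot V₀) F ≤ Real.exp (∫ u in Set.Ioi s, α u) *
      ∫ φ, ent (fluctuation Cdot V₀ s φ) F ∂nu Cdot V₀ s := by
  have : IsProbabilityMeasure (nuZero Cdot V₀) :=
    isProbabilityMeasure_tilted (integrable_exp_neg hV hb)
  have := isFiniteMeasure_nu (Cdot := Cdot) hV hb s
  obtain ⟨K, hK⟩ := exists_abs_Phi_le (M + 1)
  -- The inequality for $F + ε$ passes to the limit $ε → 0$ on both sides. For $ε < 1$ the inner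
  -- entropies are bounded by twice the maximum bound of $|Φ|$ on $[0, M+1]$, and $ν_s$ is finite.
  refine le_of_tendsto_of_tendsto (tendsto_ent_add_const hF h0 hM)
    (Tendsto.const_mul _ (tendsto_integral_filter_of_dominated_convergence (fun _ => K + K)
      (Eventually.of_forall fun ε =>
        (measurable_ent_fluctuation hV (hF.add_const ε) s).aestronglyMeasurable)
      ?_ (integrable_const _) (ae_of_all _ fun φ => ?_)))
    (eventually_nhdsWithin_of_forall fun ε hε =>
      ent_nuZero_le_of_pos hC hV hb hs hu hα hi (hF.add_const ε) hε
        (fun x => le_add_of_nonneg_left (h0 x)) fun x => add_le_add_left (hM x) ε)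
  · filter_upwards [Ioo_mem_nhdsGT (zero_lt_one' ℝ)] with ε hε
    exact ae_of_all _ fun φ => abs_ent_fluctuation_le hV hb (hF.add_const ε)
      (fun x => add_nonneg (h0 x) hε.1.le) (fun x => add_le_add (hM x) hε.2.le) hK s φ
  · have := isProbabilityMeasure_fluctuation hV hb s φ
    exact tendsto_ent_add_const hF h0 hM

end Contraction

end Polchinski

end

/-! ### Assembly of the three statements. -/

theorem mainTheorem2 {N : ℕ} (Cdot : ℝ → Matrix (Fin N) (Fin N) ℝ)
    (hC : Polchinski.IsCovarianceDecomposition Cdot)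
    (V₀ : Polchinski.fieldSpace Cdot → ℝ) (hV_meas : Measurable V₀)
    (hV_below : ∃ m : ℝ, ∀ x, m ≤ V₀ x) :
    -- entropic stability from a covariance bound on all exponential tilts
    (∀ (μ : Measure (Polchinski.fieldSpace Cdot)) (Sd : Polchinski.fieldSpace Cdot →L[ℝ]
        Polchinski.fieldSpace Cdot) (a : ℝ),
      IsProbabilityMeasure μ → (∀ h, Integrable (fun ζ => Real.exp ⟪h, ζ⟫) μ) →
      Sd.IsPositive → 0 < a →
      (∀ h, Sd * Polchinski.cov (Polchinski.tilt h μ) * Sd ≤ a • Sd) →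
      ∀ F : Polchinski.fieldSpace Cdot → ℝ, (∀ x, 0 ≤ F x) → Integrable F μ →
        ∫ ζ, F ζ ∂μ = 1 → Integrable (fun ζ => Polchinski.Phi (F ζ)) μ →
        Integrable (fun ζ => F ζ • ζ) μ ∧
        1 / 2 * Polchinski.quadForm Sd ((∫ ζ, F ζ • ζ ∂μ) - ∫ ζ, ζ ∂μ) ≤
          a * Polchinski.ent μ F) ∧
    -- equivalence of the two conditions, and entropic stability of the fluctuation measures
    (∀ t a : ℝ, 0 < t → IsUnit (Polchinski.opC Cdot t) → 0 < a →
      ContDiff ℝ 2 (Polchinski.renormPotential Cdot V₀ t) ∧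
      (Polchinski.HessianCondition Cdot V₀ t a ↔ Polchinski.CovarianceCondition Cdot V₀ t a) ∧
      (Polchinski.HessianCondition Cdot V₀ t a →
        ∀ F : Polchinski.fieldSpace Cdot → ℝ, Measurable F → (∀ x, 0 ≤ F x) →
          (∃ M : ℝ, ∀ x, F x ≤ M) → ∀ φ : Polchinski.fieldSpace Cdot,
          Polchinski.semigroup Cdot V₀ 0 t F φ = ∫ ζ, F ζ ∂Polchinski.fluctuation Cdot V₀ t φ ∧
          DifferentiableAt ℝ (fun ψ => √(Polchinski.semigroup Cdot V₀ 0 t F ψ)) φ ∧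
          2 * Polchinski.quadForm (Polchinski.opCdot Cdot t)
              (gradient (fun ψ => √(Polchinski.semigroup Cdot V₀ 0 t F ψ)) φ) ≤
            a * Polchinski.ent (Polchinski.fluctuation Cdot V₀ t φ) F ∧
          Polchinski.ent (Polchinski.fluctuation Cdot V₀ t φ) F =
            Polchinski.semigroup Cdot V₀ 0 t (fun x => Polchinski.Phi (F x)) φ
              - Polchinski.Phi (Polchinski.semigroup Cdot V₀ 0 t F φ))) ∧
    -- entropy contraction
    (∀ (α : ℝ → ℝ) (s : ℝ), 0 < s → IsUnit (Polchinski.opC Cdot s) →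
      (∀ t, s < t → 0 < α t ∧ Polchinski.HessianCondition Cdot V₀ t (α t)) →
      IntegrableOn α (Set.Ioi s) →
      ∀ F : Polchinski.fieldSpace Cdot → ℝ, Measurable F → (∀ x, 0 ≤ F x) →
        (∃ M : ℝ, ∀ x, F x ≤ M) →
        Integrable (fun φ => Polchinski.ent (Polchinski.fluctuation Cdot V₀ s φ) F)
          (Polchinski.nu Cdot V₀ s) ∧
        Polchinski.ent (Polchinski.nuZero Cdot V₀) F ≤
          Real.exp (∫ u in Set.Ioi s, α u) *
            ∫ φ, Polchinski.ent (Polchinski.fluctuation Cdot V₀ s φ) F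
              ∂Polchinski.nu Cdot V₀ s) := by
  obtain ⟨b, hb⟩ := hV_below
  refine ⟨fun μ Sd a hμ hexp hSd ha hcov F h0 hFi hF1 hΦ => ?_, fun t a ht hu ha => ?_,
    fun α s hs hu hα hi F hF h0 hM => ?_⟩
  · have hm := Polchinski.hasExpMoments_of_integrable_exp_inner hexp
    exact ⟨Polchinski.integrable_smul_id_of_integrable_Phi hm h0 hFi hΦ,
      Polchinski.half_quadForm_le_ent hm hSd ha hcov h0 hFi hF1 hΦ⟩
  · refine ⟨?_, Polchinski.hessianCondition_iff hC hV_meas hb ht.le hu a,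
      fun hH F hF h0 hM φ => ?_⟩
    · exact_mod_cast (hC.isCentredGaussian ht.le).contDiff_neg_log_integral hu hV_meas hb 2
    · obtain ⟨M, hM⟩ := hM
      obtain ⟨h1, h2⟩ := Polchinski.fluctuation_entropic_stability hC hV_meas hb ht.le hu ha hH
        hF h0 hM φ
      refine ⟨Polchinski.semigroup_zero_eq hV_meas hb t F φ, h1, h2, ?_⟩
      rw [Polchinski.semigroup_zero_eq hV_meas hb, Polchinski.semigroup_zero_eq hV_meas hb,
        Polchinski.ent]
  · obtain ⟨M, hM⟩ := hM
    exact ⟨Polchinski.integrable_ent_fluctuation hV_meas hb hF h0 hM s,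
      Polchinski.ent_nuZero_le hC hV_meas hb hs.le hu hα hi hF h0 hM⟩
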